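/- **Conventions.** All systems are finite-dimensional Hilbert spaces of dimension $d_A\ge 1$ with fixed orthonormal bases; $I$ is the one-dimensional system, and a word of systems denotes their tensor product. Every occurrence of a system in a type is a separate tensor factor, and factors $\mathcal H_I=\mathbb C$ and reorderings of tensor factors are suppressed. $\mathsf{Hrm}(\mathcal H)$, $\mathsf{Trl}(\mathcal H)$ and $\mathsf I=\mathbb R\mathds 1$ are the real spaces of Hermitian operators, of traceless Hermitian operators, and of real multiples of the identity. For a real subspace $\Delta\subseteq\mathsf{Hrm}(\mathcal H)$, $\Delta^\perp$ and $\overline\Delta$ are its Hilbert–Schmidt orthogonal complements in $\mathsf{Hrm}(\mathcal H)$ and (intersecting with traceless operators) in $\mathsf{Trl}(\mathcal H)$. $\oplus$ denotes the internal sum of subspaces. The link product of $N\in\mathcal L(\mathcal H_{\mathsf A}\otimes\mathcal H_{\mathsf S})$ and $M\in\mathcal L(\mathcal H_{\mathsf S}\otimes\mathcal H_{\mathsf B})$ is $N*M=\operatorname{Tr}_{\mathsf S}[(\mathds 1_{\mathsf A}\otimes M^{T_{\mathsf S}})(N\otimes\mathds 1_{\mathsf B})]$. **Types and events.** Types are generated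 from the elementary types $w$ (a word of systems) and $\hat X u\to\hat Y v$ ($u,v$ words, $X,Y$ systems with $d_X=d_Y$) by the rule that $x\to y$ is a type if $x,y$ are. $\mathcal H_x$ is the tensor product of all systems occurring in $x$, and $d_x=\dim\mathcal H_x$; put $\overline x=x\to I$. The extension $x\|E$ by a system $E$ is $wE$, $\hat Xu\to\hat YvE$, $x\to(y\|E)$ in the three cases. The sets $\mathsf T_1(x)\subseteq T(x)\subseteq\mathcal L(\mathcal H_x)$ of deterministic and admissible events are defined recursively: - $\mathsf T_1(w)=\{M\ge0:\operatorname{Tr}M=1\}$; $\mathsf T_1(\hat Xu\to\hat Yv)=\{M\ge 0:\operatorname{Tr}_{Yv}M=\mathds 1_{Xu},\ \operatorname{Tr}_{Xv}M=\mathds 1_{Yu}\}$; for elementary $x$, $T(x)=\{M:0\le M\le D\text{ for some }D\in\mathsf T_1(x)\}$. - For $M\in\mathcal L(\mathcal H_x\otimes\mathcal H_y)$ let $\mathcal M(O)=\operatorname{Tr}_x[(O^T\otimes\mathds 1_y)M]$. Say that $M$ preserves $T$ (resp. $\mathsf T_1$) if $(\mathcal M\otimes\mathcal I_E)$ maps $T(x\|E)$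 into $T(y\|E)$ (resp. $\mathsf T_1(x\|E)$ into $\mathsf T_1(y\|E)$) for every system $E$. Then $M\in\mathsf T_1(x\to y)$ iff $M$ preserves $T$ and $\mathsf T_1$; and $M\in T(x\to y)$ iff $M$ preserves $T$ and there are finitely many (possibly no) $N_i$ preserving $T$ such that $M+\sum_iN_i$ preserves $T$ and $\mathsf T_1$. The numbers $\lambda_x$ and subspaces $\Delta_x\subseteq\mathsf{Hrm}(\mathcal H_x)$ are defined recursively by $\lambda_w=d_w^{-1}$, $\lambda_{\hat Xu\to\hat Yv}=(d_Yd_v)^{-1}$, $\lambda_{x\to y}=\lambda_y/(d_x\lambda_x)$, and $$\Delta_w=\mathsf{Trl}(\mathcal H_w),\qquad \Delta_{\hat Xu\to\hat Yv}=\mathsf{Hrm}(\mathcal H_{XuY})\otimes\mathsf{Trl}(\mathcal H_v)\oplus\mathsf{Trl}(\mathcal H_X)\otimes\mathsf{Hrm}(\mathcal H_u)\otimes\mathsf{Trl}(\mathcal H_Y)\otimes\mathsf I_v,$$ $$\Delta_{x\to y}=\mathsf{Hrm}(\mathcal H_x)\otimes\Delta_y\oplus\overline\Delta_x\otimes\Delta_y^\perp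 .$$ **Networks.** Let $n\ge1$, let $x_1,\dots,x_n$ be types and $E_0,E_n$ systems. An operator $R\in\mathcal L(\mathcal H_{E_0}\otimes\bigotimes_{i=1}^n\mathcal H_{x_i}\otimes\mathcal H_{E_n})$ is a *deterministic network of $n$ higher-order maps* of types $x_1,\dots,x_n$ if there are systems $E_1,\dots,E_{n-1}$ and $M_i\in\mathsf T_1(\overline{x_i}\to(E_{i-1}\to E_i))$ with $R=M_1*M_2*\dots*M_n$. Given systems with $d_{A_i}=d_{B_i}$, a *bi-tooth $n$-comb* is such a network with $x_i=\hat A_i\to\hat B_i$ and $E_0,E_n$ trivial, and a *bi-slot $n$-comb* is such a network with $x_i=(\hat A_i\to\hat B_i)\to I$, $E_0=P$, $E_n=F$. For subspaces $U_i\subseteq \mathsf{Hrm}(\mathcal K_i)$, $1\le i\le n$, write $\operatorname{St}_i(U)=\bigotimes_{j<i}\mathsf{Hrm}(\mathcal K_j)\otimes U_i\otimes\bigotimes_{j>i}\mathsf I_{\mathcal K_j}$. **Proposition.** 1. $R$ is a deterministic network of $n$ higher-order maps of types $x_1,\dots,x_n$ if and only if $R\ge0$ and $R=\lambda\mathds 1+X$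 with $\lambda=d_{E_n}^{-1}\prod_{i=1}^n\lambda_{x_i}$ and $X\in\Delta_{\mathtt{HN}_n}$, where $$\Delta_{\mathtt{HN}_n}=\mathsf{Hrm}(\mathcal H_{E_0})\otimes\Bigl[\bigotimes_{i=1}^n\mathsf{Hrm}(\mathcal H_{x_i})\otimes\mathsf{Trl}(\mathcal H_{E_n})\oplus\bigoplus_{i=1}^n\operatorname{St}_i(\Delta_{x_1},\dots,\Delta_{x_n})\otimes\mathsf I_{E_n}\Bigr].$$ 2. $R\in\mathcal L(\bigotimes_i\mathcal H_{A_iB_i})$ is a bi-tooth $n$-comb if and only if $R\ge0$ and $R=\bigl(\prod_{i}d_{B_i}\bigr)^{-1}\mathds 1+X$ with $X\in\bigoplus_{i=1}^n\operatorname{St}_i\bigl((\Delta_{\hat A_j\to\hat B_j})_j\bigr)$. 3. $R\in\mathcal L(\mathcal H_P\otimes\bigotimes_i\mathcal H_{A_iB_i}\otimes\mathcal H_F)$ is a bi-slot $n$-comb if and only if $R\ge0$ and $R=\bigl(d_F\prod_{i}d_{A_i}\bigr)^{-1}\mathds 1+X$ with $$X\in\mathsf{Hrm}(\mathcal H_P)\otimes\Bigl[\bigotimes_{i}\mathsf{Hrm}(\mathcal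 H_{A_iB_i})\otimes\mathsf{Trl}(\mathcal H_F)\oplus\bigoplus_{i=1}^n\operatorname{St}_i\bigl((\overline\Delta_{\hat A_j\to\hat B_j})_j\bigr)\otimes\mathsf I_F\Bigr].$$ 4. For all systems $A,B,E,E'$ with $d_A=d_B$, $\mathsf T_1(\overline{\hat A\to\hat B}\to(E\to E'))=\mathsf T_1(\hat AE\to\hat BE')$. Consequently $R$ is a bi-tooth $n$-comb if and only if $R=N_1*\dots*N_n$ for some systems $E_0=I,E_1,\dots,E_{n-1},E_n=I$ and partially bistochastic channels $N_i\in\mathsf T_1(\hat A_iE_{i-1}\to\hat B_iE_i)$. 5. $R$ is a bi-slot $n$-comb if and only if $R=N_1*\dots*N_n$ for some systems $E_0=P,E_1,\dots,E_{n-1},E_n=F$ and bistochastic supermaps $N_i\in\mathsf T_1((\hat A_i\to\hat B_i)\to(E_{i-1}\to E_i))$. -/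

import Mathlib

open scoped Kronecker ComplexOrder

noncomputable section

namespace HOQ

/-! ### Operators on finite-dimensional systems, in fixed orthonormal bases -/

/-- Linear operators on the Hilbert space with orthonormal basis `ι`. -/
abbrev Op (ι : Type) : Type := Matrix ι ι ℂ

variable {α β σ : Type}

/-- Partial trace over the second tensor factor. -/
def ptrR [Fintype β] (M : Op (α × β)) : Op α :=
  Matrix.of fun a a' => ∑ b, M (a, b) (a', b)

/-- Partial trace over the first tensor factor. -/
def ptrL [Fintype α] (M : Op (α × β)) : Op β :=
  Matrix.of fun b b' => ∑ a, M (a, b) (a, b')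

/-- Partial transpose on the first tensor factor. -/
def ptransL (M : Op (σ × β)) : Op (σ × β) :=
  Matrix.of fun p q => M (q.1, p.2) (p.1, q.2)

/-- The link product of operators on `α ⊗ σ` and `σ ⊗ β` sharing the system `σ`:
`N * M = Tr_σ [(1_α ⊗ M^{T_σ}) (N ⊗ 1_β)]`, an operator on `α ⊗ β`. -/
def link [Fintype α] [DecidableEq α] [Fintype β] [DecidableEq β] [Fintype σ]
    (N : Op (α × σ)) (M : Op (σ × β)) : Op (α × β) :=
  let M' : Op ((α × β) × σ) :=
    ((1 : Op α) ⊗ₖ ptransL M).submatrix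
      (fun p => (p.1.1, (p.2, p.1.2))) (fun p => (p.1.1, (p.2, p.1.2)))
  let N' : Op ((α × β) × σ) :=
    (N ⊗ₖ (1 : Op β)).submatrix
      (fun p => ((p.1.1, p.2), p.1.2)) (fun p => ((p.1.1, p.2), p.1.2))
  ptrR (M' * N')

/-- The linear map with Choi operator `M`, `O ↦ Tr_α [(Oᵀ ⊗ 1_β) M]`. -/
def applyChoi [Fintype α] [Fintype β] [DecidableEq β] (M : Op (α × β)) (O : Op α) : Op β :=
  ptrL ((O.transpose ⊗ₖ (1 : Op β)) * M)

/-- The map `𝓜 ⊗ 𝓘_ε`, where `𝓜` has Choi operator `M`: `𝓜` acts on every `ε`-block. -/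
def applyChoiExt {ε : Type} [Fintype α] [Fintype β] [DecidableEq β]
    (M : Op (α × β)) (ρ : Op (α × ε)) : Op (β × ε) :=
  Matrix.of fun p q =>
    applyChoi M (Matrix.of fun a a' => ρ (a, p.2) (a', q.2)) p.1 q.1

/-- `0 ≤ M ≤ D` for some `D ∈ S`. -/
def dominated (S : Set (Op α)) : Set (Op α) :=
  {M | M.PosSemidef ∧ ∃ D ∈ S, (D - M).PosSemidef}

/-! ### Real subspaces of Hermitian operators -/

/-- Hermitian operators. -/
def Hrm (ι : Type) : Submodule ℝ (Op ι) where
  carrier := {X | X.IsHermitian}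
  add_mem' h₁ h₂ := h₁.add h₂
  zero_mem' := Matrix.isHermitian_zero
  smul_mem' c X hX := by
    have hX' : X.conjTranspose = X := hX
    change (c • X).conjTranspose = c • X
    rw [Matrix.conjTranspose_smul, hX', star_trivial]

/-- Traceless Hermitian operators. -/
def Trl (ι : Type) [Fintype ι] : Submodule ℝ (Op ι) where
  carrier := {X | X.IsHermitian ∧ X.trace = 0}
  add_mem' h₁ h₂ := ⟨h₁.1.add h₂.1, by rw [Matrix.trace_add, h₁.2, h₂.2, add_zero]⟩
  zero_mem' := ⟨Matrix.isHermitian_zero, Matrix.trace_zero _ _⟩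
  smul_mem' c _ hX := ⟨(Hrm ι).smul_mem c hX.1, by rw [Matrix.trace_smul, hX.2, smul_zero]⟩

/-- The line spanned by the identity. -/
def IdSp (ι : Type) [DecidableEq ι] : Submodule ℝ (Op ι) := Submodule.span ℝ {1}

/-- Orthogonal complement in the Hermitian operators for the Hilbert-Schmidt inner product. -/
def perp {ι : Type} [Fintype ι] (U : Submodule ℝ (Op ι)) : Submodule ℝ (Op ι) where
  carrier := {Y | Y.IsHermitian ∧ ∀ X ∈ U, (X * Y).trace = 0}
  add_mem' h₁ h₂ := ⟨h₁.1.add h₂.1, fun X hX => by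
    rw [Matrix.mul_add, Matrix.trace_add, h₁.2 X hX, h₂.2 X hX, add_zero]⟩
  zero_mem' := ⟨Matrix.isHermitian_zero, fun X _ => by simp⟩
  smul_mem' c _ hY := ⟨(Hrm ι).smul_mem c hY.1, fun X hX => by
    rw [Matrix.mul_smul, Matrix.trace_smul, hY.2 X hX, smul_zero]⟩

/-- Orthogonal complement in the traceless Hermitian operators. -/
def bar {ι : Type} [Fintype ι] (U : Submodule ℝ (Op ι)) : Submodule ℝ (Op ι) :=
  perp U ⊓ Trl ι

/-- Tensor product of two subspaces. -/
def tens (U : Submodule ℝ (Op α)) (V : Submodule ℝ (Op β)) : Submodule ℝ (Op (α × β)) :=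
  Submodule.span ℝ {Z | ∃ A ∈ U, ∃ B ∈ V, Z = A ⊗ₖ B}

/-- The tensor product `⨂ i, A i` of a finite family of operators. -/
def piKron {m : ℕ} {κ : Fin m → Type} (A : ∀ i, Op (κ i)) : Op (∀ i, κ i) :=
  Matrix.of fun a b => ∏ i, A i (a i) (b i)

/-- Tensor product of a finite family of subspaces. -/
def piTens {m : ℕ} {κ : Fin m → Type} (U : ∀ i, Submodule ℝ (Op (κ i))) :
    Submodule ℝ (Op (∀ i, κ i)) :=
  Submodule.span ℝ {Z | ∃ A : ∀ i, Op (κ i), (∀ i, A i ∈ U i) ∧ Z = piKron A}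

/-! ### Types -/

/-- Finite words of elementary systems, extended on the right. A system enters only through its
dimension, and every occurrence of a system is a tensor factor of its own. -/
inductive Word : Type
  | nil : Word
  | snoc (w : Word) (d : ℕ+) : Word

/-- The one-letter word made of the trivial system. -/
def Word.triv : Word := .snoc .nil 1

/-- Orthonormal basis of the Hilbert space of a word. -/
def Word.Idx : Word → Type
  | .nil => Unit
  | .snoc w d => w.Idx × Fin d

instance Word.instFintypeIdx : (w : Word) → Fintype w.Idx
  | .nil => inferInstanceAs (Fintype Unit)
  | .snoc w d =>
    letI := Word.instFintypeIdx w
    inferInstanceAs (Fintype (w.Idx × Fin d))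

instance Word.instDecidableEqIdx : (w : Word) → DecidableEq w.Idx
  | .nil => inferInstanceAs (DecidableEq Unit)
  | .snoc w d =>
    letI := Word.instDecidableEqIdx w
    inferInstanceAs (DecidableEq (w.Idx × Fin d))

/-- Types of higher-order maps. `sys w` is the type of states of `w`; `bist d u v` is the elementary
type `X̂u → Ŷv` of partially bistochastic channels, with `d_X = d_Y = d`; `arr x y` is `x → y`. -/
inductive Ty : Type
  | sys (w : Word) : Ty
  | bist (d : ℕ+) (u v : Word) : Ty
  | arr (x y : Ty) : Ty

namespace Ty

/-- Orthonormal basis of `𝓗_x`. -/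
def Idx : Ty → Type
  | sys w => w.Idx
  | bist d u v => (Fin d × u.Idx) × (Fin d × v.Idx)
  | arr x y => x.Idx × y.Idx

instance instFintypeIdx : (x : Ty) → Fintype x.Idx
  | sys w => inferInstanceAs (Fintype w.Idx)
  | bist d u v => inferInstanceAs (Fintype ((Fin d × u.Idx) × (Fin d × v.Idx)))
  | arr x y =>
    letI := instFintypeIdx x
    letI := instFintypeIdx y
    inferInstanceAs (Fintype (x.Idx × y.Idx))

instance instDecidableEqIdx : (x : Ty) → DecidableEq x.Idx
  | sys w => inferInstanceAs (DecidableEq w.Idx)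
  | bist d u v => inferInstanceAs (DecidableEq ((Fin d × u.Idx) × (Fin d × v.Idx)))
  | arr x y =>
    letI := instDecidableEqIdx x
    letI := instDecidableEqIdx y
    inferInstanceAs (DecidableEq (x.Idx × y.Idx))

/-- The type `x̄ = x → I` of functionals on `x`. -/
def func (x : Ty) : Ty := arr x (sys Word.triv)

/-- The extension `x ‖ E` of a type by an elementary system. -/
def ext : Ty → ℕ+ → Ty
  | sys w, E => sys (w.snoc E)
  | bist d u v, E => bist d u (v.snoc E)
  | arr x y, E => arr x (ext y E)

/-- `𝓗_{x ‖ E} = 𝓗_x ⊗ 𝓗_E`. -/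
def extEquiv : (x : Ty) → (E : ℕ+) → (x.ext E).Idx ≃ x.Idx × Fin E
  | sys w, E => Equiv.refl (w.Idx × Fin E)
  | bist d u v, E =>
    show (Fin d × u.Idx) × (Fin d × (v.Idx × Fin E)) ≃
        ((Fin d × u.Idx) × (Fin d × v.Idx)) × Fin E from
      { toFun := fun p => ((p.1, (p.2.1, p.2.2.1)), p.2.2.2)
        invFun := fun p => (p.1.1, (p.1.2.1, (p.1.2.2, p.2)))
        left_inv := fun _ => rfl
        right_inv := fun _ => rfl }
  | arr x y, E =>
    ((Equiv.refl x.Idx).prodCongr (extEquiv y E)).trans (Equiv.prodAssoc x.Idx y.Idx (Fin E)).symm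

/-- Nesting depth of arrows. -/
def depth : Ty → ℕ
  | sys _ => 0
  | bist _ _ _ => 0
  | arr x y => max x.depth y.depth + 1

theorem depth_ext : ∀ (x : Ty) (E : ℕ+), (x.ext E).depth = x.depth
  | sys _, _ => rfl
  | bist _ _ _, _ => rfl
  | arr x y, E => by simp only [ext, depth, depth_ext y E]

/-- The action `𝓜 ⊗ 𝓘_E : T_ℝ(x ‖ E) → T_ℝ(y ‖ E)` of the operator `M` of type `x → y`. -/
def act (x y : Ty) (E : ℕ+) (M : Op (x.Idx × y.Idx)) (ρ : Op (x.ext E).Idx) : Op (y.ext E).Idx :=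
  (applyChoiExt M (ρ.submatrix (x.extEquiv E).symm (x.extEquiv E).symm)).submatrix
    (y.extEquiv E) (y.extEquiv E)

/-- Deterministic events of type `w`: density operators. -/
def detSys (w : Word) : Set (Op w.Idx) := {M | M.PosSemidef ∧ M.trace = 1}

/-- Deterministic events of type `X̂u → Ŷv`: `M ≥ 0`, `Tr_{Yv} M = 1_{Xu}`, `Tr_{Xv} M = 1_{Yu}`. -/
def detBist (d : ℕ+) (u v : Word) : Set (Op ((Fin d × u.Idx) × (Fin d × v.Idx))) :=
  {M | M.PosSemidef ∧ ptrR M = 1 ∧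
    ptrR (M.submatrix
      (fun p : (Fin d × u.Idx) × (Fin d × v.Idx) => ((p.2.1, p.1.2), (p.1.1, p.2.2)))
      (fun p : (Fin d × u.Idx) × (Fin d × v.Idx) => ((p.2.1, p.1.2), (p.1.1, p.2.2)))) = 1}

/-- The pair (admissible events, deterministic events) of a type. -/
def events : (x : Ty) → Set (Op x.Idx) × Set (Op x.Idx)
  | sys w => (dominated (detSys w), detSys w)
  | bist d u v => (dominated (detBist d u v), detBist d u v)
  | arr x y =>
    let pres : Op (x.Idx × y.Idx) → Prop := fun M =>
      ∀ E : ℕ+, ∀ ρ ∈ (events (x.ext E)).1, act x y E M ρ ∈ (events (y.ext E)).1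
    let presDet : Op (x.Idx × y.Idx) → Prop := fun M =>
      ∀ E : ℕ+, ∀ ρ ∈ (events (x.ext E)).2, act x y E M ρ ∈ (events (y.ext E)).2
    ({M : Op (x.Idx × y.Idx) | pres M ∧ ∃ (k : ℕ) (N : Fin k → Op (x.Idx × y.Idx)),
        (∀ i, pres (N i)) ∧ pres (M + ∑ i, N i) ∧ presDet (M + ∑ i, N i)},
      {M : Op (x.Idx × y.Idx) | pres M ∧ presDet M})
termination_by x => x.depth
decreasing_by
  all_goals
    rw [depth_ext, depth]
    omega

/-- Deterministic events of type `x`. -/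
def T1 (x : Ty) : Set (Op x.Idx) := (events x).2

/-- The coefficient `λ_x`. -/
def lam : Ty → ℝ
  | sys w => 1 / (Fintype.card w.Idx : ℝ)
  | bist d _ v => 1 / ((d : ℝ) * (Fintype.card v.Idx : ℝ))
  | arr x y => lam y / ((Fintype.card x.Idx : ℝ) * lam x)

/-- The subspace `Δ_x`. In the case `X̂u → Ŷv` the factors are ordered as `(X ⊗ u) ⊗ (Y ⊗ v)`, so
`Hrm(XuY) ⊗ Trl(v)` is written `Hrm(Xu) ⊗ (Hrm(Y) ⊗ Trl(v))`. -/
def Delta : (x : Ty) → Submodule ℝ (Op x.Idx)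
  | sys w => Trl w.Idx
  | bist d u v =>
    (tens (Hrm (Fin d × u.Idx)) (tens (Hrm (Fin d)) (Trl v.Idx)) ⊔
      tens (tens (Trl (Fin d)) (Hrm u.Idx)) (tens (Trl (Fin d)) (IdSp v.Idx)) :
      Submodule ℝ (Op ((Fin d × u.Idx) × (Fin d × v.Idx))))
  | arr x y =>
    (tens (Hrm x.Idx) (Delta y) ⊔ tens (bar (Delta x)) (perp (Delta y)) :
      Submodule ℝ (Op (x.Idx × y.Idx)))

end Ty

/-! ### Networks -/

/-- `SeqComp node P F R`: there are systems `P = E₀, E₁, …, Eₙ₊₁ = F` and operators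
`Mᵢ` on `Eᵢ ⊗ κᵢ ⊗ Eᵢ₊₁` (`i = 0, …, n`) with `node i Eᵢ Eᵢ₊₁ Mᵢ`, such that `R` is the link product
`(⋯(M₀ * M₁) * ⋯) * Mₙ`, an operator on `P ⊗ (⨂ᵢ κᵢ) ⊗ F`. -/
def SeqComp : {n : ℕ} → {κ : Fin (n + 1) → Type} → [∀ i, Fintype (κ i)] →
    [∀ i, DecidableEq (κ i)] →
    (node : ∀ (i : Fin (n + 1)) (E E' : Word), Op (E.Idx × κ i × E'.Idx) → Prop) →
    (P F : Word) → Op (P.Idx × (∀ i, κ i) × F.Idx) → Prop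
  | 0, κ, _, _, node, P, F, R =>
    ∃ M : Op (P.Idx × κ 0 × F.Idx), node 0 P F M ∧
      R = M.submatrix (fun p => (p.1, p.2.1 0, p.2.2)) (fun p => (p.1, p.2.1 0, p.2.2))
  | n + 1, κ, _, _, node, P, F, R =>
    ∃ (E : Word) (S : Op (P.Idx × (∀ i : Fin (n + 1), κ i.castSucc) × E.Idx))
      (M : Op (E.Idx × κ (Fin.last (n + 1)) × F.Idx)),
      SeqComp (κ := fun i : Fin (n + 1) => κ i.castSucc) (fun i => node i.castSucc) P E S ∧
      node (Fin.last (n + 1)) E F M ∧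
      R = (link
          (S.submatrix
            (fun p : (P.Idx × (∀ i : Fin (n + 1), κ i.castSucc)) × E.Idx => (p.1.1, p.1.2, p.2))
            (fun p => (p.1.1, p.1.2, p.2))) M).submatrix
        (fun p => ((p.1, fun i => p.2.1 i.castSucc), (p.2.1 (Fin.last (n + 1)), p.2.2)))
        (fun p => ((p.1, fun i => p.2.1 i.castSucc), (p.2.1 (Fin.last (n + 1)), p.2.2)))

/-- `M ∈ T₁(x̄ → (E → F))`, for `M` an operator on `E ⊗ x ⊗ F`. -/
def IsNode (x : Ty) (E F : Word) (M : Op (E.Idx × x.Idx × F.Idx)) : Prop :=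
  let f : (x.Idx × Word.triv.Idx) × (E.Idx × F.Idx) → E.Idx × x.Idx × F.Idx :=
    fun p => (p.2.1, p.1.1, p.2.2)
  (M.submatrix f f) ∈ (Ty.arr x.func (Ty.arr (Ty.sys E) (Ty.sys F))).T1

/-- Deterministic networks of `n + 1` higher-order maps of types `x 0, …, x n`. -/
def IsNetwork {n : ℕ} (x : Fin (n + 1) → Ty) (P F : Word)
    (R : Op (P.Idx × (∀ i, (x i).Idx) × F.Idx)) : Prop :=
  SeqComp (κ := fun i => (x i).Idx) (fun i E E' M => IsNode (x i) E E' M) P F R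

/-- `(⨂_{j<i} Hrm) ⊗ U_i ⊗ (⨂_{j>i} I)`. -/
def stair {m : ℕ} {κ : Fin m → Type} [∀ i, DecidableEq (κ i)]
    (U : ∀ i, Submodule ℝ (Op (κ i))) (i : Fin m) : Submodule ℝ (Op (∀ j, κ j)) :=
  piTens fun j => if j < i then Hrm (κ j) else if j = i then U j else IdSp (κ j)

/-- `Hrm(P) ⊗ [⨂ᵢ Hrm(κᵢ) ⊗ Trl(F) ⊕ ⨁ᵢ (⨂_{j<i} Hrm ⊗ Uᵢ ⊗ ⨂_{j>i} I) ⊗ I_F]`. -/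
def DeltaNet {m : ℕ} {κ : Fin m → Type} [∀ i, DecidableEq (κ i)]
    (U : ∀ i, Submodule ℝ (Op (κ i))) (P F : Word) :
    Submodule ℝ (Op (P.Idx × (∀ i, κ i) × F.Idx)) :=
  tens (Hrm P.Idx)
    (tens (piTens fun i => Hrm (κ i)) (Trl F.Idx) ⊔ ⨆ i, tens (stair U i) (IdSp F.Idx))

/-! ### Bi-tooth and bi-slot combs -/

/-- The type `Â → B̂` with `d_A = d_B = d`. -/
def bi (d : ℕ+) : Ty := Ty.bist d .nil .nil

/-- An operator on `⨂ᵢ κᵢ` as an operator on `I ⊗ (⨂ᵢ κᵢ) ⊗ I`. -/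
def padTriv {m : ℕ} {κ : Fin m → Type} (R : Op (∀ i, κ i)) :
    Op (Word.triv.Idx × (∀ i, κ i) × Word.triv.Idx) :=
  R.submatrix (fun p => p.2.1) (fun p => p.2.1)

/-- Bi-tooth `(n + 1)`-combs: networks of types `Âᵢ → B̂ᵢ` with trivial end systems. -/
def IsBiTooth {n : ℕ} (d : Fin (n + 1) → ℕ+) (R : Op (∀ i, (bi (d i)).Idx)) : Prop :=
  IsNetwork (fun i => bi (d i)) Word.triv Word.triv (padTriv R)

/-- Bi-slot `(n + 1)`-combs: networks of types `(Âᵢ → B̂ᵢ) → I`. -/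
def IsBiSlot {n : ℕ} (d : Fin (n + 1) → ℕ+) (P F : Word)
    (R : Op (P.Idx × (∀ i, (bi (d i)).Idx) × F.Idx)) : Prop :=
  let f : P.Idx × (∀ i, (bi (d i)).Idx × Word.triv.Idx) × F.Idx →
      P.Idx × (∀ i, (bi (d i)).Idx) × F.Idx := fun p => (p.1, fun i => (p.2.1 i).1, p.2.2)
  IsNetwork (fun i => (bi (d i)).func) P F (R.submatrix f f)

/-- `M ∈ T₁(ÂE → B̂F)`: `M` is an `A`-`B` bistochastic channel from `AE` to `BF`, given as an
operator on `E ⊗ (A ⊗ B) ⊗ F`. -/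
def IsBiChannel (d : ℕ+) (E F : Word) (M : Op (E.Idx × (bi d).Idx × F.Idx)) : Prop :=
  let f : (Fin d × E.Idx) × (Fin d × F.Idx) → E.Idx × (bi d).Idx × F.Idx :=
    fun p => (p.1.2, ((p.1.1, ()), (p.2.1, ())), p.2.2)
  (M.submatrix f f) ∈ (Ty.bist d E F).T1

/-- `M ∈ T₁((Â → B̂) → (E → F))`: `M` is a bistochastic supermap, given as an operator on
`E ⊗ (A ⊗ B) ⊗ F`. -/
def IsBiSupermap (d : ℕ+) (E F : Word) (M : Op (E.Idx × (bi d).Idx × F.Idx)) : Prop :=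
  let f : (bi d).Idx × (E.Idx × F.Idx) → E.Idx × (bi d).Idx × F.Idx :=
    fun p => (p.2.1, p.1, p.2.2)
  (M.submatrix f f) ∈ (Ty.arr (bi d) (Ty.arr (Ty.sys E) (Ty.sys F))).T1

end HOQ

end

set_option linter.unusedSectionVars false

open scoped Kronecker ComplexOrder

noncomputable section

namespace HOQ

/-! ### The trace form on Hermitian operators -/

section TraceForm

variable {ι : Type} [Fintype ι]

/-! Everything rests on one description of deterministic events: `Ty.mem_T1_iff` identifies them
with the positive operators in the affine space `λ_x 1 + Δ_x`. Membership in such a space is tested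
by traces against the orthogonal complement of `Δ_x`, so the recursion for `Δ_{x→y}` is the dual
form of "affine space into affine space" (`isAff_arrow_iff`). Preservation of admissible events
under all extensions forces positivity of the Choi operator, by feeding in a multiple of the
maximally entangled operator. Conversely, extending by `E` costs nothing beyond positivity, because
the affine condition on `x ‖ E` only sees the marginal on `x` (`Ty.aff_ext_iff`). Since `λ_x 1` is
an interior point, deterministic events affinely span the whole affine space.

For a node of type `x̄ → (E → E')` the two bars cancel (`bar_bar`), and the condition becomes
`IsNodeOf`: contracting the `x` factor with any `Y ⊥ Δ_x` and tracing out `E'` leaves `λ_x Tr(Y)`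
times the identity of `E` (`isNode_iff`). Bistochastic supermaps satisfy the same condition with `Δ`
replaced by its bar, and partially bistochastic channels satisfy it with the space of `Â → B̂`. All
the composition statements are therefore instances of a single theorem about `IsNodeOf`.

That theorem, `seqComp_iff`, is an induction on the number of nodes. The staircase space has a
matching recursion (`isNetAff_succ`): contracting the last slot with `Y ⊥ U` must give `l Tr(Y) T`
with one fixed `T` satisfying the constraint of the shorter network. In a composite this holds
because the last node turns the link into a partial trace over the memory
(`rslice_link_of_isNodeOf`). Conversely, given such a positive `R`, purify `T` into a memory that is
a copy of the past, and let the last node be `T^{-1/2} R T^{-1/2}`, completed off the support of `T`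
(`exists_link_self`). -/

theorem trace_mul_im {X Y : Op ι} (hX : X.IsHermitian) (hY : Y.IsHermitian) :
    (X * Y).trace.im = 0 := by
  have h : star (X * Y).trace = (X * Y).trace := by
    rw [← Matrix.trace_conjTranspose, Matrix.conjTranspose_mul, hX.eq, hY.eq, Matrix.trace_mul_comm]
  exact Complex.conj_eq_iff_im.mp h

theorem trace_mul_ofReal {X Y : Op ι} (hX : X.IsHermitian) (hY : Y.IsHermitian) :
    (((X * Y).trace.re : ℝ) : ℂ) = (X * Y).trace :=
  Complex.ext (by simp) (by simp [trace_mul_im hX hY])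

/-- The real bilinear form `Re Tr (X Y)`. -/
def trForm (ι : Type) [Fintype ι] : LinearMap.BilinForm ℝ (Op ι) :=
  LinearMap.mk₂ ℝ (fun X Y => (X * Y).trace.re)
    (fun X X' Y => by simp [Matrix.add_mul])
    (fun c X Y => by simp)
    (fun X Y Y' => by simp [Matrix.mul_add])
    (fun c X Y => by simp)

theorem trForm_apply (X Y : Op ι) : trForm ι X Y = (X * Y).trace.re := rfl

theorem trForm_self_pos {X : Op ι} (hX : X.IsHermitian) (h0 : X ≠ 0) : 0 < trForm ι X X := by
  have h := (Matrix.posSemidef_conjTranspose_mul_self X).trace_nonneg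
  have h1 : (X.conjTranspose * X).trace ≠ 0 := fun h =>
    h0 (Matrix.trace_conjTranspose_mul_self_eq_zero_iff.mp h)
  rw [hX.eq] at h h1
  rw [trForm_apply]
  exact (Complex.pos_iff.mp (lt_of_le_of_ne h h1.symm)).1

/-- Every space of Hermitian operators has an orthonormal family for the trace form. -/
theorem exists_orthonormal {U : Submodule ℝ (Op ι)} (hU : U ≤ Hrm ι) :
    ∃ (m : ℕ) (q : Fin m → Op ι), (∀ k, q k ∈ U) ∧
      ∀ Y ∈ U, Y = ∑ k, (Y * q k).trace • q k := by
  have hsymm : LinearMap.IsSymm ((trForm ι).restrict U) :=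
    ⟨fun X Y => by
      simp only [LinearMap.BilinForm.restrict_apply, trForm_apply, LinearMap.domRestrict_apply]
      rw [Matrix.trace_mul_comm]
      rfl⟩
  obtain ⟨v, hv⟩ := LinearMap.BilinForm.exists_orthogonal_basis hsymm
  have hpos : ∀ k, 0 < trForm ι (v k : Op ι) (v k) := fun k =>
    trForm_self_pos (hU (v k).2) (fun h => v.ne_zero k (Subtype.ext h))
  have horth : ∀ j k, j ≠ k → trForm ι (v j : Op ι) (v k) = 0 := fun j k hjk => hv hjk
  -- The form is positive definite on Hermitian operators, so an orthogonal basis can be normalised.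
  -- The coefficients are complex traces in the statement, but they are real.
  refine ⟨_, fun k => (Real.sqrt (trForm ι (v k : Op ι) (v k)))⁻¹ • (v k : Op ι),
    fun k => U.smul_mem _ (v k).2, fun Y hY => ?_⟩
  have hrepr : Y = ∑ k, v.repr ⟨Y, hY⟩ k • (v k : Op ι) := by
    have h := congrArg Subtype.val (v.sum_repr ⟨Y, hY⟩)
    rw [Submodule.coe_sum] at h
    exact h.symm
  have hcoef : ∀ k, trForm ι Y (v k) = v.repr ⟨Y, hY⟩ k * trForm ι (v k : Op ι) (v k) := by
    intro k
    conv_lhs => rw [hrepr]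
    rw [map_sum, LinearMap.sum_apply, Finset.sum_eq_single k]
    · simp
    · intro j _ hj
      simp [horth j k hj]
    · simp
  conv_lhs => rw [hrepr]
  refine Finset.sum_congr rfl fun k _ => ?_
  rw [Matrix.mul_smul, Matrix.trace_smul, ← trace_mul_ofReal (hU hY) (hU (v k).2),
    ← trForm_apply, hcoef k]
  have hs := Real.mul_self_sqrt (hpos k).le
  have hs0 : Real.sqrt (trForm ι (v k : Op ι) (v k)) ≠ 0 := (Real.sqrt_pos.mpr (hpos k)).ne'
  set s := Real.sqrt (trForm ι (v k : Op ι) (v k)) with hsdef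
  rw [← hs]
  ext a b
  simp only [Matrix.smul_apply, Complex.real_smul, smul_eq_mul]
  push_cast
  have hs0' : (s : ℂ) ≠ 0 := by exact_mod_cast hs0
  rw [← hsdef]
  field_simp

theorem mem_perp {U : Submodule ℝ (Op ι)} {Y : Op ι} :
    Y ∈ perp U ↔ Y.IsHermitian ∧ ∀ X ∈ U, (X * Y).trace = 0 := Iff.rfl

theorem perp_le_Hrm (U : Submodule ℝ (Op ι)) : perp U ≤ Hrm ι := fun _ h => h.1

theorem Trl_le_Hrm : Trl ι ≤ Hrm ι := fun _ h => h.1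

theorem bar_le_Trl (U : Submodule ℝ (Op ι)) : bar U ≤ Trl ι := inf_le_right

theorem exists_add_perp {U : Submodule ℝ (Op ι)} (hU : U ≤ Hrm ι) {Z : Op ι}
    (hZ : Z.IsHermitian) : ∃ A ∈ U, ∃ B ∈ perp U, Z = A + B := by
  obtain ⟨m, q, hq, hexp⟩ := exists_orthonormal hU
  have hA : ∑ k, (Z * q k).trace • q k ∈ U := by
    refine Submodule.sum_mem _ fun k _ => ?_
    rw [← trace_mul_ofReal hZ (hU (hq k))]
    exact U.smul_mem _ (hq k)
  refine ⟨_, hA, Z - _, ⟨(Hrm ι).sub_mem hZ (hU hA), fun X hX => ?_⟩, (add_sub_cancel _ _).symm⟩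
  rw [Matrix.mul_sub, Matrix.trace_sub, sub_eq_zero]
  conv_lhs => rw [hexp X hX]
  rw [Finset.sum_mul, Finset.mul_sum, Matrix.trace_sum, Matrix.trace_sum]
  refine Finset.sum_congr rfl fun k _ => ?_
  rw [Matrix.smul_mul, Matrix.mul_smul, Matrix.trace_smul, Matrix.trace_smul,
    Matrix.trace_mul_comm (q k), smul_eq_mul, smul_eq_mul, mul_comm]

theorem eq_zero_of_trace_sq {X : Op ι} (hX : X.IsHermitian) (h : (X * X).trace = 0) : X = 0 := by
  by_contra h0
  have := trForm_self_pos hX h0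
  rw [trForm_apply, h] at this
  simp at this

/-- In the decomposition along `U` and its complement, the second component of a vector of the
double complement is orthogonal to itself, hence zero. -/
theorem perp_perp {U : Submodule ℝ (Op ι)} (hU : U ≤ Hrm ι) : perp (perp U) = U := by
  refine le_antisymm (fun Z hZ => ?_) (fun X hX => ⟨hU hX, fun Y hY => ?_⟩)
  · obtain ⟨A, hA, B, hB, rfl⟩ := exists_add_perp hU hZ.1
    have h1 := hZ.2 B hB
    have h2 := hB.2 A hA
    rw [Matrix.mul_add, Matrix.trace_add, Matrix.trace_mul_comm B A, h2, zero_add] at h1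
    rw [eq_zero_of_trace_sq hB.1 h1, add_zero]
    exact hA
  · rw [Matrix.trace_mul_comm]
    exact hY.2 X hX

theorem perp_anti {U V : Submodule ℝ (Op ι)} (h : U ≤ V) : perp V ≤ perp U :=
  fun _ hY => ⟨hY.1, fun X hX => hY.2 X (h hX)⟩

/-- Hermitian operators span all operators over `ℂ`, through real and imaginary parts; `A` itself
need not be Hermitian. -/
theorem trace_mul_eq_zero_of_hermitian {A : Op ι} (h : ∀ H ∈ Hrm ι, (A * H).trace = 0) :
    A = 0 := by
  classical
  refine Matrix.ext_iff_trace_mul_right.mpr fun C => ?_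
  rw [zero_mul, Matrix.trace_zero, ← realPart_add_I_smul_imaginaryPart C, Matrix.mul_add,
    Matrix.trace_add, Matrix.mul_smul, Matrix.trace_smul, h _ (realPart C).2,
    h _ (imaginaryPart C).2]
  simp

theorem eq_of_trace_mul_hermitian {A B : Op ι} (h : ∀ H ∈ Hrm ι, (A * H).trace = (B * H).trace) :
    A = B := by
  rw [← sub_eq_zero]
  refine trace_mul_eq_zero_of_hermitian fun H hH => ?_
  rw [Matrix.sub_mul, Matrix.trace_sub, h H hH, sub_self]

variable [DecidableEq ι]

theorem one_mem_Hrm {ι : Type} [DecidableEq ι] : (1 : Op ι) ∈ Hrm ι := Matrix.isHermitian_one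

theorem IdSp_le_Hrm : IdSp ι ≤ Hrm ι := by
  rw [IdSp, Submodule.span_le, Set.singleton_subset_iff]
  exact one_mem_Hrm

theorem mem_IdSp {ι : Type} [DecidableEq ι] {X : Op ι} :
    X ∈ IdSp ι ↔ ∃ c : ℝ, c • (1 : Op ι) = X :=
  Submodule.mem_span_singleton

theorem one_mem_IdSp {ι : Type} [DecidableEq ι] : (1 : Op ι) ∈ IdSp ι :=
  Submodule.mem_span_singleton_self _

theorem perp_IdSp : perp (IdSp ι) = Trl ι := by
  ext X
  constructor
  · exact fun h => ⟨h.1, by simpa using h.2 1 one_mem_IdSp⟩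
  · refine fun h => ⟨h.1, fun Y hY => ?_⟩
    obtain ⟨c, rfl⟩ := mem_IdSp.mp hY
    rw [Matrix.smul_mul, Matrix.trace_smul, one_mul, h.2, smul_zero]

theorem perp_Trl : perp (Trl ι) = IdSp ι := by
  rw [← perp_IdSp, perp_perp IdSp_le_Hrm]

theorem one_mem_perp {U : Submodule ℝ (Op ι)} (hU : U ≤ Trl ι) : (1 : Op ι) ∈ perp U :=
  ⟨one_mem_Hrm, fun X hX => by rw [mul_one, (hU hX).2]⟩

theorem perp_bot : perp (⊥ : Submodule ℝ (Op ι)) = Hrm ι := by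
  ext X
  refine ⟨fun h => h.1, fun h => ⟨h, fun Y hY => ?_⟩⟩
  rw [(Submodule.mem_bot ℝ).mp hY, zero_mul, Matrix.trace_zero]

theorem perp_Hrm : perp (Hrm ι) = ⊥ := by
  rw [← perp_bot, perp_perp bot_le]

theorem perp_sup (U V : Submodule ℝ (Op ι)) : perp (U ⊔ V) = perp U ⊓ perp V := by
  refine le_antisymm (le_inf (perp_anti le_sup_left) (perp_anti le_sup_right)) fun Y hY =>
    ⟨hY.1.1, fun X hX => ?_⟩
  obtain ⟨A, hA, B, hB, rfl⟩ := Submodule.mem_sup.mp hX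
  rw [Matrix.add_mul, Matrix.trace_add, hY.1.2 A hA, hY.2.2 B hB, add_zero]

theorem bar_eq_perp (U : Submodule ℝ (Op ι)) : bar U = perp (U ⊔ IdSp ι) := by
  rw [bar, perp_sup, perp_IdSp]

theorem perp_bar {U : Submodule ℝ (Op ι)} (hU : U ≤ Hrm ι) : perp (bar U) = U ⊔ IdSp ι := by
  rw [bar_eq_perp, perp_perp (sup_le hU IdSp_le_Hrm)]

/-- A traceless element of `U + ℝ1` has no component along the identity. This is what makes the
functional type of `x̄` return to the direction space of `x`. -/
theorem bar_bar {U : Submodule ℝ (Op ι)} (hU : U ≤ Trl ι) : bar (bar U) = U := by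
  rw [bar, perp_bar (hU.trans Trl_le_Hrm)]
  refine le_antisymm (fun X hX => ?_) (le_inf le_sup_left hU)
  obtain ⟨A, hA, B, hB, rfl⟩ := Submodule.mem_sup.mp hX.1
  obtain ⟨c, rfl⟩ := mem_IdSp.mp hB
  have h := hX.2.2
  rw [Matrix.trace_add, (hU hA).2, zero_add] at h
  have h' : (c • (1 : Op ι)) = 0 := by
    refine eq_zero_of_trace_sq (IdSp_le_Hrm hB) ?_
    rw [Matrix.mul_smul, Matrix.trace_smul, mul_one, h, smul_zero]
  rw [h', add_zero]
  exact hA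

end TraceForm

/-! ### Tensor products of subspaces -/

section Tens

variable {α β : Type}

theorem tens_le {U : Submodule ℝ (Op α)} {V : Submodule ℝ (Op β)} {W : Submodule ℝ (Op (α × β))} :
    tens U V ≤ W ↔ ∀ A ∈ U, ∀ B ∈ V, A ⊗ₖ B ∈ W := by
  rw [tens, Submodule.span_le]
  constructor
  · exact fun h A hA B hB => h ⟨A, hA, B, hB, rfl⟩
  · rintro h _ ⟨A, hA, B, hB, rfl⟩
    exact h A hA B hB

theorem kron_mem_tens {U : Submodule ℝ (Op α)} {V : Submodule ℝ (Op β)} {A : Op α} {B : Op β}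
    (hA : A ∈ U) (hB : B ∈ V) : A ⊗ₖ B ∈ tens U V :=
  Submodule.subset_span ⟨A, hA, B, hB, rfl⟩

theorem isHermitian_kron {A : Op α} {B : Op β} (hA : A.IsHermitian) (hB : B.IsHermitian) :
    (A ⊗ₖ B).IsHermitian := by
  rw [Matrix.IsHermitian, Matrix.conjTranspose_kronecker, hA.eq, hB.eq]

theorem tens_le_Hrm {U : Submodule ℝ (Op α)} {V : Submodule ℝ (Op β)} (hU : U ≤ Hrm α)
    (hV : V ≤ Hrm β) : tens U V ≤ Hrm (α × β) :=
  tens_le.mpr fun _ hA _ hB => isHermitian_kron (hU hA) (hV hB)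

variable [Fintype α] [Fintype β]

theorem trace_kron_mul_kron (A C : Op α) (B D : Op β) :
    ((A ⊗ₖ B) * (C ⊗ₖ D)).trace = (A * C).trace * (B * D).trace := by
  rw [← Matrix.mul_kronecker_mul, Matrix.trace_kronecker]

/-- Contraction of the second tensor factor with `Y`. -/
def rslice (Z : Op (α × β)) (Y : Op β) : Op α :=
  Matrix.of fun a a' => ∑ b, ∑ b', Z (a, b) (a', b') * Y b' b

theorem rslice_apply {α β : Type} [Fintype β] (Z : Op (α × β)) (Y : Op β) (a a' : α) :
    rslice Z Y a a' = ∑ b, ∑ b', Z (a, b) (a', b') * Y b' b := rfl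

/-- Slicing by `Y` is adjoint to `H ↦ H ⊗ Y`; it converts trace tests against product operators into
operator identities on the first factor. -/
theorem trace_mul_kron (Z : Op (α × β)) (H : Op α) (Y : Op β) :
    (Z * (H ⊗ₖ Y)).trace = (rslice Z Y * H).trace := by
  simp only [Matrix.trace, Matrix.diag_apply, Matrix.mul_apply, Fintype.sum_prod_type,
    rslice_apply, Matrix.kroneckerMap_apply, Finset.sum_mul]
  refine Finset.sum_congr rfl fun a _ => ?_
  rw [Finset.sum_comm]
  refine Finset.sum_congr rfl fun a' _ => Finset.sum_congr rfl fun b _ =>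
    Finset.sum_congr rfl fun b' _ => by ring

theorem isHermitian_rslice {α β : Type} [Fintype β] {Z : Op (α × β)} {Y : Op β}
    (hZ : Z.IsHermitian) (hY : Y.IsHermitian) :
    (rslice Z Y).IsHermitian := by
  ext a a'
  rw [Matrix.conjTranspose_apply, rslice_apply, rslice_apply, star_sum]
  simp_rw [star_sum]
  rw [Finset.sum_comm]
  refine Finset.sum_congr rfl fun b _ => Finset.sum_congr rfl fun b' _ => ?_
  rw [star_mul', hZ.apply, hY.apply]

theorem eq_zero_of_trace_mul_kron {Z : Op (α × β)}
    (h : ∀ H ∈ Hrm α, ∀ Y ∈ Hrm β, (Z * (H ⊗ₖ Y)).trace = 0) : Z = 0 := by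
  ext ⟨a, b⟩ ⟨a', b'⟩
  have h1 : ∀ Y ∈ Hrm β, rslice Z Y = 0 := fun Y hY =>
    trace_mul_eq_zero_of_hermitian fun H hH => by rw [← trace_mul_kron]; exact h H hH Y hY
  have h2 : (Matrix.of fun b b' => Z (a, b) (a', b') : Op β) = 0 := by
    refine trace_mul_eq_zero_of_hermitian fun Y hY => ?_
    have := congrFun (congrFun (h1 Y hY) a) a'
    rw [rslice_apply] at this
    simpa [Matrix.trace, Matrix.mul_apply] using this
  exact congrFun (congrFun h2 b) b'

/-- As `V ⊥ Q`, the second factor splits into `V`, `Q` and the rest: nothing is required along `V`,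
the slices along `Q` must lie in `U`, and the slices along the rest must vanish. This one criterion
computes every direction space below. -/
theorem mem_sup_tens_of_trace {U : Submodule ℝ (Op α)} {V Q : Submodule ℝ (Op β)} {Z : Op (α × β)}
    (hZ : Z.IsHermitian) (hU : U ≤ Hrm α) (hV : V ≤ Hrm β) (hQ : Q ≤ perp V)
    (h1 : ∀ H ∈ Hrm α, ∀ Y ∈ perp (V ⊔ Q), (Z * (H ⊗ₖ Y)).trace = 0)
    (h2 : ∀ H ∈ perp U, ∀ Y ∈ Q, (Z * (H ⊗ₖ Y)).trace = 0) :
    Z ∈ tens (Hrm α) V ⊔ tens U Q := by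
  classical
  -- Projection onto the part of `Z` supported on `Q`: expand along an orthonormal family `q k` of
  -- `Q`. The slices of `Z` by `q k` lie in `U` by the double complement.
  have key : ∀ {U : Submodule ℝ (Op α)} {Q : Submodule ℝ (Op β)} {Z : Op (α × β)},
      Z.IsHermitian → U ≤ Hrm α → Q ≤ Hrm β →
      (∀ H ∈ perp U, ∀ Y ∈ Q, (Z * (H ⊗ₖ Y)).trace = 0) →
      ∃ Z' ∈ tens U Q, ∀ H ∈ Hrm α, ∀ Y ∈ Q, ((Z - Z') * (H ⊗ₖ Y)).trace = 0 := by
    intro U Q Z hZ hU hQ h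
    obtain ⟨m, q, hq, hexp⟩ := exists_orthonormal hQ
    refine ⟨∑ k, rslice Z (q k) ⊗ₖ q k, Submodule.sum_mem _ fun k _ => kron_mem_tens ?_ (hq k), ?_⟩
    · rw [← perp_perp hU]
      refine ⟨isHermitian_rslice hZ (hQ (hq k)), fun X hX => ?_⟩
      rw [Matrix.trace_mul_comm, ← trace_mul_kron]
      exact h X hX _ (hq k)
    · intro H hH Y hY
      rw [Matrix.sub_mul, Matrix.trace_sub, sub_eq_zero]
      conv_lhs => rw [hexp Y hY]
      rw [Finset.sum_mul, Matrix.trace_sum]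
      have : (H ⊗ₖ ∑ k, (Y * q k).trace • q k) = ∑ k, (Y * q k).trace • (H ⊗ₖ q k) := by
        ext i j
        simp [Matrix.sum_apply, Finset.mul_sum, mul_left_comm]
      rw [this, Finset.mul_sum, Matrix.trace_sum]
      refine Finset.sum_congr rfl fun k _ => ?_
      rw [trace_kron_mul_kron, Matrix.mul_smul, Matrix.trace_smul, trace_mul_kron, smul_eq_mul,
        Matrix.trace_mul_comm (q k), mul_comm]
  obtain ⟨Z₁, hZ₁, e₁⟩ := key hZ hU (hQ.trans (perp_le_Hrm V)) h2
  have hZ₁' := tens_le_Hrm hU (hQ.trans (perp_le_Hrm V)) hZ₁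
  obtain ⟨Z₂, hZ₂, e₂⟩ := key (U := Hrm α) ((Hrm _).sub_mem hZ hZ₁') le_rfl hV (by
    intro H hH
    rw [perp_Hrm] at hH
    rw [(Submodule.mem_bot ℝ).mp hH]
    simp)
  -- Each `Y` splits along `V`, `Q` and the complement of `V ⊔ Q`; `Z₂` is invisible to operators
  -- orthogonal to `V`, and `Z₁` to those orthogonal to `Q`.
  have hzero : Z - Z₁ - Z₂ = 0 := by
    refine eq_zero_of_trace_mul_kron fun H hH Y hY => ?_
    have hVQ : V ⊔ Q ≤ Hrm β := sup_le hV (hQ.trans (perp_le_Hrm V))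
    obtain ⟨A, hA, B, hB, rfl⟩ := exists_add_perp hVQ hY
    obtain ⟨A₁, hA₁, A₂, hA₂, rfl⟩ := Submodule.mem_sup.mp hA
    have tV : ∀ Y ∈ perp V, (Z₂ * (H ⊗ₖ Y)).trace = 0 := by
      intro Y hY
      have : tens (Hrm α) V ≤ perp (perp (tens (Hrm α) V)) := by
        rw [perp_perp (tens_le_Hrm le_rfl hV)]
      rw [Matrix.trace_mul_comm]
      refine (this hZ₂).2 _ ⟨isHermitian_kron hH hY.1, fun X hX => ?_⟩
      refine Submodule.span_induction (p := fun X _ => (X * (H ⊗ₖ Y)).trace = 0) ?_ ?_ ?_ ?_ hX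
      · rintro _ ⟨A, hA, B, hB, rfl⟩
        rw [trace_kron_mul_kron, hY.2 B hB, mul_zero]
      · simp
      · intro X X' _ _ h h'
        rw [Matrix.add_mul, Matrix.trace_add, h, h', add_zero]
      · intro c X _ h
        rw [Matrix.smul_mul, Matrix.trace_smul, h, smul_zero]
    have tQ : ∀ Y ∈ perp Q, (Z₁ * (H ⊗ₖ Y)).trace = 0 := by
      intro Y hY
      refine Submodule.span_induction (p := fun X _ => (X * (H ⊗ₖ Y)).trace = 0) ?_ ?_ ?_ ?_ hZ₁
      · rintro _ ⟨A, hA, B, hB, rfl⟩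
        rw [trace_kron_mul_kron, hY.2 B hB, mul_zero]
      · simp
      · intro X X' _ _ h h'
        rw [Matrix.add_mul, Matrix.trace_add, h, h', add_zero]
      · intro c X _ h
        rw [Matrix.smul_mul, Matrix.trace_smul, h, smul_zero]
    rw [Matrix.kronecker_add, Matrix.kronecker_add, Matrix.mul_add, Matrix.mul_add,
      Matrix.trace_add, Matrix.trace_add, e₂ H hH A₁ hA₁]
    have hB' := hB
    rw [perp_sup] at hB'
    have hb : ((Z - Z₁ - Z₂) * (H ⊗ₖ B)).trace = 0 := by
      rw [Matrix.sub_mul, Matrix.sub_mul, Matrix.trace_sub, Matrix.trace_sub, h1 H hH B hB,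
        tQ B hB'.2, tV B hB'.1]
      simp
    have ha : ((Z - Z₁ - Z₂) * (H ⊗ₖ A₂)).trace = 0 := by
      rw [Matrix.sub_mul, Matrix.trace_sub, e₁ H hH A₂ hA₂, tV A₂ (hQ hA₂), sub_zero]
    rw [ha, hb]
    simp
  have : Z = Z₂ + Z₁ := by
    rw [sub_sub, sub_eq_zero] at hzero
    rw [hzero, add_comm]
  rw [this]
  exact Submodule.add_mem_sup hZ₂ hZ₁

end Tens

/-! ### Positive operators -/

section Positivity

variable {ι σ : Type} [Fintype ι] [Fintype σ]

-- The identity is an order unit, hence an interior point of the positive cone.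
open scoped MatrixOrder Matrix.Norms.L2Operator in
theorem exists_smul_one_sub_posSemidef [DecidableEq ι] {H : Op ι} (hH : H.IsHermitian) :
    ∃ c : ℝ, 0 < c ∧ (c • (1 : Op ι) - H).PosSemidef := by
  refine ⟨‖H‖ + 1, by positivity, ?_⟩
  have h : H ≤ algebraMap ℝ (Op ι) ‖H‖ := IsSelfAdjoint.le_algebraMap_norm_self hH
  rw [Matrix.le_iff, Algebra.algebraMap_eq_smul_one] at h
  have e : (‖H‖ + 1) • (1 : Op ι) - H = (‖H‖ • (1 : Op ι) - H) + 1 := by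
    rw [add_smul, one_smul]
    abel
  rw [e]
  exact h.add Matrix.PosSemidef.one

/-- The contraction is `C* G C` for a rectangular 0-1 matrix `C`. Choi actions and link products are
such contractions of a compression of `N ⊗ M`, with one index `s` for the rows and one `s'` for the
columns, so their positivity needs no argument about transposes. -/
theorem posSemidef_contract {G : Op (ι × σ)} (hG : G.PosSemidef) :
    (Matrix.of fun i j => ∑ s, ∑ s', G (i, s) (j, s') : Op ι).PosSemidef := by
  classical
  let C : Matrix (ι × σ) ι ℂ := Matrix.of fun p j => if p.1 = j then 1 else 0
  have h := hG.conjTranspose_mul_mul_same C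
  convert h using 1
  ext i j
  have h1 : ∀ q, (C.conjTranspose * G) i q = ∑ s, G (i, s) q := fun q => by
    rw [Matrix.mul_apply, Fintype.sum_prod_type_right]
    simp [C, apply_ite star]
  rw [Matrix.mul_apply, Fintype.sum_prod_type_right, Matrix.of_apply, Finset.sum_comm]
  simp [C, h1]

theorem posSemidef_ptrR {G : Op (ι × σ)} (hG : G.PosSemidef) : (ptrR G).PosSemidef := by
  have : ptrR G = ∑ s, G.submatrix (fun i => (i, s)) (fun i => (i, s)) := by
    ext i j
    simp [ptrR, Matrix.sum_apply]
  rw [this]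
  exact Matrix.posSemidef_sum _ fun s _ => hG.submatrix _

end Positivity

/-! ### Action of Choi operators -/

section Choi

variable {α β ε σ : Type} [Fintype α] [Fintype β] [DecidableEq β]

theorem applyChoi_apply (M : Op (α × β)) (O : Op α) (b b' : β) :
    applyChoi M O b b' = ∑ a, ∑ a', O a a' * M (a, b) (a', b') := by
  simp only [applyChoi, ptrL, Matrix.of_apply, Matrix.mul_apply, Fintype.sum_prod_type,
    Matrix.kroneckerMap_apply, Matrix.transpose_apply, Matrix.one_apply, mul_ite, mul_one, mul_zero,
    ite_mul, zero_mul, Finset.sum_ite_eq, Finset.mem_univ, if_true]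
  exact Finset.sum_comm

theorem applyChoiExt_apply (M : Op (α × β)) (ρ : Op (α × ε)) (p q : β × ε) :
    applyChoiExt M ρ p q = ∑ a, ∑ a', ρ (a, p.2) (a', q.2) * M (a, p.1) (a', q.1) := by
  rw [applyChoiExt, Matrix.of_apply, applyChoi_apply]
  rfl

theorem applyChoi_add (M : Op (α × β)) (O O' : Op α) :
    applyChoi M (O + O') = applyChoi M O + applyChoi M O' := by
  ext b b'
  simp only [applyChoi_apply, Matrix.add_apply, add_mul, Finset.sum_add_distrib]

theorem applyChoi_smul (M : Op (α × β)) (c : ℝ) (O : Op α) :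
    applyChoi M (c • O) = c • applyChoi M O := by
  ext b b'
  simp only [applyChoi_apply, Matrix.smul_apply, smul_mul_assoc, Finset.smul_sum]

theorem applyChoiExt_sub_left (M N : Op (α × β)) (ρ : Op (α × ε)) :
    applyChoiExt (M - N) ρ = applyChoiExt M ρ - applyChoiExt N ρ := by
  ext p q
  simp only [applyChoiExt_apply, Matrix.sub_apply, mul_sub, Finset.sum_sub_distrib]

theorem applyChoiExt_sub_right (M : Op (α × β)) (ρ τ : Op (α × ε)) :
    applyChoiExt M (ρ - τ) = applyChoiExt M ρ - applyChoiExt M τ := by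
  ext p q
  simp only [applyChoiExt_apply, Matrix.sub_apply, sub_mul, Finset.sum_sub_distrib]

theorem ptrR_applyChoiExt [Fintype ε] (M : Op (α × β)) (ρ : Op (α × ε)) :
    ptrR (applyChoiExt M ρ) = applyChoi M (ptrR ρ) := by
  ext b b'
  simp only [ptrR, Matrix.of_apply, applyChoiExt_apply, applyChoi_apply, Finset.sum_mul]
  rw [Finset.sum_comm]
  exact Finset.sum_congr rfl fun a _ => Finset.sum_comm

theorem ptrR_applyChoi {γ : Type} [Fintype γ] [DecidableEq γ] [Fintype ε] (e : γ ≃ β × ε)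
    (M : Op (α × γ)) (ρ : Op α) :
    ptrR ((applyChoi M ρ).submatrix e.symm e.symm) =
      applyChoi (ptrR (M.submatrix
        (fun p : (α × β) × ε => (p.1.1, e.symm (p.1.2, p.2)))
        (fun p : (α × β) × ε => (p.1.1, e.symm (p.1.2, p.2))))) ρ := by
  ext b b'
  simp only [ptrR, Matrix.of_apply, applyChoi_apply, Finset.mul_sum, Matrix.submatrix_apply]
  rw [Finset.sum_comm]
  exact Finset.sum_congr rfl fun a _ => Finset.sum_comm

theorem posSemidef_applyChoiExt [Fintype ε] {M : Op (α × β)} {ρ : Op (α × ε)} (hM : M.PosSemidef)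
    (hρ : ρ.PosSemidef) : (applyChoiExt M ρ).PosSemidef := by
  have h := posSemidef_contract (ι := β × ε) (σ := α)
    ((hρ.kronecker hM).submatrix fun p => ((p.2, p.1.2), (p.2, p.1.1)))
  convert h using 1
  ext p q
  rw [applyChoiExt_apply]
  rfl

theorem isHermitian_applyChoi {M : Op (α × β)} {ρ : Op α} (hM : M.IsHermitian)
    (hρ : ρ.IsHermitian) : (applyChoi M ρ).IsHermitian := by
  ext b b'
  rw [Matrix.conjTranspose_apply, applyChoi_apply, applyChoi_apply, star_sum]
  simp_rw [star_sum]
  rw [Finset.sum_comm]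
  refine Finset.sum_congr rfl fun a _ => Finset.sum_congr rfl fun a' _ => ?_
  rw [star_mul', hM.apply, hρ.apply]

/-- Duality between a map and its Choi operator. The transpose on `ρ` is the reason why direction
spaces must be shown stable under transposition. -/
theorem trace_applyChoi_mul (M : Op (α × β)) (ρ : Op α) (Y : Op β) :
    (applyChoi M ρ * Y).trace = (M * (ρ.transpose ⊗ₖ Y)).trace := by
  rw [trace_mul_kron]
  simp only [Matrix.trace, Matrix.diag_apply, Matrix.mul_apply, applyChoi_apply, rslice_apply,
    Matrix.transpose_apply, Finset.sum_mul]
  calc _ = ∑ b, ∑ a, ∑ b', ∑ a', ρ a a' * M (a, b) (a', b') * Y b' b := by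
        refine Finset.sum_congr rfl fun b _ => ?_
        rw [Finset.sum_comm]
    _ = _ := by
        rw [Finset.sum_comm]
        refine Finset.sum_congr rfl fun a _ => ?_
        rw [Finset.sum_comm' (t' := Finset.univ) (s' := fun _ => Finset.univ) (by simp)]
        rw [Finset.sum_comm]
        simp_rw [Finset.sum_comm (γ := α)]
        refine Finset.sum_congr rfl fun a' _ => ?_
        exact Finset.sum_congr rfl fun b _ => Finset.sum_congr rfl fun b' _ => by ring

end Choi

/-! ### Affine spaces of operators -/

section Affine

variable {ι : Type} [Fintype ι] [DecidableEq ι]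

/-- The affine space `l 1 + U`, described through its orthogonal complement. -/
def IsAff (U : Submodule ℝ (Op ι)) (l : ℝ) (M : Op ι) : Prop :=
  M.IsHermitian ∧ ∀ Y ∈ perp U, (M * Y).trace = l * Y.trace

theorem isAff_iff {U : Submodule ℝ (Op ι)} (hU : U ≤ Trl ι) {l : ℝ} {M : Op ι} :
    IsAff U l M ↔ M - l • 1 ∈ U := by
  constructor
  · intro h
    rw [← perp_perp (hU.trans Trl_le_Hrm)]
    refine ⟨(Hrm ι).sub_mem h.1 ((Hrm ι).smul_mem _ one_mem_Hrm), fun Y hY => ?_⟩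
    rw [Matrix.mul_sub, Matrix.trace_sub, Matrix.trace_mul_comm, h.2 Y hY, Matrix.mul_smul, mul_one,
      Matrix.trace_smul, Complex.real_smul, sub_self]
  · intro h
    have hM : M = (M - l • 1) + l • 1 := (sub_add_cancel _ _).symm
    refine ⟨?_, fun Y hY => ?_⟩
    · rw [hM]
      exact (Hrm ι).add_mem (hU.trans Trl_le_Hrm h) ((Hrm ι).smul_mem _ one_mem_Hrm)
    · rw [hM, Matrix.add_mul, Matrix.trace_add, hY.2 _ h, Matrix.smul_mul, one_mul,
        Matrix.trace_smul, Complex.real_smul, zero_add]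

theorem isAff_smul_one {U : Submodule ℝ (Op ι)} (hU : U ≤ Trl ι) (l : ℝ) :
    IsAff U l (l • 1) := by
  rw [isAff_iff hU, sub_self]
  exact U.zero_mem

theorem IsAff.trace_eq {U : Submodule ℝ (Op ι)} (hU : U ≤ Trl ι) {l : ℝ} {M : Op ι}
    (h : IsAff U l M) : M.trace = l * Fintype.card ι := by
  have := h.2 1 (one_mem_perp hU)
  rwa [mul_one, Matrix.trace_one] at this

theorem IsAff.lineMap {U : Submodule ℝ (Op ι)} {l : ℝ} {M N : Op ι}
    (hM : IsAff U l M) (hN : IsAff U l N) (t : ℝ) : IsAff U l (M + t • (N - M)) := by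
  refine ⟨(Hrm ι).add_mem hM.1 ((Hrm ι).smul_mem _ ((Hrm ι).sub_mem hN.1 hM.1)), fun Y hY => ?_⟩
  rw [Matrix.add_mul, Matrix.trace_add, Matrix.smul_mul, Matrix.trace_smul, Matrix.sub_mul,
    Matrix.trace_sub, hM.2 Y hY, hN.2 Y hY, sub_self, smul_zero, add_zero]

theorem isAff_Trl_iff {M : Op ι} [Nonempty ι] :
    IsAff (Trl ι) (1 / (Fintype.card ι : ℝ)) M ↔ M.IsHermitian ∧ M.trace = 1 := by
  have hc : (Fintype.card ι : ℂ) ≠ 0 := Nat.cast_ne_zero.mpr Fintype.card_ne_zero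
  constructor
  · intro h
    refine ⟨h.1, ?_⟩
    rw [h.trace_eq le_rfl]
    push_cast
    field_simp
  · rintro ⟨h, h1⟩
    refine ⟨h, fun Y hY => ?_⟩
    rw [perp_Trl] at hY
    obtain ⟨c, rfl⟩ := mem_IdSp.mp hY
    rw [Matrix.mul_smul, mul_one, Matrix.trace_smul, h1, Matrix.trace_smul, Matrix.trace_one,
      Complex.real_smul, Complex.real_smul]
    push_cast
    field_simp

variable {α β : Type} [Fintype α] [DecidableEq α] [Fintype β] [DecidableEq β]

theorem kron_mem_perp_tens_left {U : Submodule ℝ (Op α)} {V : Submodule ℝ (Op β)} {T : Op α}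
    {Y : Op β} (hT : T ∈ perp U) (hY : Y ∈ Hrm β) : T ⊗ₖ Y ∈ perp (tens U V) := by
  refine ⟨isHermitian_kron hT.1 hY, fun X hX => ?_⟩
  have : tens U V ≤ LinearMap.ker
      ((Matrix.traceLinearMap _ ℝ ℂ).comp (LinearMap.mulRight ℝ (T ⊗ₖ Y))) :=
    tens_le.mpr fun A hA B hB => by
      change ((A ⊗ₖ B) * (T ⊗ₖ Y)).trace = 0
      rw [trace_kron_mul_kron, hT.2 A hA, zero_mul]
  exact this hX

theorem kron_mem_perp_tens_right {U : Submodule ℝ (Op α)} {V : Submodule ℝ (Op β)} {T : Op α}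
    {Y : Op β} (hT : T ∈ Hrm α) (hY : Y ∈ perp V) : T ⊗ₖ Y ∈ perp (tens U V) := by
  refine ⟨isHermitian_kron hT hY.1, fun X hX => ?_⟩
  have : tens U V ≤ LinearMap.ker
      ((Matrix.traceLinearMap _ ℝ ℂ).comp (LinearMap.mulRight ℝ (T ⊗ₖ Y))) :=
    tens_le.mpr fun A hA B hB => by
      change ((A ⊗ₖ B) * (T ⊗ₖ Y)).trace = 0
      rw [trace_kron_mul_kron, hY.2 B hB, mul_zero]
  exact this hX

theorem perp_sup_perp (V : Submodule ℝ (Op ι)) : perp (V ⊔ perp V) = ⊥ := by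
  rw [perp_sup, eq_bot_iff]
  intro Y hY
  exact (Submodule.mem_bot ℝ).mpr (eq_zero_of_trace_sq hY.1.1 (hY.2.2 Y hY.1))

theorem tens_le_Trl_left {U : Submodule ℝ (Op α)} {V : Submodule ℝ (Op β)} (hU : U ≤ Trl α)
    (hV : V ≤ Hrm β) : tens U V ≤ Trl (α × β) :=
  tens_le.mpr fun A hA B hB => ⟨isHermitian_kron (hU hA).1 (hV hB), by
    rw [Matrix.trace_kronecker, (hU hA).2, zero_mul]⟩

theorem tens_le_Trl_right {U : Submodule ℝ (Op α)} {V : Submodule ℝ (Op β)} (hU : U ≤ Hrm α)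
    (hV : V ≤ Trl β) : tens U V ≤ Trl (α × β) :=
  tens_le.mpr fun A hA B hB => ⟨isHermitian_kron (hU hA) (hV hB).1, by
    rw [Matrix.trace_kronecker, (hV hB).2, mul_zero]⟩

theorem arrow_le_Trl {U : Submodule ℝ (Op α)} {V : Submodule ℝ (Op β)} (hV : V ≤ Trl β) :
    tens (Hrm α) V ⊔ tens (bar U) (perp V) ≤ Trl (α × β) :=
  sup_le (tens_le_Trl_right le_rfl hV) (tens_le_Trl_left (bar_le_Trl U) (perp_le_Hrm V))

/-- Product tests suffice: the complement of the arrow space is governed by products of operators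
from the complements of `bar U` and of `V`. -/
theorem isAff_arrow_iff_trace {U : Submodule ℝ (Op α)} {V : Submodule ℝ (Op β)}
    (hV : V ≤ Trl β) {l : ℝ} {M : Op (α × β)} :
    IsAff (tens (Hrm α) V ⊔ tens (bar U) (perp V)) l M ↔
      M.IsHermitian ∧ ∀ T ∈ perp (bar U), ∀ Y ∈ perp V,
        (M * (T ⊗ₖ Y)).trace = l * T.trace * Y.trace := by
  constructor
  · refine fun h => ⟨h.1, fun T hT Y hY => ?_⟩
    rw [h.2 _ ?_, Matrix.trace_kronecker, mul_assoc]
    rw [perp_sup]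
    exact ⟨kron_mem_perp_tens_right hT.1 hY, kron_mem_perp_tens_left hT hY.1⟩
  · rintro ⟨hM, h⟩
    rw [isAff_iff (arrow_le_Trl hV)]
    refine mem_sup_tens_of_trace ((Hrm _).sub_mem hM ((Hrm _).smul_mem _ one_mem_Hrm))
      ((bar_le_Trl U).trans Trl_le_Hrm) (hV.trans Trl_le_Hrm) le_rfl ?_ ?_
    · intro H hH Y hY
      rw [perp_sup_perp] at hY
      rw [(Submodule.mem_bot ℝ).mp hY, Matrix.kronecker_zero, mul_zero, Matrix.trace_zero]
    · intro T hT Y hY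
      rw [Matrix.sub_mul, Matrix.trace_sub, h T hT Y hY, Matrix.smul_mul, one_mul,
        Matrix.trace_smul, Matrix.trace_kronecker, Complex.real_smul, mul_assoc, sub_self]

/-- The complement of `bar U` is `U + ℝ1`, which contains the transposes of all points of `k 1 + U`,
so both sides test `M` on the same operators. The coefficient arises because such points have trace
`k` times the dimension. -/
theorem isAff_arrow_iff {U : Submodule ℝ (Op α)} {V : Submodule ℝ (Op β)}
    (hU : U ≤ Trl α) (hV : V ≤ Trl β) (hUt : ∀ X ∈ U, X.transpose ∈ U) {k l : ℝ} (hk : k ≠ 0)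
    [Nonempty α] {M : Op (α × β)} :
    IsAff (tens (Hrm α) V ⊔ tens (bar U) (perp V)) (l / ((Fintype.card α : ℝ) * k)) M ↔
      M.IsHermitian ∧ ∀ ρ, IsAff U k ρ → IsAff V l (applyChoi M ρ) := by
  have hc : (Fintype.card α : ℂ) ≠ 0 := Nat.cast_ne_zero.mpr Fintype.card_ne_zero
  have hk' : (k : ℂ) ≠ 0 := by exact_mod_cast hk
  rw [isAff_arrow_iff_trace hV, perp_bar (hU.trans Trl_le_Hrm)]
  refine and_congr_right fun hM => ⟨fun h ρ hρ => ?_, fun h T hT Y hY => ?_⟩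
  · refine ⟨isHermitian_applyChoi hM hρ.1, fun Y hY => ?_⟩
    rw [trace_applyChoi_mul, h _ _ Y hY, Matrix.trace_transpose, hρ.trace_eq hU]
    · push_cast
      field_simp
    · rw [isAff_iff hU] at hρ
      have e : ρ.transpose = (ρ - k • 1).transpose + k • 1 := by
        rw [Matrix.transpose_sub, Matrix.transpose_smul, Matrix.transpose_one, sub_add_cancel]
      rw [e]
      exact Submodule.add_mem_sup (hUt _ hρ) ((IdSp α).smul_mem _ one_mem_IdSp)
  · obtain ⟨A, hA, B, hB, rfl⟩ := Submodule.mem_sup.mp hT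
    obtain ⟨c, rfl⟩ := mem_IdSp.mp hB
    -- Two points of the affine space separate the components: `k 1` fixes the value on `1 ⊗ Y`, and
    -- its displacement by the transpose of `A` shows that `A ⊗ Y` contributes nothing.
    have h0 := (h (k • 1) (isAff_smul_one hU k)).2 Y hY
    have h1 := (h (k • 1 + A.transpose) (by
      rw [isAff_iff hU, add_sub_cancel_left]
      exact hUt A hA)).2 Y hY
    rw [trace_applyChoi_mul, Matrix.transpose_smul, Matrix.transpose_one] at h0
    rw [trace_applyChoi_mul, Matrix.transpose_add, Matrix.transpose_transpose,
      Matrix.transpose_smul, Matrix.transpose_one, Matrix.add_kronecker, Matrix.mul_add,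
      Matrix.trace_add, h0] at h1
    rw [Matrix.smul_kronecker, Matrix.mul_smul, Matrix.trace_smul, Complex.real_smul] at h0
    rw [Matrix.add_kronecker, Matrix.mul_add, Matrix.trace_add, Matrix.smul_kronecker,
      Matrix.mul_smul, Matrix.trace_smul, Complex.real_smul, Matrix.trace_add, (hU hA).2,
      Matrix.trace_smul, Matrix.trace_one, Complex.real_smul]
    have h2 : (M * (A ⊗ₖ Y)).trace = 0 := by simpa using h1
    have h3 : (M * ((1 : Op α) ⊗ₖ Y)).trace = l / k * Y.trace := by
      field_simp
      rw [mul_comm]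
      exact h0
    rw [h2, h3]
    push_cast
    field_simp
    ring

end Affine

/-! ### Invariance of the trace pairing under relabelling -/

section Reindex

variable {ι κ : Type} [Fintype ι] [Fintype κ]

theorem trace_submatrix_mul_submatrix (e : ι ≃ κ) (M N : Op κ) :
    (M.submatrix e e * N.submatrix e e).trace = (M * N).trace := by
  rw [Matrix.submatrix_mul_equiv, Matrix.trace, Matrix.trace]
  exact Equiv.sum_comp e fun k => (M * N) k k

end Reindex

/-! ### Partially bistochastic channels -/

section Bistochastic

variable {α β μ ν : Type} [Fintype α] [DecidableEq α] [Fintype β] [DecidableEq β] [Fintype μ]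
  [DecidableEq μ] [Fintype ν] [DecidableEq ν]

theorem rslice_one {α β : Type} [Fintype β] [DecidableEq β] (Z : Op (α × β)) :
    rslice Z 1 = ptrR Z := by
  ext a a'
  simp [rslice_apply, ptrR, Matrix.one_apply]

theorem isHermitian_ptrR {α β : Type} [Fintype β] {Z : Op (α × β)} (hZ : Z.IsHermitian) :
    (ptrR Z).IsHermitian := by
  classical
  rw [← rslice_one]
  exact isHermitian_rslice hZ one_mem_Hrm

theorem trace_ptrR {α β : Type} [Fintype α] [Fintype β] (Z : Op (α × β)) :
    (ptrR Z).trace = Z.trace := by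
  simp only [Matrix.trace, Matrix.diag_apply, ptrR, Matrix.of_apply, Fintype.sum_prod_type]

theorem Trl_prod : tens (Hrm α) (Trl β) ⊔ tens (Trl α) (IdSp β) = Trl (α × β) := by
  refine le_antisymm (sup_le (tens_le_Trl_right le_rfl le_rfl)
    (tens_le_Trl_left le_rfl IdSp_le_Hrm)) fun Z hZ => ?_
  refine mem_sup_tens_of_trace hZ.1 Trl_le_Hrm Trl_le_Hrm perp_Trl.ge ?_ ?_
  · intro H _ Y hY
    rw [← perp_Trl, perp_sup_perp] at hY
    rw [(Submodule.mem_bot ℝ).mp hY, Matrix.kronecker_zero, mul_zero, Matrix.trace_zero]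
  · intro H hH Y hY
    rw [perp_Trl] at hH
    obtain ⟨c, rfl⟩ := mem_IdSp.mp hH
    obtain ⟨c', rfl⟩ := mem_IdSp.mp hY
    rw [Matrix.smul_kronecker, Matrix.kronecker_smul, Matrix.one_kronecker_one, Matrix.mul_smul,
      Matrix.mul_smul, Matrix.trace_smul, Matrix.trace_smul, mul_one, hZ.2, smul_zero, smul_zero]

theorem tens_bot (U : Submodule ℝ (Op α)) : tens U (⊥ : Submodule ℝ (Op β)) = ⊥ := by
  rw [eq_bot_iff, tens_le]
  intro A _ B hB
  rw [(Submodule.mem_bot ℝ).mp hB, Matrix.kronecker_zero]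
  exact Submodule.zero_mem _

/-- The criterion `mem_sup_tens_of_trace` with nothing free (`V = ⊥`) and `Q` the whole Hermitian
space. -/
theorem perp_tens_Hrm_le {U : Submodule ℝ (Op α)} (hU : U ≤ Hrm α) :
    perp (tens U (Hrm β)) ≤ tens (perp U) (Hrm β) := by
  intro Z hZ
  have h := mem_sup_tens_of_trace (V := ⊥) (Q := Hrm β) hZ.1 (perp_le_Hrm U) bot_le
    perp_bot.ge ?_ ?_
  · rwa [tens_bot, bot_sup_eq] at h
  · intro H _ Y hY
    rw [bot_sup_eq, perp_Hrm] at hY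
    rw [(Submodule.mem_bot ℝ).mp hY, Matrix.kronecker_zero, mul_zero, Matrix.trace_zero]
  · intro H hH Y hY
    rw [perp_perp hU] at hH
    rw [Matrix.trace_mul_comm]
    exact hZ.2 _ (kron_mem_tens hH hY)

theorem apply_eq_zero_of_mem_tens {U : Submodule ℝ (Op α)} {V : Submodule ℝ (Op β)}
    (f : Op (α × β) →ₗ[ℝ] ℂ) (h : ∀ A ∈ U, ∀ B ∈ V, f (A ⊗ₖ B) = 0) {T : Op (α × β)}
    (hT : T ∈ tens U V) : f T = 0 := by
  have : tens U V ≤ LinearMap.ker f := tens_le.mpr h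
  exact this hT

/-- The direction space of partially bistochastic channels from `α μ` to `α ν`. -/
abbrev bistSpace (α μ ν : Type) [Fintype α] [Fintype ν] [DecidableEq ν] :
    Submodule ℝ (Op ((α × μ) × (α × ν))) :=
  tens (Hrm (α × μ)) (tens (Hrm α) (Trl ν)) ⊔
    tens (tens (Trl α) (Hrm μ)) (tens (Trl α) (IdSp ν))

theorem bistSpace_le_Trl : bistSpace α μ ν ≤ Trl ((α × μ) × (α × ν)) :=
  sup_le (tens_le_Trl_right le_rfl (tens_le_Trl_right le_rfl le_rfl))
    (tens_le_Trl_left (tens_le_Trl_left le_rfl le_rfl) (tens_le_Hrm Trl_le_Hrm IdSp_le_Hrm))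

/-- The two families of tests, `H ⊗ 1` and `(1 ⊗ B) ⊗ (C ⊗ 1)`, generate the complement of the
direction space; they are dual to the two marginal conditions on a partially bistochastic channel.
In the criterion, `V ⊔ Q` is all of the traceless space of the output, so only the identity is left
outside it. -/
theorem isAff_bistSpace_iff_trace {l : ℝ} {M : Op ((α × μ) × (α × ν))} :
    IsAff (bistSpace α μ ν) l M ↔ M.IsHermitian ∧
      (∀ H ∈ Hrm (α × μ), (M * (H ⊗ₖ (1 : Op (α × ν)))).trace =
        l * (H.trace * (Fintype.card α * Fintype.card ν))) ∧
      (∀ B ∈ Hrm μ, ∀ C ∈ Hrm α, (M * (((1 : Op α) ⊗ₖ B) ⊗ₖ (C ⊗ₖ (1 : Op ν)))).trace =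
        l * ((Fintype.card α * B.trace) * (C.trace * Fintype.card ν))) := by
  have one_perp : (1 : Op ν) ∈ perp (Trl ν) := one_mem_perp le_rfl
  have one_perp' : (1 : Op α) ∈ perp (Trl α) := one_mem_perp le_rfl
  constructor
  · refine fun h => ⟨h.1, fun H hH => ?_, fun B hB C hC => ?_⟩
    · rw [h.2 _ ?_, Matrix.trace_kronecker, Matrix.trace_one, Fintype.card_prod, Nat.cast_mul]
      rw [perp_sup, ← Matrix.one_kronecker_one (α := ℂ) (m := α) (n := ν)]
      exact ⟨kron_mem_perp_tens_right hH (kron_mem_perp_tens_right one_mem_Hrm one_perp),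
        kron_mem_perp_tens_right hH (kron_mem_perp_tens_left one_perp' one_mem_Hrm)⟩
    · rw [h.2 _ ?_, Matrix.trace_kronecker, Matrix.trace_kronecker, Matrix.trace_kronecker,
        Matrix.trace_one, Matrix.trace_one]
      rw [perp_sup]
      exact ⟨kron_mem_perp_tens_right (isHermitian_kron one_mem_Hrm hB)
          (kron_mem_perp_tens_right hC one_perp),
        kron_mem_perp_tens_left (kron_mem_perp_tens_left one_perp' hB)
          (isHermitian_kron hC one_mem_Hrm)⟩
  · rintro ⟨hM, h1, h2⟩
    rw [isAff_iff bistSpace_le_Trl]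
    have hVQ : tens (Trl α) (IdSp ν) ≤ perp (tens (Hrm α) (Trl ν)) :=
      tens_le.mpr fun A hA B hB =>
        kron_mem_perp_tens_right hA.1 (perp_Trl (ι := ν) ▸ hB)
    refine mem_sup_tens_of_trace ((Hrm _).sub_mem hM ((Hrm _).smul_mem _ one_mem_Hrm))
      (tens_le_Hrm Trl_le_Hrm le_rfl) (tens_le_Hrm le_rfl Trl_le_Hrm) hVQ ?_ ?_
    · intro H hH Y hY
      rw [Trl_prod, perp_Trl] at hY
      obtain ⟨c, rfl⟩ := mem_IdSp.mp hY
      rw [Matrix.kronecker_smul, Matrix.mul_smul, Matrix.trace_smul, Matrix.sub_mul,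
        Matrix.trace_sub, h1 H hH, Matrix.smul_mul, one_mul, Matrix.trace_smul,
        Matrix.trace_kronecker, Matrix.trace_one, Fintype.card_prod, Nat.cast_mul,
        Complex.real_smul (x := l), sub_self, smul_zero]
    · intro H hH Y hY
      have key : ∀ (B : Op μ) (C : Op α), B ∈ Hrm μ → C ∈ Hrm α →
          ((M - l • 1) * (((1 : Op α) ⊗ₖ B) ⊗ₖ (C ⊗ₖ (1 : Op ν)))).trace = 0 := by
        intro B C hB hC
        rw [Matrix.sub_mul, Matrix.trace_sub, h2 B hB C hC, Matrix.smul_mul, one_mul,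
          Matrix.trace_smul, Matrix.trace_kronecker, Matrix.trace_kronecker,
          Matrix.trace_kronecker, Matrix.trace_one, Matrix.trace_one, Complex.real_smul, sub_self]
      have hH' := perp_tens_Hrm_le Trl_le_Hrm hH
      rw [perp_Trl] at hH'
      -- A bilinear packaging, so that vanishing can be checked on generators in each tensor space
      -- separately.
      let f : Op (α × μ) →ₗ[ℝ] Op (α × ν) →ₗ[ℝ] ℂ :=
        LinearMap.mk₂ ℝ (fun H Y => ((M - l • 1) * (H ⊗ₖ Y)).trace)
          (fun _ _ _ => by rw [Matrix.add_kronecker, Matrix.mul_add, Matrix.trace_add])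
          (fun _ _ _ => by rw [Matrix.smul_kronecker, Matrix.mul_smul, Matrix.trace_smul])
          (fun _ _ _ => by rw [Matrix.kronecker_add, Matrix.mul_add, Matrix.trace_add])
          (fun _ _ _ => by rw [Matrix.kronecker_smul, Matrix.mul_smul, Matrix.trace_smul])
      change f H Y = 0
      refine apply_eq_zero_of_mem_tens (f H) (fun C hC Z hZ => ?_) hY
      obtain ⟨c, rfl⟩ := mem_IdSp.mp hZ
      refine apply_eq_zero_of_mem_tens (f.flip (C ⊗ₖ (c • (1 : Op ν))))
        (fun A hA B hB => ?_) hH'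
      obtain ⟨c', rfl⟩ := mem_IdSp.mp hA
      rw [Matrix.smul_kronecker, Matrix.kronecker_smul, map_smul, LinearMap.flip_apply, map_smul]
      have : f ((1 : Op α) ⊗ₖ B) (C ⊗ₖ (1 : Op ν)) = 0 := key B C hB hC.1
      rw [this, smul_zero, smul_zero]

theorem eq_one_iff_trace {M : Op α} : M = 1 ↔ ∀ H ∈ Hrm α, (M * H).trace = H.trace := by
  refine ⟨fun h H _ => by rw [h, one_mul], fun h => eq_of_trace_mul_hermitian fun H hH => ?_⟩
  rw [h H hH, one_mul]

theorem eq_one_iff_trace_kron {M : Op (α × β)} :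
    M = 1 ↔ ∀ A ∈ Hrm α, ∀ B ∈ Hrm β, (M * (A ⊗ₖ B)).trace = A.trace * B.trace := by
  refine ⟨fun h A _ B _ => by rw [h, one_mul, Matrix.trace_kronecker], fun h => ?_⟩
  rw [← sub_eq_zero]
  refine eq_zero_of_trace_mul_kron fun A hA B hB => ?_
  rw [Matrix.sub_mul, Matrix.trace_sub, h A hA B hB, one_mul, Matrix.trace_kronecker, sub_self]

/-- Exchange of the input and output bistochastic systems. -/
def swapInOut (α μ ν : Type) : (α × μ) × (α × ν) ≃ (α × μ) × (α × ν) where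
  toFun p := ((p.2.1, p.1.2), (p.1.1, p.2.2))
  invFun p := ((p.2.1, p.1.2), (p.1.1, p.2.2))
  left_inv _ := rfl
  right_inv _ := rfl

theorem trace_ptrR_mul (M : Op (α × β)) (H : Op α) :
    (ptrR M * H).trace = (M * (H ⊗ₖ (1 : Op β))).trace := by
  rw [trace_mul_kron, rslice_one]

theorem trace_ptrR_swapInOut_mul (M : Op ((α × μ) × (α × ν))) (C : Op α) (B : Op μ) :
    (ptrR (M.submatrix (swapInOut α μ ν) (swapInOut α μ ν)) * (C ⊗ₖ B)).trace =
      (M * (((1 : Op α) ⊗ₖ B) ⊗ₖ (C ⊗ₖ (1 : Op ν)))).trace := by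
  rw [trace_ptrR_mul, ← trace_submatrix_mul_submatrix (swapInOut α μ ν) M]
  congr 2
  rw [← Matrix.one_kronecker_one (α := ℂ) (m := α) (n := ν)]
  ext ⟨⟨a, m⟩, b, n⟩ ⟨⟨a', m'⟩, b', n'⟩
  simp only [swapInOut, Matrix.kroneckerMap_apply, Matrix.submatrix_apply, Equiv.coe_fn_mk]
  ring

theorem isAff_bistSpace_iff [Nonempty α] [Nonempty ν] {M : Op ((α × μ) × (α × ν))} :
    IsAff (bistSpace α μ ν) (1 / ((Fintype.card α : ℝ) * (Fintype.card ν : ℝ))) M ↔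
      M.IsHermitian ∧ ptrR M = 1 ∧
        ptrR (M.submatrix (swapInOut α μ ν) (swapInOut α μ ν)) = 1 := by
  have h1 : (Fintype.card α : ℂ) ≠ 0 := Nat.cast_ne_zero.mpr Fintype.card_ne_zero
  have h2 : (Fintype.card ν : ℂ) ≠ 0 := Nat.cast_ne_zero.mpr Fintype.card_ne_zero
  rw [isAff_bistSpace_iff_trace, eq_one_iff_trace, eq_one_iff_trace_kron]
  refine and_congr_right fun hM => and_congr ?_ ?_
  · refine forall₂_congr fun H hH => ?_
    rw [trace_ptrR_mul]
    have e : ((1 / ((Fintype.card α : ℝ) * (Fintype.card ν : ℝ)) : ℝ) : ℂ) *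
        (H.trace * (Fintype.card α * Fintype.card ν)) = H.trace := by
      push_cast
      field_simp
    rw [e]
  · have e : ∀ (B : Op μ) (C : Op α),
        ((1 / ((Fintype.card α : ℝ) * (Fintype.card ν : ℝ)) : ℝ) : ℂ) *
        ((Fintype.card α * B.trace) * (C.trace * Fintype.card ν)) = C.trace * B.trace := by
      intro B C
      push_cast
      field_simp
    simp_rw [e, trace_ptrR_swapInOut_mul]
    exact ⟨fun h C hC B hB => h B hB C hC, fun h B hB C hC => h C hC B hB⟩

end Bistochastic

/-! ### Direction spaces of types -/

section Transpose

variable {ι κ : Type} [Fintype ι] [DecidableEq ι]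

/-- Stability under transposition. -/
def TransposeStable {ι : Type} (U : Submodule ℝ (Op ι)) : Prop := ∀ X ∈ U, X.transpose ∈ U

theorem transposeStable_Hrm {ι : Type} : TransposeStable (Hrm ι) :=
  fun _ hX => Matrix.IsHermitian.transpose hX

theorem transposeStable_Trl : TransposeStable (Trl ι) :=
  fun X hX => ⟨hX.1.transpose, by rw [Matrix.trace_transpose, hX.2]⟩

theorem transposeStable_IdSp {ι : Type} [DecidableEq ι] : TransposeStable (IdSp ι) := by
  intro X hX
  obtain ⟨c, rfl⟩ := mem_IdSp.mp hX
  rwa [Matrix.transpose_smul, Matrix.transpose_one]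

theorem TransposeStable.perp {U : Submodule ℝ (Op ι)} (hU : TransposeStable U) :
    TransposeStable (perp U) := fun Y hY => ⟨hY.1.transpose, fun X hX => by
  rw [Matrix.trace_mul_comm, ← Matrix.trace_transpose, Matrix.transpose_mul,
    Matrix.transpose_transpose]
  exact hY.2 _ (hU X hX)⟩

theorem TransposeStable.bar {U : Submodule ℝ (Op ι)} (hU : TransposeStable U) :
    TransposeStable (bar U) := fun Y hY => ⟨hU.perp Y hY.1, transposeStable_Trl Y hY.2⟩

theorem TransposeStable.sup {ι : Type} {U V : Submodule ℝ (Op ι)} (hU : TransposeStable U)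
    (hV : TransposeStable V) : TransposeStable (U ⊔ V) := by
  intro X hX
  obtain ⟨A, hA, B, hB, rfl⟩ := Submodule.mem_sup.mp hX
  rw [Matrix.transpose_add]
  exact Submodule.add_mem_sup (hU A hA) (hV B hB)

theorem TransposeStable.tens {α β : Type} {U : Submodule ℝ (Op α)} {V : Submodule ℝ (Op β)}
    (hU : TransposeStable U) (hV : TransposeStable V) : TransposeStable (tens U V) := by
  intro X hX
  have : HOQ.tens U V ≤
      (HOQ.tens U V).comap (Matrix.transposeLinearEquiv (α × β) (α × β) ℝ ℂ).toLinearMap :=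
    tens_le.mpr fun A hA B hB => by
      change (A ⊗ₖ B).transpose ∈ HOQ.tens U V
      rw [← Matrix.kroneckerMap_transpose]
      exact kron_mem_tens (hU A hA) (hV B hB)
  exact this hX

end Transpose

instance Word.instNonemptyIdx : (w : Word) → Nonempty w.Idx
  | .nil => ⟨()⟩
  | .snoc w d => ⟨((Word.instNonemptyIdx w).some, (0 : Fin d))⟩

namespace Ty

instance instNonemptyIdx : (x : Ty) → Nonempty x.Idx
  | sys w => Word.instNonemptyIdx w
  | bist d u v => ⟨(((0 : Fin d), (Word.instNonemptyIdx u).some),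
      ((0 : Fin d), (Word.instNonemptyIdx v).some))⟩
  | arr x y => ⟨((instNonemptyIdx x).some, (instNonemptyIdx y).some)⟩

theorem Delta_le_Trl : (x : Ty) → x.Delta ≤ Trl x.Idx
  | sys _ => le_rfl
  | bist _ _ _ => bistSpace_le_Trl
  | arr _ y => arrow_le_Trl (Delta_le_Trl y)

theorem transposeStable_Delta : (x : Ty) → TransposeStable x.Delta
  | sys _ => transposeStable_Trl
  | bist _ _ _ => TransposeStable.sup
      (transposeStable_Hrm.tens (transposeStable_Hrm.tens transposeStable_Trl))
      ((transposeStable_Trl.tens transposeStable_Hrm).tens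
        (transposeStable_Trl.tens transposeStable_IdSp))
  | arr x y => TransposeStable.sup
      (transposeStable_Hrm.tens (transposeStable_Delta y))
      ((transposeStable_Delta x).bar.tens (transposeStable_Delta y).perp)

theorem lam_pos : (x : Ty) → 0 < x.lam
  | sys _ => one_div_pos.mpr (Nat.cast_pos.mpr Fintype.card_pos)
  | bist d _ _ => one_div_pos.mpr (mul_pos (Nat.cast_pos.mpr d.pos)
      (Nat.cast_pos.mpr Fintype.card_pos))
  | arr x y => div_pos (lam_pos y) (mul_pos (Nat.cast_pos.mpr Fintype.card_pos) (lam_pos x))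

/-- The affine span of the deterministic events. -/
def Aff (x : Ty) (M : Op x.Idx) : Prop := IsAff x.Delta x.lam M

theorem aff_sys_iff {w : Word} {M : Op w.Idx} :
    Aff (sys w) M ↔ M.IsHermitian ∧ M.trace = 1 := isAff_Trl_iff

theorem aff_bist_iff {d : ℕ+} {u v : Word} {M : Op ((Fin d × u.Idx) × (Fin d × v.Idx))} :
    Aff (bist d u v) M ↔ M.IsHermitian ∧ ptrR M = 1 ∧
      ptrR (M.submatrix (swapInOut (Fin d) u.Idx v.Idx) (swapInOut (Fin d) u.Idx v.Idx)) = 1 := by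
  rw [← isAff_bistSpace_iff, Fintype.card_fin]
  rfl

theorem aff_arr_iff {x y : Ty} {M : Op (x.Idx × y.Idx)} :
    Aff (arr x y) M ↔ M.IsHermitian ∧ ∀ ρ, Aff x ρ → Aff y (applyChoi M ρ) :=
  isAff_arrow_iff (Delta_le_Trl x) (Delta_le_Trl y) (transposeStable_Delta x) (lam_pos x).ne'

/-- By recursion on the type: the extending factor sits at the far end of the output, where every
linear condition already takes a trace. Positivity is therefore the only way in which an extension
matters. -/
theorem aff_ext_iff : (x : Ty) → (E : ℕ+) → (M : Op (x.ext E).Idx) →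
    (Aff (x.ext E) M ↔ M.IsHermitian ∧
      Aff x (ptrR (M.submatrix (x.extEquiv E).symm (x.extEquiv E).symm)))
  | sys w, E, M => by
    refine (aff_sys_iff (w := w.snoc E)).trans (and_congr_right fun hM => ?_)
    refine Iff.trans ?_ aff_sys_iff.symm
    have e := trace_ptrR (α := w.Idx) (β := Fin E) M
    exact ⟨fun h => ⟨isHermitian_ptrR hM, e.trans h⟩, fun h => e.symm.trans h.2⟩
  | bist d u v, E, M => by
    refine (aff_bist_iff (v := v.snoc E)).trans (and_congr_right fun hM => ?_)
    refine Iff.trans ?_ aff_bist_iff.symm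
    have h1 : ∀ N : Op ((Fin d × u.Idx) × (Fin d × (v.Idx × Fin E))),
        ptrR (ptrR (N.submatrix ((bist d u v).extEquiv E).symm ((bist d u v).extEquiv E).symm) :
          Op ((Fin d × u.Idx) × (Fin d × v.Idx))) = ptrR N := by
      intro N
      ext p q
      simp only [ptrR, Matrix.of_apply, Fintype.sum_prod_type]
      rfl
    have e1 := h1 M
    -- The exchange of bistochastic systems does not touch `v`, so it commutes definitionally with
    -- splitting off the extension.
    have e2 := h1 (M.submatrix (swapInOut _ _ _) (swapInOut _ _ _))
    have h3 : ∀ N : Op ((Fin d × u.Idx) × (Fin d × (v.Idx × Fin E))), N.IsHermitian →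
        (ptrR (N.submatrix ((bist d u v).extEquiv E).symm ((bist d u v).extEquiv E).symm) :
          Op ((Fin d × u.Idx) × (Fin d × v.Idx))).IsHermitian :=
      fun N hN => isHermitian_ptrR (hN.submatrix _)
    refine ⟨fun h => ⟨h3 M hM, e1.trans h.1, e2.trans h.2⟩,
      fun h => ⟨e1.symm.trans h.2.1, e2.symm.trans h.2.2⟩⟩
  | arr x y, E, M => by
    refine (aff_arr_iff (y := y.ext E)).trans (and_congr_right fun hM => ?_)
    refine Iff.trans ?_ aff_arr_iff.symm
    have hH : (ptrR (M.submatrix ((arr x y).extEquiv E).symm ((arr x y).extEquiv E).symm) :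
        Op (x.Idx × y.Idx)).IsHermitian := isHermitian_ptrR (hM.submatrix _)
    have key : ∀ ρ, Aff x ρ → (Aff (y.ext E) (applyChoi M ρ) ↔
        Aff y (applyChoi (ptrR (M.submatrix ((arr x y).extEquiv E).symm
          ((arr x y).extEquiv E).symm) : Op (x.Idx × y.Idx)) ρ)) := by
      intro ρ hρ
      rw [aff_ext_iff y E, ptrR_applyChoi (y.extEquiv E) M ρ]
      exact ⟨fun h => h.2, fun h => ⟨isHermitian_applyChoi hM hρ.1, h⟩⟩
    exact ⟨fun h => ⟨hH, fun ρ hρ => (key ρ hρ).mp (h ρ hρ)⟩,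
      fun h ρ hρ => (key ρ hρ).mpr (h.2 ρ hρ)⟩

/-- Positive operators in the affine span of the deterministic events. -/
def detSet (x : Ty) : Set (Op x.Idx) := {M | M.PosSemidef ∧ Aff x M}

/-! ### Event-preserving maps as positive operators in an affine space -/

section Arrow

variable {x y : Ty} {M D : Op (x.Idx × y.Idx)}

theorem posSemidef_act (E : ℕ+) {ρ : Op (x.ext E).Idx} (hM : M.PosSemidef) (hρ : ρ.PosSemidef) :
    (act x y E M ρ).PosSemidef :=
  (posSemidef_applyChoiExt hM (hρ.submatrix _)).submatrix _

theorem ptrR_act (E : ℕ+) (M : Op (x.Idx × y.Idx)) (ρ : Op (x.ext E).Idx) :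
    ptrR ((act x y E M ρ).submatrix (y.extEquiv E).symm (y.extEquiv E).symm) =
      applyChoi M (ptrR (ρ.submatrix (x.extEquiv E).symm (x.extEquiv E).symm)) := by
  rw [← ptrR_applyChoiExt, act, Matrix.submatrix_submatrix, Equiv.self_comp_symm,
    Matrix.submatrix_id_id]

theorem act_sub_left (E : ℕ+) (M N : Op (x.Idx × y.Idx)) (ρ : Op (x.ext E).Idx) :
    act x y E (M - N) ρ = act x y E M ρ - act x y E N ρ := by
  rw [act, applyChoiExt_sub_left, Matrix.submatrix_sub]
  rfl

theorem act_sub_right (E : ℕ+) (M : Op (x.Idx × y.Idx)) (ρ τ : Op (x.ext E).Idx) :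
    act x y E M (ρ - τ) = act x y E M ρ - act x y E M τ := by
  rw [act, Matrix.submatrix_sub, Pi.sub_apply, Pi.sub_apply, applyChoiExt_sub_right,
    Matrix.submatrix_sub]
  rfl

theorem act_mem_detSet (hM : M ∈ detSet (arr x y)) (E : ℕ+) {ρ : Op (x.ext E).Idx}
    (hρ : ρ ∈ detSet (x.ext E)) : act x y E M ρ ∈ detSet (y.ext E) := by
  have hpos := posSemidef_act E hM.1 hρ.1
  refine ⟨hpos, (aff_ext_iff y E _).mpr ⟨hpos.isHermitian, ?_⟩⟩
  rw [ptrR_act]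
  exact (aff_arr_iff.mp hM.2).2 _ ((aff_ext_iff x E ρ).mp hρ.2).2

/-- If `ρ ≤ τ` and `M ≤ D`, then `D(τ) - M(ρ) = (D - M)(τ) + M(τ - ρ)` is a sum of two positive
terms. -/
theorem act_mem_dominated (hM : M.PosSemidef) (hD : D ∈ detSet (arr x y))
    (hMD : (D - M).PosSemidef) (E : ℕ+) {ρ : Op (x.ext E).Idx}
    (hρ : ρ ∈ dominated (detSet (x.ext E))) : act x y E M ρ ∈ dominated (detSet (y.ext E)) := by
  obtain ⟨hρ0, τ, hτ, hρτ⟩ := hρ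
  refine ⟨posSemidef_act E hM hρ0, act x y E D τ, act_mem_detSet hD E hτ, ?_⟩
  have e : act x y E D τ - act x y E M ρ = act x y E (D - M) τ + act x y E M (τ - ρ) := by
    rw [act_sub_left, act_sub_right]
    abel
  rw [e]
  exact (posSemidef_act E hMD hτ.1).add (posSemidef_act E hM hρτ)

theorem smul_one_mem_detSet (x : Ty) : x.lam • (1 : Op x.Idx) ∈ detSet x :=
  ⟨Matrix.PosSemidef.one.smul (lam_pos x).le, isAff_smul_one (Delta_le_Trl x) _⟩

theorem exists_smul_mem_dominated {x : Ty} {ρ : Op x.Idx} (hρ : ρ.PosSemidef) :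
    ∃ c : ℝ, 0 < c ∧ c • ρ ∈ dominated (detSet x) := by
  obtain ⟨c, hc, h⟩ := exists_smul_one_sub_posSemidef hρ.isHermitian
  refine ⟨x.lam / c, div_pos (lam_pos x) hc, hρ.smul (div_pos (lam_pos x) hc).le, _,
    smul_one_mem_detSet x, ?_⟩
  have h' := h.smul (div_pos (lam_pos x) hc).le
  rwa [smul_sub, smul_smul, div_mul_cancel₀ _ hc.ne'] at h'

/-- Choi's argument: a small multiple of the maximally entangled operator on `x ⊗ E` is admissible,
and its image is that multiple of `M` up to relabelling. -/
theorem posSemidef_of_preserves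
    (h : ∀ E : ℕ+, ∀ ρ ∈ dominated (detSet (x.ext E)),
      act x y E M ρ ∈ dominated (detSet (y.ext E))) : M.PosSemidef := by
  let E : ℕ+ := ⟨Fintype.card x.Idx, Fintype.card_pos⟩
  let e : x.Idx ≃ Fin E := Fintype.equivFin x.Idx
  let φ : Matrix (x.Idx × Fin E) Unit ℂ := Matrix.of fun p _ => if e p.1 = p.2 then 1 else 0
  have hφ := (Matrix.posSemidef_self_mul_conjTranspose φ).submatrix (x.extEquiv E)
  obtain ⟨c, hc, hcρ⟩ := exists_smul_mem_dominated hφ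
  have h1 := ((h E _ hcρ).1.submatrix (y.extEquiv E).symm).submatrix
    (fun p : x.Idx × y.Idx => (p.2, e p.1))
  have h2 := h1.smul (inv_pos.mpr hc).le
  convert h2 using 1
  ext p q
  rw [Matrix.smul_apply, Matrix.submatrix_apply, act, Matrix.submatrix_submatrix,
    Equiv.self_comp_symm, Matrix.submatrix_id_id, applyChoiExt_apply]
  have hc' : (c : ℂ) ≠ 0 := by exact_mod_cast hc.ne'
  have : ∀ a a', ((c • (φ * φ.conjTranspose).submatrix (x.extEquiv E) (x.extEquiv E)).submatrix
      (x.extEquiv E).symm (x.extEquiv E).symm) (a, e p.1) (a', e q.1) =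
        if a = p.1 then (if a' = q.1 then (c : ℂ) else 0) else 0 := by
    intro a a'
    simp only [Matrix.smul_apply, Matrix.submatrix_apply,
      Equiv.apply_symm_apply, Matrix.mul_apply, Matrix.conjTranspose_apply, φ, Matrix.of_apply,
      EmbeddingLike.apply_eq_iff_eq]
    by_cases h1 : a = p.1 <;> by_cases h2 : a' = q.1 <;> simp [h1, h2]
  simp only [this]
  simp [hc']

/-- Preservation gives information only on deterministic events; it extends to the whole affine
space because they contain a relative neighbourhood of the interior point `λ_x 1`. -/
theorem aff_of_preserves (hM : M.PosSemidef)
    (h : ∀ E : ℕ+, ∀ ρ ∈ detSet (x.ext E), act x y E M ρ ∈ detSet (y.ext E)) :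
    Aff (arr x y) M := by
  refine aff_arr_iff.mpr ⟨hM.isHermitian, fun ρ hρ => ?_⟩
  have hpos : ∀ τ ∈ detSet x, Aff y (applyChoi M τ) := by
    intro τ hτ
    -- Extension by a one-dimensional system stands in for no extension.
    let τ' : Op (x.ext 1).Idx := (τ.submatrix Prod.fst Prod.fst).submatrix
      (x.extEquiv 1) (x.extEquiv 1)
    have hτ' : ptrR (τ'.submatrix (x.extEquiv 1).symm (x.extEquiv 1).symm) = τ := by
      rw [Matrix.submatrix_submatrix, Equiv.self_comp_symm, Matrix.submatrix_id_id]
      ext a a'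
      simp only [ptrR, Matrix.of_apply, Matrix.submatrix_apply]
      exact Fintype.sum_unique (ι := Fin 1) _
    have hp : τ'.PosSemidef := (hτ.1.submatrix _).submatrix _
    have := h 1 τ' ⟨hp, (aff_ext_iff x 1 τ').mpr ⟨hp.isHermitian, by rw [hτ']; exact hτ.2⟩⟩
    have := ((aff_ext_iff y 1 _).mp this.2).2
    rwa [ptrR_act, hτ'] at this
  obtain ⟨c, hc, hcp⟩ := exists_smul_one_sub_posSemidef
    ((Hrm _).sub_mem (isAff_smul_one (Delta_le_Trl x) x.lam).1 hρ.1)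
  have hl := lam_pos x
  have h0 := hpos _ (smul_one_mem_detSet x)
  -- Move from the centre towards `ρ` by a fraction small enough to stay positive; extrapolating by
  -- the inverse factor `c / λ_x` then recovers the image of `ρ`.
  have hτ : x.lam • (1 : Op x.Idx) + (x.lam / c) • (ρ - x.lam • 1) ∈ detSet x := by
    refine ⟨?_, (isAff_smul_one (Delta_le_Trl x) x.lam).lineMap hρ _⟩
    have h' := hcp.smul (div_pos hl hc).le
    rw [smul_sub, smul_smul, div_mul_cancel₀ _ hc.ne', ← neg_sub ρ, smul_neg, sub_neg_eq_add] at h'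
    exact h'
  have h1 := hpos _ hτ
  have h2 := IsAff.lineMap h0 h1 (c / x.lam)
  have e : applyChoi M (x.lam • 1) + (c / x.lam) •
      (applyChoi M (x.lam • 1 + (x.lam / c) • (ρ - x.lam • 1)) - applyChoi M (x.lam • 1)) =
      applyChoi M ρ := by
    rw [applyChoi_add, add_sub_cancel_left, applyChoi_smul M (x.lam / c), smul_smul,
      div_mul_div_cancel₀ hl.ne', div_self hc.ne', one_smul, ← applyChoi_add,
      add_sub_cancel]
  rw [e] at h2
  exact h2

/-- `detSet` of an arrow type, as a set of operators on the product space. -/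
def detArr (x y : Ty) : Set (Op (x.Idx × y.Idx)) := detSet (arr x y)

theorem preserves_det_iff :
    ((∀ E : ℕ+, ∀ ρ ∈ dominated (detSet (x.ext E)),
        act x y E M ρ ∈ dominated (detSet (y.ext E))) ∧
      ∀ E : ℕ+, ∀ ρ ∈ detSet (x.ext E), act x y E M ρ ∈ detSet (y.ext E)) ↔ M ∈ detArr x y := by
  constructor
  · rintro ⟨hM, hM'⟩
    have hp := posSemidef_of_preserves hM
    exact ⟨hp, aff_of_preserves hp hM'⟩
  · intro hD
    exact ⟨fun E ρ hρ => act_mem_dominated hD.1 hD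
      (by rw [sub_self]; exact Matrix.PosSemidef.zero) E hρ, fun E ρ hρ => act_mem_detSet hD E hρ⟩

theorem preserves_dominated_iff :
    ((∀ E : ℕ+, ∀ ρ ∈ dominated (detSet (x.ext E)),
        act x y E M ρ ∈ dominated (detSet (y.ext E))) ∧
      ∃ (k : ℕ) (N : Fin k → Op (x.Idx × y.Idx)),
        (∀ i, ∀ E : ℕ+, ∀ ρ ∈ dominated (detSet (x.ext E)),
          act x y E (N i) ρ ∈ dominated (detSet (y.ext E))) ∧
        (∀ E : ℕ+, ∀ ρ ∈ dominated (detSet (x.ext E)),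
          act x y E (M + ∑ i, N i) ρ ∈ dominated (detSet (y.ext E))) ∧
        ∀ E : ℕ+, ∀ ρ ∈ detSet (x.ext E), act x y E (M + ∑ i, N i) ρ ∈ detSet (y.ext E)) ↔
      M ∈ dominated (detArr x y) := by
  constructor
  · rintro ⟨hM, k, N, hN, hD⟩
    refine ⟨posSemidef_of_preserves hM, M + ∑ i, N i, preserves_det_iff.mp hD, ?_⟩
    rw [add_sub_cancel_left]
    exact Matrix.posSemidef_sum _ fun i _ => posSemidef_of_preserves (hN i)
  -- A single completing operator is enough, namely `D - M`, itself dominated by `D`.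
  · rintro ⟨hM, D, hD, hDM⟩
    refine ⟨fun E ρ hρ => act_mem_dominated hM hD hDM E hρ, 1, fun _ => D - M,
      fun _ E ρ hρ => act_mem_dominated hDM hD (by rwa [sub_sub_cancel]) E hρ, ?_⟩
    have e : M + ∑ _i : Fin 1, (D - M) = D := by simp
    rw [e]
    exact preserves_det_iff.mpr hD

end Arrow

/-- The arrow case refers to `x ‖ E` and `y ‖ E`, which are not subterms; extension keeps the depth,
so strong induction on depth applies. -/
theorem events_eq (x : Ty) : events x = (dominated (detSet x), detSet x) := by
  induction h : x.depth using Nat.strong_induction_on generalizing x with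
  | _ n ih =>
    cases x with
    | sys w =>
      have e : detSys w = detSet (sys w) := by
        ext M
        refine and_congr_right fun hM => ?_
        exact ⟨fun h => aff_sys_iff.mpr ⟨hM.isHermitian, h⟩, fun h => (aff_sys_iff.mp h).2⟩
      rw [events, e]
    | bist d u v =>
      have e : detBist d u v = detSet (bist d u v) := by
        ext M
        refine and_congr_right fun hM => ?_
        exact ⟨fun h => aff_bist_iff.mpr ⟨hM.isHermitian, h⟩, fun h => (aff_bist_iff.mp h).2⟩
      rw [events, e]
    | arr x y =>
      have hx : ∀ E, events (x.ext E) = (dominated (detSet (x.ext E)), detSet (x.ext E)) :=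
        fun E => ih _ (by rw [← h, depth]; omega) (x.ext E) (depth_ext x E)
      have hy : ∀ E, events (y.ext E) = (dominated (detSet (y.ext E)), detSet (y.ext E)) :=
        fun E => ih _ (by rw [← h, depth]; omega) (y.ext E) (depth_ext y E)
      rw [events]
      simp only [hx, hy]
      exact Prod.ext (Set.ext fun M => preserves_dominated_iff)
        (Set.ext fun M => preserves_det_iff)

theorem mem_T1_iff {x : Ty} {M : Op x.Idx} : M ∈ x.T1 ↔ M.PosSemidef ∧ IsAff x.Delta x.lam M := by
  rw [T1, events_eq]
  rfl

end Ty

/-! ### Reindexing -/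

section Reindexing

variable {ι κ α β α' β' : Type}

/-- Reindexing of operators along an equivalence of the bases. -/
def reix (e : ι ≃ κ) : Op ι ≃ₗ[ℝ] Op κ := Matrix.reindexLinearEquiv ℝ ℂ e e

theorem reix_apply (e : ι ≃ κ) (M : Op ι) : reix e M = M.submatrix e.symm e.symm := rfl

theorem reix_symm_apply (e : ι ≃ κ) (M : Op κ) : (reix e).symm M = M.submatrix e e := rfl

theorem isHermitian_submatrix_equiv (e : ι ≃ κ) {M : Op κ} :
    (M.submatrix e e).IsHermitian ↔ M.IsHermitian := by
  refine ⟨fun h => ?_, fun h => h.submatrix e⟩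
  have := h.submatrix e.symm
  simpa using this

theorem map_Hrm (e : ι ≃ κ) : (Hrm ι).map (reix e).toLinearMap = Hrm κ := by
  ext X
  rw [Submodule.mem_map_equiv, reix_symm_apply]
  refine ⟨fun h => ?_, fun h => Matrix.IsHermitian.submatrix h e⟩
  exact (isHermitian_submatrix_equiv e).mp h

theorem map_IdSp [DecidableEq ι] [DecidableEq κ] (e : ι ≃ κ) :
    (IdSp ι).map (reix e).toLinearMap = IdSp κ := by
  rw [IdSp, Submodule.map_span, Set.image_singleton, IdSp]
  congr 2
  exact Matrix.submatrix_one_equiv e.symm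

theorem map_perp [Fintype ι] [Fintype κ] (e : ι ≃ κ) (U : Submodule ℝ (Op ι)) :
    (perp U).map (reix e).toLinearMap = perp (U.map (reix e).toLinearMap) := by
  ext Y
  have hH := (map_Hrm e).le
  rw [Submodule.mem_map_equiv, mem_perp, mem_perp, reix_symm_apply,
    isHermitian_submatrix_equiv e]
  refine and_congr_right fun _ => ⟨fun h X hX => ?_, fun h X hX => ?_⟩
  · rw [Submodule.mem_map_equiv] at hX
    rw [← trace_submatrix_mul_submatrix e]
    exact h _ hX
  · rw [← h _ (Submodule.mem_map_of_mem hX), ← trace_submatrix_mul_submatrix e]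
    congr 2
    ext i j
    simp [reix_apply]

theorem map_Trl [Fintype ι] [Fintype κ] (e : ι ≃ κ) :
    (Trl ι).map (reix e).toLinearMap = Trl κ := by
  classical
  rw [← perp_IdSp, map_perp, map_IdSp, perp_IdSp]

theorem map_bar [Fintype ι] [Fintype κ] (e : ι ≃ κ) (U : Submodule ℝ (Op ι)) :
    (bar U).map (reix e).toLinearMap = bar (U.map (reix e).toLinearMap) := by
  rw [bar, bar, Submodule.map_inf _ (reix e).injective, map_perp, map_Trl]

theorem map_tens (e : α ≃ α') (f : β ≃ β') (U : Submodule ℝ (Op α)) (V : Submodule ℝ (Op β)) :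
    (tens U V).map (reix (e.prodCongr f)).toLinearMap =
      tens (U.map (reix e).toLinearMap) (V.map (reix f).toLinearMap) := by
  apply le_antisymm
  · rw [Submodule.map_le_iff_le_comap, tens_le]
    exact fun A hA B hB => kron_mem_tens (Submodule.mem_map_of_mem hA)
      (Submodule.mem_map_of_mem hB)
  · rw [tens_le]
    rintro _ ⟨A, hA, rfl⟩ _ ⟨B, hB, rfl⟩
    exact ⟨A ⊗ₖ B, kron_mem_tens hA hB, rfl⟩

/-- The bilinear map `A, B ↦ A ⊗ B`. -/
def kronBilin (α β : Type) : Op α →ₗ[ℝ] Op β →ₗ[ℝ] Op (α × β) :=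
  LinearMap.mk₂ ℝ (fun A B => A ⊗ₖ B) (fun _ _ _ => Matrix.add_kronecker _ _ _)
    (fun _ _ _ => Matrix.smul_kronecker _ _ _) (fun _ _ _ => Matrix.kronecker_add _ _ _)
    (fun _ _ _ => Matrix.kronecker_smul _ _ _)

theorem tens_eq_map₂ (U : Submodule ℝ (Op α)) (V : Submodule ℝ (Op β)) :
    tens U V = Submodule.map₂ (kronBilin α β) U V := by
  apply le_antisymm
  · exact tens_le.mpr fun A hA B hB => Submodule.apply_mem_map₂ (kronBilin α β) hA hB
  · exact Submodule.map₂_le.mpr fun A hA B hB => kron_mem_tens hA hB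

theorem tens_sup_right (U : Submodule ℝ (Op α)) (V V' : Submodule ℝ (Op β)) :
    tens U (V ⊔ V') = tens U V ⊔ tens U V' := by
  simp only [tens_eq_map₂, Submodule.map₂_sup_right]

theorem tens_iSup_left {J : Sort*} (U : J → Submodule ℝ (Op α)) (V : Submodule ℝ (Op β)) :
    tens (⨆ i, U i) V = ⨆ i, tens (U i) V := by
  simp only [tens_eq_map₂, Submodule.map₂_iSup_left]

theorem map_tens_assoc {γ : Type} (U : Submodule ℝ (Op α)) (V : Submodule ℝ (Op β))
    (W : Submodule ℝ (Op γ)) :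
    (tens U (tens V W)).map (reix (Equiv.prodAssoc α β γ).symm).toLinearMap =
      tens (tens U V) W := by
  have e : ∀ (A : Op α) (B : Op β) (C : Op γ),
      reix (Equiv.prodAssoc α β γ).symm (A ⊗ₖ (B ⊗ₖ C)) = (A ⊗ₖ B) ⊗ₖ C := by
    intro A B C
    ext ⟨⟨a, b⟩, c⟩ ⟨⟨a', b'⟩, c'⟩
    exact (mul_assoc _ _ _).symm
  apply le_antisymm
  · rw [Submodule.map_le_iff_le_comap, tens_le]
    intro A hA Z hZ
    have : tens V W ≤ (tens (tens U V) W).comap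
        ((reix (Equiv.prodAssoc α β γ).symm).toLinearMap.comp (kronBilin α (β × γ) A)) :=
      tens_le.mpr fun B hB C hC => by
        change reix (Equiv.prodAssoc α β γ).symm (A ⊗ₖ (B ⊗ₖ C)) ∈ tens (tens U V) W
        rw [e]
        exact kron_mem_tens (kron_mem_tens hA hB) hC
    exact this hZ
  · rw [tens_le]
    intro Z hZ C hC
    have : tens U V ≤ ((tens U (tens V W)).map
        (reix (Equiv.prodAssoc α β γ).symm).toLinearMap).comap
          ((kronBilin (α × β) γ).flip C) :=
      tens_le.mpr fun A hA B hB => ⟨A ⊗ₖ (B ⊗ₖ C), kron_mem_tens hA (kron_mem_tens hB hC), e A B C⟩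
    exact this hZ

theorem tens_Hrm_Hrm [Fintype α] [Fintype β] : tens (Hrm α) (Hrm β) = Hrm (α × β) := by
  classical
  refine le_antisymm (tens_le_Hrm le_rfl le_rfl) fun Z hZ => ?_
  refine perp_bot (ι := α) ▸ perp_tens_Hrm_le bot_le ⟨hZ, fun X hX => ?_⟩
  have h : tens (⊥ : Submodule ℝ (Op α)) (Hrm β) ≤ ⊥ := tens_le.mpr fun A hA B _ => by
    rw [(Submodule.mem_bot ℝ).mp hA, Matrix.zero_kronecker]
    exact Submodule.zero_mem _
  rw [(Submodule.mem_bot ℝ).mp (h hX), zero_mul, Matrix.trace_zero]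

/-- A `1 × 1` Hermitian matrix is a real scalar. This is how tensor factors `I` are suppressed. -/
theorem Hrm_unique [Unique ι] [DecidableEq ι] : Hrm ι = IdSp ι := by
  refine le_antisymm (fun X hX => mem_IdSp.mpr ⟨(X default default).re, ?_⟩) IdSp_le_Hrm
  have hX' : X.IsHermitian := hX
  ext i j
  rw [Unique.eq_default i, Unique.eq_default j, Matrix.smul_apply, Matrix.one_apply_eq,
    Complex.real_smul, mul_one]
  exact Complex.conj_eq_iff_re.mp (hX'.apply default default)

theorem Trl_unique [Unique ι] [Fintype ι] : Trl ι = ⊥ := by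
  classical
  rw [← perp_IdSp, ← Hrm_unique, perp_Hrm]

theorem tens_unique_right [Unique β] (U : Submodule ℝ (Op α)) :
    tens U (Hrm β) = U.map (reix (Equiv.prodUnique α β).symm).toLinearMap := by
  classical
  have e : ∀ A : Op α, reix (Equiv.prodUnique α β).symm A = A ⊗ₖ (1 : Op β) := by
    intro A
    ext ⟨a, b⟩ ⟨a', b'⟩
    rw [Matrix.kroneckerMap_apply, Subsingleton.elim b b', Matrix.one_apply_eq, mul_one]
    rfl
  rw [Hrm_unique]
  apply le_antisymm
  · rw [tens_le]
    intro A hA B hB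
    obtain ⟨c, rfl⟩ := mem_IdSp.mp hB
    rw [Matrix.kronecker_smul]
    exact Submodule.smul_mem _ _ ⟨A, hA, e A⟩
  · rintro _ ⟨A, hA, rfl⟩
    exact (e A).symm ▸ kron_mem_tens hA one_mem_IdSp

theorem tens_unique_left [Unique α] (U : Submodule ℝ (Op β)) :
    tens (Hrm α) U = U.map (reix (Equiv.uniqueProd β α).symm).toLinearMap := by
  classical
  have e : ∀ A : Op β, reix (Equiv.uniqueProd β α).symm A = (1 : Op α) ⊗ₖ A := by
    intro A
    ext ⟨b, a⟩ ⟨b', a'⟩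
    rw [Matrix.kroneckerMap_apply, Subsingleton.elim b b', Matrix.one_apply_eq, one_mul]
    rfl
  rw [Hrm_unique]
  apply le_antisymm
  · rw [tens_le]
    intro B hB A hA
    obtain ⟨c, rfl⟩ := mem_IdSp.mp hB
    rw [Matrix.smul_kronecker]
    exact Submodule.smul_mem _ _ ⟨A, hA, e A⟩
  · rintro _ ⟨A, hA, rfl⟩
    exact (e A).symm ▸ kron_mem_tens one_mem_IdSp hA

end Reindexing

/-! ### Nodes -/

section Nodes

variable {ε κ φ : Type} [Fintype ε] [DecidableEq ε] [Fintype κ] [DecidableEq κ] [Fintype φ]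
  [DecidableEq φ]

/-- Positive operators on `ε ⊗ κ ⊗ φ` which, contracted on `κ` with any operator orthogonal to `U`
and traced over `φ`, give a multiple of the identity of `ε`. -/
def IsNodeOf (U : Submodule ℝ (Op κ)) (l : ℝ) (M : Op (ε × κ × φ)) : Prop :=
  M.PosSemidef ∧ ∀ Y ∈ perp U, rslice M (Y ⊗ₖ (1 : Op φ)) = (l * Y.trace) • (1 : Op ε)

theorem isNodeOf_iff_trace {U : Submodule ℝ (Op κ)} {l : ℝ} {M : Op (ε × κ × φ)} :
    IsNodeOf U l M ↔ M.PosSemidef ∧ ∀ H ∈ Hrm ε, ∀ Y ∈ perp U,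
      (M * (H ⊗ₖ (Y ⊗ₖ (1 : Op φ)))).trace = l * H.trace * Y.trace := by
  refine and_congr_right fun _ => ⟨fun h H _ Y hY => ?_, fun h Y hY => ?_⟩
  · rw [trace_mul_kron, h Y hY, Matrix.smul_mul, one_mul, Matrix.trace_smul, smul_eq_mul]
    ring
  · refine eq_of_trace_mul_hermitian fun H hH => ?_
    rw [← trace_mul_kron, h H hH Y hY, Matrix.smul_mul, one_mul, Matrix.trace_smul, smul_eq_mul]
    ring

theorem bar_Trl : bar (Trl κ) = ⊥ := by
  have h : bar (⊥ : Submodule ℝ (Op κ)) = Trl κ := by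
    rw [bar, perp_bot, inf_eq_right]
    exact Trl_le_Hrm
  rw [← h, bar_bar bot_le]

theorem bot_tens (V : Submodule ℝ (Op φ)) : tens (⊥ : Submodule ℝ (Op ε)) V = ⊥ := by
  rw [eq_bot_iff, tens_le]
  intro A hA B _
  rw [(Submodule.mem_bot ℝ).mp hA, Matrix.zero_kronecker]
  exact Submodule.zero_mem _

theorem mem_tens_Hrm_of_trace {V : Submodule ℝ (Op φ)} (hV : V ≤ Hrm φ) {Z : Op (ε × φ)}
    (hZ : Z.IsHermitian)
    (h : ∀ H ∈ Hrm ε, ∀ Y ∈ perp V, (Z * (H ⊗ₖ Y)).trace = 0) : Z ∈ tens (Hrm ε) V := by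
  have := mem_sup_tens_of_trace (U := ⊥) (Q := ⊥) hZ bot_le hV bot_le
    (by rwa [sup_bot_eq]) (by
      intro H _ Y hY
      rw [(Submodule.mem_bot ℝ).mp hY, Matrix.kronecker_zero, mul_zero, Matrix.trace_zero])
  rwa [tens_bot, sup_bot_eq] at this

theorem perp_tens_Hrm_Trl : perp (tens (Hrm ε) (Trl φ)) = tens (Hrm ε) (IdSp φ) := by
  apply le_antisymm
  · intro Z hZ
    refine mem_tens_Hrm_of_trace IdSp_le_Hrm hZ.1 fun H hH Y hY => ?_
    rw [perp_IdSp] at hY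
    rw [Matrix.trace_mul_comm]
    exact hZ.2 _ (kron_mem_tens hH hY)
  · exact tens_le.mpr fun A hA B hB => kron_mem_perp_tens_right hA (perp_Trl (ι := φ) ▸ hB)

/-- Since `bar (Trl)` vanishes, the direction space of `E → F` is `Hrm(E) ⊗ Trl(F)`, with complement
`Hrm(E) ⊗ 1_F`. The tests thus trace out `F`, and its dimension is absorbed into the weight. -/
theorem isAff_supermap_iff {U : Submodule ℝ (Op κ)} {l : ℝ} {N : Op (κ × (ε × φ))} :
    IsAff (tens (Hrm κ) (tens (Hrm ε) (Trl φ) ⊔ tens (bar (Trl ε)) (perp (Trl φ))) ⊔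
        tens (bar U) (perp (tens (Hrm ε) (Trl φ) ⊔ tens (bar (Trl ε)) (perp (Trl φ))))) l N ↔
      N.IsHermitian ∧ ∀ H ∈ Hrm ε, ∀ Y ∈ perp (bar U),
        (N * (Y ⊗ₖ (H ⊗ₖ (1 : Op φ)))).trace = (l * Fintype.card φ) * H.trace * Y.trace := by
  rw [bar_Trl, bot_tens, sup_bot_eq, isAff_arrow_iff_trace (tens_le_Trl_right le_rfl le_rfl),
    perp_tens_Hrm_Trl]
  refine and_congr_right fun _ => ⟨fun h H hH Y hY => ?_, fun h Y hY Z hZ => ?_⟩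
  · rw [h Y hY _ (kron_mem_tens hH one_mem_IdSp), Matrix.trace_kronecker, Matrix.trace_one]
    ring
  · rw [← sub_eq_zero]
    let f : Op (ε × φ) →ₗ[ℝ] ℂ :=
      { toFun := fun Z => (N * (Y ⊗ₖ Z)).trace - l * Y.trace * Z.trace
        map_add' := fun A B => by
          rw [Matrix.kronecker_add, Matrix.mul_add, Matrix.trace_add, Matrix.trace_add]
          ring
        map_smul' := fun c A => by
          rw [Matrix.kronecker_smul, Matrix.mul_smul, Matrix.trace_smul, Matrix.trace_smul,
            Complex.real_smul, Complex.real_smul, RingHom.id_apply, Complex.real_smul]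
          ring }
    refine apply_eq_zero_of_mem_tens f (fun H hH B hB => ?_) hZ
    obtain ⟨c, rfl⟩ := mem_IdSp.mp hB
    rw [Matrix.kronecker_smul, map_smul]
    have : f (H ⊗ₖ (1 : Op φ)) = 0 := by
      change (N * (Y ⊗ₖ (H ⊗ₖ (1 : Op φ)))).trace - l * Y.trace * (H ⊗ₖ (1 : Op φ)).trace = 0
      rw [h H hH Y hY, Matrix.trace_kronecker, Matrix.trace_one]
      ring
    rw [this, smul_zero]

/-- `ε ⊗ κ ⊗ φ` with the middle factor in front. -/
def midFront (ε κ φ : Type) : κ × (ε × φ) ≃ ε × κ × φ where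
  toFun p := (p.2.1, p.1, p.2.2)
  invFun p := (p.2.1, (p.1, p.2.2))
  left_inv _ := rfl
  right_inv _ := rfl

theorem trace_midFront (M : Op (ε × κ × φ)) (Y : Op κ) (H : Op ε) :
    (M.submatrix (midFront ε κ φ) (midFront ε κ φ) * (Y ⊗ₖ (H ⊗ₖ (1 : Op φ)))).trace =
      (M * (H ⊗ₖ (Y ⊗ₖ (1 : Op φ)))).trace := by
  rw [← trace_submatrix_mul_submatrix (midFront ε κ φ) M]
  congr 2
  ext ⟨k, e, f⟩ ⟨k', e', f'⟩
  simp only [midFront, Matrix.kroneckerMap_apply, Matrix.submatrix_apply, Equiv.coe_fn_mk]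
  ring

theorem isNodeOf_map_iff {κ' : Type} [Fintype κ'] [DecidableEq κ'] (e : κ ≃ κ')
    {U : Submodule ℝ (Op κ)} {l : ℝ} {M : Op (ε × κ' × φ)} :
    IsNodeOf (U.map (reix e).toLinearMap) l M ↔
      IsNodeOf U l (M.submatrix ((Equiv.refl ε).prodCongr (e.prodCongr (Equiv.refl φ)))
        ((Equiv.refl ε).prodCongr (e.prodCongr (Equiv.refl φ)))) := by
  rw [isNodeOf_iff_trace, isNodeOf_iff_trace, Matrix.posSemidef_submatrix_equiv, ← map_perp]
  refine and_congr_right fun _ => forall₂_congr fun H hH => ?_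
  have key : ∀ Y : Op κ, (M * (H ⊗ₖ (reix e Y ⊗ₖ (1 : Op φ)))).trace =
      (M.submatrix ((Equiv.refl ε).prodCongr (e.prodCongr (Equiv.refl φ)))
        ((Equiv.refl ε).prodCongr (e.prodCongr (Equiv.refl φ))) *
          (H ⊗ₖ (Y ⊗ₖ (1 : Op φ)))).trace := by
    intro Y
    rw [← trace_submatrix_mul_submatrix ((Equiv.refl ε).prodCongr (e.prodCongr (Equiv.refl φ))) M]
    congr 2
    ext ⟨a, k, b⟩ ⟨a', k', b'⟩
    simp [reix_apply]
  have htr : ∀ Y : Op κ, (reix e Y).trace = Y.trace := fun Y =>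
    Equiv.sum_comp e.symm fun k => Y k k
  constructor
  · intro h Y hY
    rw [← key, ← htr]
    exact h _ (Submodule.mem_map_of_mem hY)
  · rintro h _ ⟨Y, hY, rfl⟩
    have := h Y hY
    rw [← key, ← htr] at this
    exact this

end Nodes

/-! ### Functional types, weights, and the nodes of a network -/

instance Word.instUniqueTrivIdx : Unique Word.triv.Idx :=
  { default := ((), (0 : Fin 1))
    uniq := fun _ => Prod.ext rfl (Subsingleton.elim (α := Fin 1) _ _) }

theorem lam_sys_arr (E F : Word) : (Ty.arr (Ty.sys E) (Ty.sys F)).lam =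
    1 / (Fintype.card F.Idx : ℝ) := by
  have h : (Fintype.card E.Idx : ℝ) ≠ 0 := Nat.cast_ne_zero.mpr Fintype.card_ne_zero
  change 1 / (Fintype.card F.Idx : ℝ) / ((Fintype.card E.Idx : ℝ) * (1 / Fintype.card E.Idx)) = _
  field_simp

theorem lam_func (x : Ty) : x.func.lam = 1 / ((Fintype.card x.Idx : ℝ) * x.lam) := by
  change 1 / (Fintype.card Word.triv.Idx : ℝ) / ((Fintype.card x.Idx : ℝ) * x.lam) = _
  rw [Fintype.card_unique, Nat.cast_one, div_one]

theorem card_func (x : Ty) : Fintype.card x.func.Idx = Fintype.card x.Idx := by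
  have : Fintype.card x.func.Idx = Fintype.card (x.Idx × Word.triv.Idx) := rfl
  rw [this, Fintype.card_prod, Fintype.card_unique (α := Word.triv.Idx), mul_one]

/-- The factor `1/d_F` in the weight of `E → F` cancels against the trace of the identity of `F`, so
the node condition depends on `x` alone. -/
theorem mem_T1_supermap_iff {x : Ty} {E F : Word} {M : Op (E.Idx × x.Idx × F.Idx)} :
    M.submatrix (midFront E.Idx x.Idx F.Idx) (midFront E.Idx x.Idx F.Idx) ∈
        (Ty.arr x (Ty.arr (Ty.sys E) (Ty.sys F))).T1 ↔
      IsNodeOf (bar x.Delta) (1 / ((Fintype.card x.Idx : ℝ) * x.lam)) M := by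
  have hF : (Fintype.card F.Idx : ℝ) ≠ 0 := Nat.cast_ne_zero.mpr Fintype.card_ne_zero
  have key : ∀ N : Op (x.Idx × (E.Idx × F.Idx)),
      N ∈ (Ty.arr x (Ty.arr (Ty.sys E) (Ty.sys F))).T1 ↔
        N.PosSemidef ∧ ∀ H ∈ Hrm E.Idx, ∀ Y ∈ perp (bar x.Delta),
          (N * (Y ⊗ₖ (H ⊗ₖ (1 : Op F.Idx)))).trace =
            ((Ty.arr x (Ty.arr (Ty.sys E) (Ty.sys F))).lam * Fintype.card F.Idx) *
              H.trace * Y.trace :=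
    fun N => Ty.mem_T1_iff.trans (and_congr_right fun hN =>
      (isAff_supermap_iff (U := x.Delta)).trans ⟨And.right, fun h => ⟨hN.isHermitian, h⟩⟩)
  have hl : (Ty.arr x (Ty.arr (Ty.sys E) (Ty.sys F))).lam * (Fintype.card F.Idx : ℝ) =
      1 / ((Fintype.card x.Idx : ℝ) * x.lam) := by
    change (Ty.arr (Ty.sys E) (Ty.sys F)).lam / ((Fintype.card x.Idx : ℝ) * x.lam) * _ = _
    rw [lam_sys_arr]
    field_simp
  refine (key _).trans ?_
  rw [isNodeOf_iff_trace, Matrix.posSemidef_submatrix_equiv, ← hl]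
  simp only [trace_midFront]
  push_cast
  rfl

theorem Delta_func (x : Ty) : x.func.Delta =
    (bar x.Delta).map (reix (Equiv.prodUnique x.Idx Word.triv.Idx).symm).toLinearMap := by
  have h : x.func.Delta = (tens (Hrm x.Idx) (Trl Word.triv.Idx) ⊔
      tens (bar x.Delta) (perp (Trl Word.triv.Idx)) :
        Submodule ℝ (Op (x.Idx × Word.triv.Idx))) := rfl
  rw [h, Trl_unique, tens_bot, bot_sup_eq, perp_bot, tens_unique_right]

/-- The supermap criterion applied to the functional type of `x`: both operations it involves, `bar`
on direction spaces and `λ ↦ 1/(d_x λ)` on weights, are involutive, so the data of `x` itself come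
back. -/
theorem isNode_iff {x : Ty} {E F : Word} {M : Op (E.Idx × x.Idx × F.Idx)} :
    IsNode x E F M ↔ IsNodeOf x.Delta x.lam M := by
  let M' : Op (E.Idx × x.func.Idx × F.Idx) :=
    M.submatrix (fun p => (p.1, p.2.1.1, p.2.2)) fun p => (p.1, p.2.1.1, p.2.2)
  have h1 : IsNode x E F M ↔
      IsNodeOf (bar x.func.Delta) (1 / ((Fintype.card x.func.Idx : ℝ) * x.func.lam)) M' :=
    mem_T1_supermap_iff (x := x.func) (M := M')
  have hl : 1 / ((Fintype.card x.func.Idx : ℝ) * x.func.lam) = x.lam := by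
    have h2 : (Fintype.card x.Idx : ℝ) ≠ 0 := Nat.cast_ne_zero.mpr Fintype.card_ne_zero
    have h3 := (Ty.lam_pos x).ne'
    rw [card_func, lam_func]
    field_simp
  have hU : bar x.func.Delta =
      x.Delta.map (reix (Equiv.prodUnique x.Idx Word.triv.Idx).symm).toLinearMap := by
    rw [Delta_func]
    refine (map_bar (Equiv.prodUnique x.Idx Word.triv.Idx).symm (bar x.Delta)).symm.trans ?_
    rw [bar_bar (Ty.Delta_le_Trl x)]
  rw [h1, hl, hU]
  exact isNodeOf_map_iff (Equiv.prodUnique x.Idx Word.triv.Idx).symm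

theorem card_bi (d : ℕ+) : (Fintype.card (bi d).Idx : ℝ) = d * d := by
  have : Fintype.card (bi d).Idx = Fintype.card ((Fin d × Unit) × (Fin d × Unit)) := rfl
  rw [this]
  simp

theorem lam_bi (d : ℕ+) : (bi d).lam = 1 / (d : ℝ) := by
  change 1 / ((d : ℝ) * (Fintype.card Unit : ℝ)) = 1 / (d : ℝ)
  simp

theorem lam_func_bi (d : ℕ+) : 1 / ((Fintype.card (bi d).Idx : ℝ) * (bi d).lam) = 1 / (d : ℝ) := by
  have h : (d : ℝ) ≠ 0 := Nat.cast_ne_zero.mpr d.ne_zero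
  rw [card_bi, lam_bi]
  field_simp

theorem isBiSupermap_iff {d : ℕ+} {E F : Word} {M : Op (E.Idx × (bi d).Idx × F.Idx)} :
    IsBiSupermap d E F M ↔ IsNodeOf (bar (bi d).Delta) (1 / (d : ℝ)) M := by
  rw [← lam_func_bi]
  exact mem_T1_supermap_iff (x := bi d)

/-! ### Nodes on bistochastic channels as partially bistochastic channels -/

section BiChannel

variable {α μ ν : Type} [Fintype α] [DecidableEq α] [Fintype μ] [DecidableEq μ] [Fintype ν]
  [DecidableEq ν]

theorem isAff_bistSpace_iff_trace_kron {l : ℝ} {M : Op ((α × μ) × (α × ν))} :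
    IsAff (bistSpace α μ ν) l M ↔ M.IsHermitian ∧
      (∀ B ∈ Hrm μ, ∀ A ∈ Hrm α, (M * ((A ⊗ₖ B) ⊗ₖ ((1 : Op α) ⊗ₖ (1 : Op ν)))).trace =
        l * ((A.trace * B.trace) * (Fintype.card α * Fintype.card ν))) ∧
      (∀ B ∈ Hrm μ, ∀ C ∈ Hrm α, (M * (((1 : Op α) ⊗ₖ B) ⊗ₖ (C ⊗ₖ (1 : Op ν)))).trace =
        l * ((Fintype.card α * B.trace) * (C.trace * Fintype.card ν))) := by
  rw [isAff_bistSpace_iff_trace, Matrix.one_kronecker_one]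
  refine and_congr_right fun _ => and_congr_left fun _ => ⟨fun h B hB A hA => ?_, fun h H hH => ?_⟩
  · rw [h _ (isHermitian_kron hA hB), Matrix.trace_kronecker]
  · rw [← sub_eq_zero]
    let f : Op (α × μ) →ₗ[ℝ] ℂ :=
      { toFun := fun Z => (M * (Z ⊗ₖ (1 : Op (α × ν)))).trace -
          l * (Z.trace * (Fintype.card α * Fintype.card ν))
        map_add' := fun A B => by
          rw [Matrix.add_kronecker, Matrix.mul_add, Matrix.trace_add, Matrix.trace_add]
          ring
        map_smul' := fun c A => by
          rw [Matrix.smul_kronecker, Matrix.mul_smul, Matrix.trace_smul, Matrix.trace_smul,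
            Complex.real_smul, Complex.real_smul, RingHom.id_apply, Complex.real_smul]
          ring }
    rw [← tens_Hrm_Hrm] at hH
    refine apply_eq_zero_of_mem_tens f (fun A hA B hB => ?_) hH
    change (M * ((A ⊗ₖ B) ⊗ₖ (1 : Op (α × ν)))).trace -
          l * ((A ⊗ₖ B).trace * (Fintype.card α * Fintype.card ν)) = 0
    rw [h B hB A hA, Matrix.trace_kronecker, sub_self]

/-- `μ ⊗ (α ⊗ α) ⊗ ν`, with trivial factors, as `(α ⊗ μ) ⊗ (α ⊗ ν)`. -/
def channelEquiv (α μ ν : Type) : (α × μ) × (α × ν) ≃ μ × ((α × Unit) × (α × Unit)) × ν where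
  toFun p := (p.1.2, ((p.1.1, ()), (p.2.1, ())), p.2.2)
  invFun p := ((p.2.1.1.1, p.1), (p.2.1.2.1, p.2.2))
  left_inv _ := rfl
  right_inv _ := rfl

/-- Contraction of the outer factors with `H` and the identity. -/
def outerSlice {ε κ φ : Type} [Fintype ε] [Fintype φ] [DecidableEq φ] (M : Op (ε × κ × φ))
    (H : Op ε) : Op κ :=
  rslice (M.submatrix (midFront ε κ φ) (midFront ε κ φ)) (H ⊗ₖ (1 : Op φ))

theorem trace_outerSlice_mul {ε κ φ : Type} [Fintype ε] [DecidableEq ε] [Fintype κ]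
    [DecidableEq κ] [Fintype φ] [DecidableEq φ] (M : Op (ε × κ × φ)) (H : Op ε) (Y : Op κ) :
    (outerSlice M H * Y).trace = (M * (H ⊗ₖ (Y ⊗ₖ (1 : Op φ)))).trace := by
  rw [outerSlice, ← trace_mul_kron, trace_midFront]

theorem trace_outerSlice_mul_channel (M : Op (μ × ((α × Unit) × (α × Unit)) × ν)) (A C : Op α)
    (H : Op μ) :
    (outerSlice M H * ((A ⊗ₖ (1 : Op Unit)) ⊗ₖ (C ⊗ₖ (1 : Op Unit)))).trace =
      (M.submatrix (channelEquiv α μ ν) (channelEquiv α μ ν) *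
        ((A ⊗ₖ H) ⊗ₖ (C ⊗ₖ (1 : Op ν)))).trace := by
  rw [trace_outerSlice_mul, ← trace_submatrix_mul_submatrix (channelEquiv α μ ν) M]
  congr 2
  ext ⟨⟨a, m⟩, b, n⟩ ⟨⟨a', m'⟩, b', n'⟩
  simp only [channelEquiv, Matrix.kroneckerMap_apply, Matrix.submatrix_apply, Equiv.coe_fn_mk,
    Matrix.one_apply_eq]
  ring

theorem forall_Hrm_unit_iff {p : Op Unit → Prop} :
    (∀ B ∈ Hrm Unit, p B) ↔ ∀ c : ℝ, p (c • 1) := by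
  rw [Hrm_unique]
  refine ⟨fun h c => h _ (mem_IdSp.mpr ⟨c, rfl⟩), fun h B hB => ?_⟩
  obtain ⟨c, rfl⟩ := mem_IdSp.mp hB
  exact h c

/-- The complement of the bistochastic space is generated by `A ⊗ 1` and `1 ⊗ C`. Adjoining a test
operator `H` on the memory input and the identity on the memory output gives exactly the tests for a
partially bistochastic channel. -/
theorem isNodeOf_bistSpace_iff [Nonempty α] [Nonempty ν]
    {M : Op (μ × ((α × Unit) × (α × Unit)) × ν)} :
    IsNodeOf (bistSpace α Unit Unit) (1 / (Fintype.card α : ℝ)) M ↔ M.PosSemidef ∧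
      IsAff (bistSpace α μ ν) (1 / ((Fintype.card α : ℝ) * (Fintype.card ν : ℝ)))
        (M.submatrix (channelEquiv α μ ν) (channelEquiv α μ ν)) := by
  have h1 : (Fintype.card α : ℂ) ≠ 0 := Nat.cast_ne_zero.mpr Fintype.card_ne_zero
  have h2 : (Fintype.card ν : ℂ) ≠ 0 := Nat.cast_ne_zero.mpr Fintype.card_ne_zero
  rw [isNodeOf_iff_trace]
  refine and_congr_right fun hM => ?_
  rw [isAff_bistSpace_iff_trace_kron, and_iff_right (hM.isHermitian.submatrix _), ← forall₂_and]
  refine forall₂_congr fun H hH => ?_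
  have ht : ((H.trace.re : ℝ) : ℂ) = H.trace := by
    have := trace_mul_ofReal hH (one_mem_Hrm (ι := μ))
    rwa [mul_one] at this
  have hS : (outerSlice M H).IsHermitian :=
    isHermitian_rslice (hM.isHermitian.submatrix _) (isHermitian_kron hH one_mem_Hrm)
  -- For fixed `H`, the node condition says that the outer slice of `M` by `H` is itself affine of
  -- bistochastic type, with weight scaled by `Tr H`.
  have e : (∀ Y ∈ perp (bistSpace α Unit Unit), (M * (H ⊗ₖ (Y ⊗ₖ (1 : Op ν)))).trace =
      ((1 / (Fintype.card α : ℝ) : ℝ) : ℂ) * H.trace * Y.trace) ↔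
      IsAff (bistSpace α Unit Unit) (1 / (Fintype.card α : ℝ) * H.trace.re) (outerSlice M H) := by
    rw [IsAff, and_iff_right hS]
    simp only [trace_outerSlice_mul, Complex.ofReal_mul, ht]
  rw [e, isAff_bistSpace_iff_trace_kron, and_iff_right hS, forall_Hrm_unit_iff,
    forall_Hrm_unit_iff]
  simp only [Matrix.kronecker_smul, Matrix.smul_kronecker, Matrix.mul_smul, Matrix.trace_smul,
    trace_outerSlice_mul_channel, Complex.real_smul, Complex.ofReal_mul, ht, Matrix.trace_one,
    Fintype.card_unit, Nat.cast_one, mul_one]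
  push_cast
  refine and_congr ⟨fun h A hA => ?_, fun h c A hA => ?_⟩ ⟨fun h A hA => ?_, fun h c A hA => ?_⟩
  · have := h 1 A hA
    rw [Complex.ofReal_one, one_mul] at this
    rw [this]
    field_simp
  · rw [h A hA]
    field_simp
  · have := h 1 A hA
    rw [Complex.ofReal_one, one_mul] at this
    rw [this]
    field_simp
  · rw [h A hA]
    field_simp

end BiChannel

theorem isBiChannel_iff {d : ℕ+} {E F : Word} {M : Op (E.Idx × (bi d).Idx × F.Idx)} :
    IsBiChannel d E F M ↔ IsNodeOf (bi d).Delta (1 / (d : ℝ)) M := by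
  have h := isNodeOf_bistSpace_iff (α := Fin d) (μ := E.Idx) (ν := F.Idx) (M := M)
  rw [Fintype.card_fin] at h
  refine Iff.trans ?_ h.symm
  refine (Ty.mem_T1_iff (x := Ty.bist d E F)).trans (and_congr ?_ Iff.rfl)
  exact Matrix.posSemidef_submatrix_equiv (channelEquiv (Fin d) E.Idx F.Idx)

/-! ### Link products -/

section Link

variable {K E κ φ β σ : Type} [Fintype K] [DecidableEq K] [Fintype E] [DecidableEq E] [Fintype κ]
  [DecidableEq κ] [Fintype φ] [DecidableEq φ] [Fintype β] [DecidableEq β] [Fintype σ]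
  [DecidableEq σ]

theorem link_apply (N : Op (K × σ)) (M : Op (σ × β)) (p q : K × β) :
    link N M p q = ∑ s, ∑ s', N (p.1, s) (q.1, s') * M (s, p.2) (s', q.2) := by
  simp only [link, ptrR, ptransL, Matrix.of_apply, Matrix.mul_apply, Fintype.sum_prod_type,
    Matrix.kroneckerMap_apply, Matrix.submatrix_apply, Matrix.one_apply, mul_ite, mul_one, mul_zero,
    ite_mul, zero_mul, one_mul]
  rw [Finset.sum_comm (s := Finset.univ (α := σ)) (t := Finset.univ (α := σ))]
  refine Finset.sum_congr rfl fun s' _ => ?_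
  rw [Finset.sum_eq_single p.1, Finset.sum_eq_single q.2]
  · simp [mul_comm]
  · intro b _ hb
    simp [hb]
  · simp
  · intro a _ ha
    simp [ha.symm]
  · simp

theorem kron_one_mul_apply (A : Op K) (M : Op (K × β)) (k : K) (b : β) (q : K × β) :
    ((A ⊗ₖ (1 : Op β)) * M) (k, b) q = ∑ e, A k e * M (e, b) q := by
  rw [Matrix.mul_apply, Fintype.sum_prod_type]
  simp [Matrix.one_apply]

theorem mul_kron_one_apply (A : Op K) (M : Op (K × β)) (k : K) (b : β) (p : K × β) :
    (M * (A ⊗ₖ (1 : Op β))) p (k, b) = ∑ e, M p (e, b) * A e k := by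
  rw [Matrix.mul_apply, Fintype.sum_prod_type]
  simp [Matrix.one_apply]

theorem posSemidef_link {N : Op (K × σ)} {M : Op (σ × β)} (hN : N.PosSemidef)
    (hM : M.PosSemidef) : (link N M).PosSemidef := by
  have h := posSemidef_contract (ι := K × β) (σ := σ)
    ((hN.kronecker hM).submatrix fun p => ((p.1.1, p.2), (p.2, p.1.2)))
  convert h using 1
  ext p q
  rw [link_apply]
  rfl

theorem rslice_link (N : Op (K × σ)) (M : Op (σ × β)) (Z : Op β) (k k' : K) :
    rslice (link N M) Z k k' = ∑ s, ∑ s', N (k, s) (k', s') * rslice M Z s s' := by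
  simp only [rslice_apply, link_apply, Finset.sum_mul, Finset.mul_sum]
  calc _ = ∑ b, ∑ s, ∑ b', ∑ s', N (k, s) (k', s') * M (s, b) (s', b') * Z b' b :=
        Finset.sum_congr rfl fun b _ => Finset.sum_comm
    _ = ∑ s, ∑ b, ∑ s', ∑ b', N (k, s) (k', s') * M (s, b) (s', b') * Z b' b := by
        rw [Finset.sum_comm]
        exact Finset.sum_congr rfl fun s _ => Finset.sum_congr rfl fun b _ => Finset.sum_comm
    _ = _ := by
        refine Finset.sum_congr rfl fun s _ => ?_
        rw [Finset.sum_comm]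
        simp only [mul_assoc]

/-- The contracted node is a multiple of the identity on the memory, and linking with the identity
is a partial trace. -/
theorem rslice_link_of_isNodeOf {U : Submodule ℝ (Op κ)} {l : ℝ} {N : Op (K × E)}
    {M : Op (E × κ × φ)} (hM : IsNodeOf U l M) {Y : Op κ} (hY : Y ∈ perp U) :
    rslice (link N M) (Y ⊗ₖ (1 : Op φ)) = (l * Y.trace) • ptrR N := by
  ext k k'
  rw [rslice_link, hM.2 Y hY]
  simp [ptrR, Matrix.one_apply, Finset.mul_sum, mul_comm]

theorem rslice_conj (A : Op K) (R : Op (K × β)) (B : Op K) (Z : Op β) :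
    rslice ((A ⊗ₖ (1 : Op β)) * R * (B ⊗ₖ (1 : Op β))) Z = A * rslice R Z * B := by
  refine eq_of_trace_mul_hermitian fun H _ => ?_
  have e : (B ⊗ₖ (1 : Op β)) * (H ⊗ₖ Z) * (A ⊗ₖ (1 : Op β)) = (B * H * A) ⊗ₖ Z := by
    rw [← Matrix.mul_kronecker_mul, ← Matrix.mul_kronecker_mul, one_mul, mul_one]
  rw [← trace_mul_kron, Matrix.mul_assoc, Matrix.mul_assoc, Matrix.trace_mul_comm,
    Matrix.mul_assoc, e, trace_mul_kron, ← Matrix.mul_assoc, Matrix.trace_mul_comm]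
  simp only [Matrix.mul_assoc]

theorem rslice_kron (A : Op K) (B Z : Op β) : rslice (A ⊗ₖ B) Z = (B * Z).trace • A := by
  refine eq_of_trace_mul_hermitian fun H _ => ?_
  rw [← trace_mul_kron, trace_kron_mul_kron, Matrix.smul_mul, Matrix.trace_smul, smul_eq_mul,
    mul_comm]

theorem rslice_add (Z Z' : Op (K × β)) (Y : Op β) :
    rslice (Z + Z') Y = rslice Z Y + rslice Z' Y := by
  ext k k'
  simp only [rslice_apply, Matrix.add_apply, add_mul, Finset.sum_add_distrib]

/-- A square root and a pseudo-inverse of it. -/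
theorem exists_sqrt_pinv {S : Op K} (hS : S.PosSemidef) :
    ∃ A B : Op K, A.IsHermitian ∧ B.IsHermitian ∧ A * A = S ∧ A * B = B * A ∧ A * B * A = A := by
  set V : Op K := (hS.isHermitian.eigenvectorUnitary : Op K) with hV
  have hVV : star V * V = 1 := Unitary.coe_star_mul_self hS.isHermitian.eigenvectorUnitary
  let f : (K → ℝ) → Op K := fun g => V * Matrix.diagonal (fun k => (g k : ℂ)) * star V
  have hmul : ∀ g h, f g * f h = f (g * h) := by
    intro g h
    calc f g * f h = V * (Matrix.diagonal (fun k => (g k : ℂ)) * (star V * V) *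
          Matrix.diagonal (fun k => (h k : ℂ))) * star V := by
          simp only [f, Matrix.mul_assoc]
      _ = f (g * h) := by
          rw [hVV, mul_one, Matrix.diagonal_mul_diagonal]
          simp [f]
  have hherm : ∀ g, (f g).IsHermitian := by
    intro g
    simp only [f, Matrix.star_eq_conjTranspose]
    refine Matrix.isHermitian_mul_mul_conjTranspose V ?_
    rw [Matrix.isHermitian_diagonal_iff]
    intro k
    exact Complex.conj_ofReal _
  have hSf : S = f hS.isHermitian.eigenvalues := by
    conv_lhs => rw [hS.isHermitian.spectral_theorem]
    rfl
  have hnn := hS.eigenvalues_nonneg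
  refine ⟨f fun k => √(hS.isHermitian.eigenvalues k),
    f fun k => (√(hS.isHermitian.eigenvalues k))⁻¹,
    hherm _, hherm _, ?_, ?_, ?_⟩
  · rw [hmul]
    conv_rhs => rw [hSf]
    congr 1
    ext k
    exact Real.mul_self_sqrt (hnn k)
  · rw [hmul, hmul, mul_comm]
  · rw [hmul, hmul]
    congr 1
    ext k
    -- This also covers zero eigenvalues, because `0⁻¹ = 0`: hence a pseudo-inverse.
    exact mul_inv_mul_cancel _

/-- The memory is a copy of `K`. With `A = √T`, pseudo-inverse `B` and support projection `Q = A B`,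
the state `S` is the vectorisation of `A`, and linking with it is conjugation by `A`. The node is `B
R B` on the support of `T`; off the support it is a multiple of the identity, added only to
normalise. -/
theorem exists_link_self [Nonempty κ] [Nonempty φ] {U : Submodule ℝ (Op κ)} (hU : U ≤ Trl κ)
    {l : ℝ} (hl : 0 < l) {R : Op (K × κ × φ)} (hR : R.PosSemidef) {T : Op K}
    (hT : ∀ Y ∈ perp U, rslice R (Y ⊗ₖ (1 : Op φ)) = (l * Y.trace) • T) :
    ∃ (S : Op (K × K)) (M : Op (K × κ × φ)),
      S.PosSemidef ∧ ptrR S = T ∧ IsNodeOf U l M ∧ link S M = R := by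
  have hκ : (0 : ℝ) < Fintype.card κ := Nat.cast_pos.mpr Fintype.card_pos
  have hφ : (0 : ℝ) < Fintype.card φ := Nat.cast_pos.mpr Fintype.card_pos
  have hφ' : (Fintype.card φ : ℂ) ≠ 0 := Nat.cast_ne_zero.mpr Fintype.card_ne_zero
  -- The hypothesis at `Y = 1`, allowed because `U` is traceless; it determines `T` as a scaled
  -- marginal of `R`, whence `T ≥ 0`.
  have hRT : ptrR R = (l * Fintype.card κ : ℝ) • T := by
    rw [← rslice_one, ← Matrix.one_kronecker_one (m := κ) (n := φ), hT 1 (one_mem_perp hU),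
      Matrix.trace_one]
    ext i j
    simp
  have hTpos : T.PosSemidef := by
    have h := (posSemidef_ptrR hR).smul (inv_pos.mpr (mul_pos hl hκ)).le
    rwa [hRT, smul_smul, inv_mul_cancel₀ (mul_pos hl hκ).ne', one_smul] at h
  obtain ⟨A, B, hA, hB, hAA, hAB, hABA⟩ := exists_sqrt_pinv hTpos
  set Q := A * B with hQ
  have hQh : Q.IsHermitian := by
    rw [Matrix.IsHermitian, hQ, Matrix.conjTranspose_mul, hA.eq, hB.eq]
    exact hAB.symm
  have hQQ : Q * Q = Q := by
    conv_lhs => rw [hQ, ← Matrix.mul_assoc, ← hQ, hABA]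
  have hN : (1 - Q).IsHermitian := Matrix.isHermitian_one.sub hQh
  have hNN : (1 - Q) * (1 - Q) = 1 - Q := by
    rw [Matrix.mul_sub, mul_one, Matrix.sub_mul, one_mul, hQQ, sub_self, sub_zero]
  have hNpos : (1 - Q).PosSemidef := by
    have := Matrix.posSemidef_conjTranspose_mul_self (1 - Q)
    rwa [hN.eq, hNN] at this
  have hAN : A * (1 - Q) = 0 := by
    rw [Matrix.mul_sub, mul_one, hAB, ← Matrix.mul_assoc, ← hQ, hABA, sub_self]
  -- The support of `R` lies over that of its marginal: for `R = C* C`, the squared norm of `C (1 -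
  -- Q)` is a multiple of `Tr (T (1 - Q)) = 0`.
  have hRN : R * ((1 - Q) ⊗ₖ (1 : Op (κ × φ))) = 0 := by
    obtain ⟨C, -, hCh, -, hCC, -⟩ := exists_sqrt_pinv hR
    have hC : R = C.conjTranspose * C := by rw [hCh.eq, hCC]
    have h0 : C * ((1 - Q) ⊗ₖ (1 : Op (κ × φ))) = 0 := by
      rw [← Matrix.trace_conjTranspose_mul_self_eq_zero_iff, Matrix.conjTranspose_mul,
        (isHermitian_kron hN Matrix.isHermitian_one).eq, Matrix.mul_assoc,
        ← Matrix.mul_assoc C.conjTranspose, ← hC, Matrix.trace_mul_comm, Matrix.mul_assoc,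
        ← Matrix.mul_kronecker_mul, hNN, mul_one, trace_mul_kron, rslice_one, hRT,
        Matrix.smul_mul, ← hAA, Matrix.mul_assoc, hAN, mul_zero, smul_zero, Matrix.trace_zero]
    rw [hC, Matrix.mul_assoc, h0, mul_zero]
  have hRQ : R * (Q ⊗ₖ (1 : Op (κ × φ))) = R := by
    have e : (Q ⊗ₖ (1 : Op (κ × φ))) = 1 - (1 - Q) ⊗ₖ (1 : Op (κ × φ)) := by
      rw [eq_sub_iff_add_eq, ← Matrix.add_kronecker, add_sub_cancel, Matrix.one_kronecker_one]
    rw [e, Matrix.mul_sub, hRN, mul_one, sub_zero]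
  have hQR : (Q ⊗ₖ (1 : Op (κ × φ))) * R = R := by
    have := congrArg Matrix.conjTranspose hRQ
    rwa [Matrix.conjTranspose_mul, hR.isHermitian.eq,
      (isHermitian_kron hQh Matrix.isHermitian_one).eq] at this
  let s : Matrix (K × K) Unit ℂ := Matrix.of fun p _ => A p.1 p.2
  -- The factor `l / d_φ` makes the correction term slice to `l Tr(Y) (1 - Q)`, complementing the `l
  -- Tr(Y) Q` obtained from the first term.
  let M : Op (K × κ × φ) := (B ⊗ₖ (1 : Op (κ × φ))) * R * (B ⊗ₖ (1 : Op (κ × φ))) +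
    (1 - Q) ⊗ₖ ((l / Fintype.card φ : ℝ) • (1 : Op (κ × φ)))
  have hs : ∀ p q, (s * s.conjTranspose) p q = A p.1 p.2 * A q.2 q.1 := by
    intro p q
    simp only [s, Matrix.mul_apply, Matrix.conjTranspose_apply, Matrix.of_apply]
    rw [Fintype.sum_unique, hA.apply]
  refine ⟨s * s.conjTranspose, M, Matrix.posSemidef_self_mul_conjTranspose s, ?_, ⟨?_, ?_⟩, ?_⟩
  · ext k k'
    simp only [ptrR, Matrix.of_apply, hs, ← hAA, Matrix.mul_apply]
  · have h1 := hR.mul_mul_conjTranspose_same (B ⊗ₖ (1 : Op (κ × φ)))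
    rw [(isHermitian_kron hB Matrix.isHermitian_one).eq] at h1
    exact h1.add (hNpos.kronecker (Matrix.PosSemidef.one.smul (div_pos hl hφ).le))
  · intro Y hY
    have e1 : B * T * B = Q := by
      rw [← hAA, ← Matrix.mul_assoc, ← hAB, Matrix.mul_assoc, ← hQ, hQQ]
    rw [rslice_add, rslice_conj, hT Y hY, rslice_kron, Matrix.mul_smul, Matrix.smul_mul, e1,
      Matrix.smul_mul, Matrix.trace_smul, one_mul, Matrix.trace_kronecker, Matrix.trace_one,
      Complex.real_smul]
    have e2 : ((l / Fintype.card φ : ℝ) : ℂ) * (Y.trace * Fintype.card φ) = l * Y.trace := by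
      push_cast
      field_simp
    rw [e2, ← smul_add, add_sub_cancel]
  · have e : link (s * s.conjTranspose) M =
        (A ⊗ₖ (1 : Op (κ × φ))) * M * (A ⊗ₖ (1 : Op (κ × φ))) := by
      ext ⟨k, b⟩ ⟨k', b'⟩
      rw [link_apply, mul_kron_one_apply, Finset.sum_comm]
      refine Finset.sum_congr rfl fun j _ => ?_
      rw [kron_one_mul_apply, Finset.sum_mul]
      refine Finset.sum_congr rfl fun i _ => ?_
      rw [hs]
      ring
    have e1 : (A ⊗ₖ (1 : Op (κ × φ))) * ((1 - Q) ⊗ₖ ((l / Fintype.card φ : ℝ) •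
        (1 : Op (κ × φ)))) = 0 := by
      rw [← Matrix.mul_kronecker_mul, hAN, Matrix.zero_kronecker]
    have e2 : (A ⊗ₖ (1 : Op (κ × φ))) * (B ⊗ₖ (1 : Op (κ × φ))) = Q ⊗ₖ 1 := by
      rw [← Matrix.mul_kronecker_mul, mul_one]
    have e3 : (B ⊗ₖ (1 : Op (κ × φ))) * (A ⊗ₖ (1 : Op (κ × φ))) = Q ⊗ₖ 1 := by
      rw [← Matrix.mul_kronecker_mul, mul_one, ← hAB]
    rw [e, Matrix.mul_add, e1, add_zero, Matrix.mul_assoc, Matrix.mul_assoc, e3, Matrix.mul_assoc,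
      hRQ, ← Matrix.mul_assoc, e2, hQR]

end Link

/-- A one-letter word of prescribed dimension. -/
theorem exists_word_equiv (K : Type) [Fintype K] [Nonempty K] : ∃ E : Word, Nonempty (E.Idx ≃ K) :=
  ⟨Word.snoc .nil ⟨Fintype.card K, Fintype.card_pos⟩,
    ⟨(Equiv.uniqueProd (Fin (Fintype.card K)) Unit).trans (Fintype.equivFin K).symm⟩⟩

theorem exists_link {K κ φ : Type} [Fintype K] [DecidableEq K] [Nonempty K] [Fintype κ]
    [DecidableEq κ] [Fintype φ] [DecidableEq φ] [Nonempty κ] [Nonempty φ]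
    {U : Submodule ℝ (Op κ)} (hU : U ≤ Trl κ)
    {l : ℝ} (hl : 0 < l) {R : Op (K × κ × φ)} (hR : R.PosSemidef) {T : Op K}
    (hT : ∀ Y ∈ perp U, rslice R (Y ⊗ₖ (1 : Op φ)) = (l * Y.trace) • T) :
    ∃ (E : Word) (S : Op (K × E.Idx)) (M : Op (E.Idx × κ × φ)),
      S.PosSemidef ∧ ptrR S = T ∧ IsNodeOf U l M ∧ link S M = R := by
  obtain ⟨S, M, hS, hST, hM, hlink⟩ := exists_link_self hU hl hR hT
  obtain ⟨E, ⟨e⟩⟩ := exists_word_equiv K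
  refine ⟨E, S.submatrix (fun p => (p.1, e p.2)) (fun p => (p.1, e p.2)),
    M.submatrix (fun p => (e p.1, p.2)) (fun p => (e p.1, p.2)), hS.submatrix _, ?_,
    ⟨hM.1.submatrix _, fun Y hY => ?_⟩, ?_⟩
  · rw [← hST]
    ext k k'
    exact Equiv.sum_comp e fun j => S (k, j) (k', j)
  · have h := congrArg (fun Z : Op K => Z.submatrix e e) (hM.2 Y hY)
    refine Eq.trans ?_ (h.trans ?_)
    · rfl
    · rw [Matrix.submatrix_smul, Pi.smul_apply, Pi.smul_apply, Matrix.submatrix_one_equiv]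
  · rw [← hlink]
    ext p q
    rw [link_apply, link_apply]
    rw [← Equiv.sum_comp e]
    refine Finset.sum_congr rfl fun s _ => ?_
    rw [← Equiv.sum_comp e]
    rfl

/-! ### Staircase spaces -/

section Stair

variable {m : ℕ}

/-- Separation of the last coordinate. -/
def piSnoc (κ : Fin (m + 1) → Type) :
    (∀ i, κ i) ≃ (∀ i : Fin m, κ i.castSucc) × κ (Fin.last m) where
  toFun a := (fun i => a i.castSucc, a (Fin.last m))
  invFun p := Fin.snoc (α := κ) p.1 p.2
  left_inv a := Fin.snoc_init_self a
  right_inv p := by simp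

variable {κ : Fin (m + 1) → Type}

theorem reix_piSnoc_piKron (A : ∀ i, Op (κ i)) :
    reix (piSnoc κ) (piKron A) = piKron (fun i : Fin m => A i.castSucc) ⊗ₖ A (Fin.last m) := by
  ext p q
  rw [reix_apply, Matrix.submatrix_apply, Matrix.kroneckerMap_apply]
  change ∏ i, A i (Fin.snoc (α := κ) p.1 p.2 i) (Fin.snoc (α := κ) q.1 q.2 i) =
    (∏ i : Fin m, A i.castSucc (p.1 i) (q.1 i)) * A (Fin.last m) p.2 q.2
  rw [Fin.prod_univ_castSucc]
  simp

theorem map_piTens_snoc (U : ∀ i, Submodule ℝ (Op (κ i))) :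
    (piTens U).map (reix (piSnoc κ)).toLinearMap =
      tens (piTens fun i : Fin m => U i.castSucc) (U (Fin.last m)) := by
  apply le_antisymm
  · rw [Submodule.map_le_iff_le_comap, piTens, Submodule.span_le]
    rintro _ ⟨A, hA, rfl⟩
    change reix (piSnoc κ) (piKron A) ∈ tens (piTens fun i : Fin m => U i.castSucc) (U (Fin.last m))
    rw [reix_piSnoc_piKron]
    exact kron_mem_tens (Submodule.subset_span ⟨_, fun i => hA _, rfl⟩) (hA _)
  · rw [tens_le]
    intro Z hZ B hB
    have : (piTens fun i : Fin m => U i.castSucc) ≤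
        ((piTens U).map (reix (piSnoc κ)).toLinearMap).comap ((kronBilin _ _).flip B) := by
      rw [piTens, Submodule.span_le]
      rintro _ ⟨A, hA, rfl⟩
      refine ⟨piKron (Fin.snoc (α := fun i => Op (κ i)) A B), Submodule.subset_span
        ⟨_, fun i => ?_, rfl⟩, ?_⟩
      · refine Fin.lastCases ?_ (fun j => ?_) i
        · rwa [Fin.snoc_last]
        · rw [Fin.snoc_castSucc]
          exact hA j
      · refine (reix_piSnoc_piKron _).trans ?_
        simp only [Fin.snoc_castSucc, Fin.snoc_last]
        rfl
    exact this hZ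

theorem piTens_Hrm : ∀ {m : ℕ} {κ : Fin m → Type} [∀ i, Fintype (κ i)],
    (piTens fun i => Hrm (κ i)) = Hrm (∀ i, κ i)
  | 0, κ, _ => by
    classical
    rw [Hrm_unique, IdSp, piTens]
    congr 1
    have h1 : ∀ A : (∀ i : Fin 0, Op (κ i)), piKron A = 1 := by
      intro A
      ext p q
      rw [Subsingleton.elim p q]
      simp [piKron]
    ext Z
    constructor
    · rintro ⟨A, _, rfl⟩
      exact h1 A
    · rintro rfl
      exact ⟨fun i => 0, fun i => i.elim0, (h1 _).symm⟩
  | m + 1, κ, _ => by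
    have h := map_piTens_snoc (κ := κ) fun i => Hrm (κ i)
    rw [piTens_Hrm (κ := fun i : Fin m => κ i.castSucc), tens_Hrm_Hrm, ← map_Hrm (piSnoc κ)] at h
    exact Submodule.map_injective_of_injective (reix (piSnoc κ)).injective h

variable [∀ i, DecidableEq (κ i)]

theorem map_stair_castSucc (U : ∀ i, Submodule ℝ (Op (κ i))) (i : Fin m) :
    (stair U i.castSucc).map (reix (piSnoc κ)).toLinearMap =
      tens (stair (fun j : Fin m => U j.castSucc) i) (IdSp (κ (Fin.last m))) := by
  rw [stair, map_piTens_snoc, stair]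
  have h1 : ¬ Fin.last m < i.castSucc := not_lt.mpr (Fin.le_last _)
  have h2 : ¬ Fin.last m = i.castSucc := (Fin.castSucc_lt_last i).ne'
  rw [if_neg h1, if_neg h2]
  simp only [Fin.castSucc_lt_castSucc_iff, Fin.castSucc_inj]

theorem map_stair_last [∀ i, Fintype (κ i)] (U : ∀ i, Submodule ℝ (Op (κ i))) :
    (stair U (Fin.last m)).map (reix (piSnoc κ)).toLinearMap =
      tens (Hrm (∀ i : Fin m, κ i.castSucc)) (U (Fin.last m)) := by
  rw [stair, map_piTens_snoc, ← piTens_Hrm, if_neg (lt_irrefl _), if_pos rfl]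
  simp only [Fin.castSucc_lt_last, if_true]

theorem iSup_fin_succ_last {L : Type*} [CompleteLattice L] (f : Fin (m + 1) → L) :
    ⨆ i, f i = (⨆ i : Fin m, f i.castSucc) ⊔ f (Fin.last m) := by
  apply le_antisymm
  · refine iSup_le fun i => Fin.lastCases le_sup_right (fun j => ?_) i
    exact le_sup_of_le_left (le_iSup (fun j : Fin m => f j.castSucc) j)
  · exact sup_le (iSup_le fun i => le_iSup f _) (le_iSup f _)

/-- All steps but the last carry an identity on the last factor, and the last step is free on
everything before it. -/
theorem map_iSup_stair [∀ i, Fintype (κ i)] (U : ∀ i, Submodule ℝ (Op (κ i))) :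
    (⨆ i, stair U i).map (reix (piSnoc κ)).toLinearMap =
      tens (⨆ i, stair (fun j : Fin m => U j.castSucc) i) (IdSp (κ (Fin.last m))) ⊔
        tens (Hrm (∀ i : Fin m, κ i.castSucc)) (U (Fin.last m)) := by
  rw [iSup_fin_succ_last, Submodule.map_sup, Submodule.map_iSup, map_stair_last, tens_iSup_left]
  simp only [map_stair_castSucc]

variable {ρ : Type}

/-- Separation of the last coordinate, in the presence of a further factor. -/
def prodPiSnoc (ρ : Type) (κ : Fin (m + 1) → Type) :
    ρ × (∀ i, κ i) ≃ (ρ × ∀ i : Fin m, κ i.castSucc) × κ (Fin.last m) :=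
  ((Equiv.refl ρ).prodCongr (piSnoc κ)).trans (Equiv.prodAssoc _ _ _).symm

theorem map_reix_trans {ι κ τ : Type} (e : ι ≃ κ) (f : κ ≃ τ) (U : Submodule ℝ (Op ι)) :
    U.map (reix (e.trans f)).toLinearMap =
      (U.map (reix e).toLinearMap).map (reix f).toLinearMap := by
  rw [← Submodule.map_comp]
  rfl

theorem map_tens_Hrm_stair [Fintype ρ] [∀ i, Fintype (κ i)] (U : ∀ i, Submodule ℝ (Op (κ i))) :
    (tens (Hrm ρ) (⨆ i, stair U i)).map (reix (prodPiSnoc ρ κ)).toLinearMap =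
      tens (tens (Hrm ρ) (⨆ i, stair (fun j : Fin m => U j.castSucc) i)) (IdSp (κ (Fin.last m))) ⊔
        tens (Hrm (ρ × ∀ i : Fin m, κ i.castSucc)) (U (Fin.last m)) := by
  rw [prodPiSnoc, map_reix_trans, map_tens, map_Hrm, map_iSup_stair, tens_sup_right,
    Submodule.map_sup, map_tens_assoc, map_tens_assoc, tens_Hrm_Hrm]

end Stair

/-! ### One step of the staircase recursion, read through slices -/

section Step

variable {K κ : Type} [Fintype K] [DecidableEq K] [Fintype κ] [DecidableEq κ]

theorem exists_of_mem_tens_IdSp {W : Submodule ℝ (Op K)} {X : Op (K × κ)}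
    (hX : X ∈ tens W (IdSp κ)) : ∃ w ∈ W, X = w ⊗ₖ (1 : Op κ) := by
  have : tens W (IdSp κ) ≤ W.map ((kronBilin K κ).flip 1) := tens_le.mpr fun A hA B hB => by
    obtain ⟨c, rfl⟩ := mem_IdSp.mp hB
    rw [Matrix.kronecker_smul]
    exact Submodule.smul_mem _ _ ⟨A, hA, rfl⟩
  obtain ⟨w, hw, e⟩ := this hX
  exact ⟨w, hw, e.symm⟩

/-- Slicing by `Y ⊥ U` kills `Hrm ⊗ U`, leaving only the component `w ⊗ 1`; conversely, subtracting
`l T ⊗ 1` leaves an operator invisible to all such `Y`. -/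
theorem sub_smul_one_mem_iff_rslice {W : Submodule ℝ (Op K)} (hW : W ≤ Hrm K)
    {U : Submodule ℝ (Op κ)} (hU : U ≤ Trl κ) {l : ℝ} (hl : l ≠ 0) (m : ℝ) {Z : Op (K × κ)}
    (hZ : Z.IsHermitian) :
    Z - (m * l) • 1 ∈ tens W (IdSp κ) ⊔ tens (Hrm K) U ↔
      ∃ T : Op K, T - m • 1 ∈ W ∧ ∀ Y ∈ perp U, rslice Z Y = (l * Y.trace) • T := by
  constructor
  · intro h
    obtain ⟨X₁, h₁, X₂, h₂, e⟩ := Submodule.mem_sup.mp h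
    obtain ⟨w, hw, rfl⟩ := exists_of_mem_tens_IdSp h₁
    -- A slice of `(m l 1 + w) ⊗ 1` is `Tr Y` times that operator, so a factor `l` is divided out.
    refine ⟨m • 1 + l⁻¹ • w, by rw [add_sub_cancel_left]; exact W.smul_mem _ hw, fun Y hY => ?_⟩
    have hz : Z = ((m * l) • 1 + w) ⊗ₖ (1 : Op κ) + X₂ := by
      rw [Matrix.add_kronecker, Matrix.smul_kronecker, Matrix.one_kronecker_one, add_assoc, e,
        add_sub_cancel]
    have h0 : rslice X₂ Y = 0 := by
      refine trace_mul_eq_zero_of_hermitian fun H hH => ?_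
      rw [← trace_mul_kron]
      exact (kron_mem_perp_tens_right hH hY).2 X₂ h₂
    rw [hz, rslice_add, h0, add_zero, rslice_kron, one_mul]
    ext i j
    have hl' : (l : ℂ) ≠ 0 := by exact_mod_cast hl
    simp only [Matrix.smul_apply, Matrix.add_apply, smul_eq_mul, Complex.real_smul]
    push_cast
    field_simp
  · rintro ⟨T, hT, h⟩
    have hTh : T.IsHermitian := by
      have := (Hrm K).add_mem (hW hT) ((Hrm K).smul_mem m one_mem_Hrm)
      rwa [sub_add_cancel] at this
    have e : Z - (m * l) • 1 = (l • (T - m • 1)) ⊗ₖ (1 : Op κ) + (Z - (l • T) ⊗ₖ (1 : Op κ)) := by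
      rw [smul_sub, smul_smul, mul_comm l m]
      have : (l • T - (m * l) • 1) ⊗ₖ (1 : Op κ) = (l • T) ⊗ₖ (1 : Op κ) - (m * l) • 1 := by
        rw [eq_sub_iff_add_eq, ← Matrix.one_kronecker_one, ← Matrix.smul_kronecker,
          ← Matrix.add_kronecker, sub_add_cancel]
      rw [this]
      abel
    rw [e]
    refine Submodule.add_mem_sup (kron_mem_tens (W.smul_mem _ hT) one_mem_IdSp)
      (mem_tens_Hrm_of_trace (hU.trans Trl_le_Hrm) ?_ fun H hH Y hY => ?_)
    · exact (Hrm _).sub_mem hZ (isHermitian_kron ((Hrm K).smul_mem l hTh) one_mem_Hrm)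
    · rw [Matrix.sub_mul, Matrix.trace_sub, trace_mul_kron, h Y hY, trace_kron_mul_kron, one_mul,
        Matrix.smul_mul, Matrix.smul_mul, Matrix.trace_smul, Matrix.trace_smul, smul_eq_mul,
        Complex.real_smul]
      ring

end Step

/-! ### Networks -/

section Network

variable {m : ℕ} {ρ : Type} [Fintype ρ] [DecidableEq ρ]

/-- The linear constraint on the marginal of a network on `ρ ⊗ ⨂ᵢ κᵢ`. -/
def IsNetAff {m : ℕ} {κ : Fin m → Type} [∀ i, DecidableEq (κ i)]
    (U : ∀ i, Submodule ℝ (Op (κ i))) (l : Fin m → ℝ) (R : Op (ρ × ∀ i, κ i)) : Prop :=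
  R - (∏ i, l i) • 1 ∈ tens (Hrm ρ) (⨆ i, stair U i)

/-- The start of the recursion: with no nodes, the marginal on the input system must be the
identity, as for a channel. -/
theorem isNetAff_zero {κ : Fin 0 → Type} [∀ i, DecidableEq (κ i)]
    (U : ∀ i, Submodule ℝ (Op (κ i))) (l : Fin 0 → ℝ) (R : Op (ρ × ∀ i, κ i)) :
    IsNetAff U l R ↔ R = 1 := by
  rw [IsNetAff, iSup_of_empty, tens_bot, Submodule.mem_bot, Finset.univ_eq_empty,
    Finset.prod_empty, one_smul, sub_eq_zero]

theorem stair_le_Hrm {κ : Fin m → Type} [∀ i, DecidableEq (κ i)] [∀ i, Fintype (κ i)]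
    {U : ∀ i, Submodule ℝ (Op (κ i))} (hU : ∀ i, U i ≤ Trl (κ i)) (i : Fin m) :
    stair U i ≤ Hrm (∀ i, κ i) := by
  rw [← piTens_Hrm, stair, piTens, piTens]
  refine Submodule.span_mono ?_
  rintro _ ⟨A, hA, rfl⟩
  refine ⟨A, fun j => ?_, rfl⟩
  have h := hA j
  split_ifs at h
  · exact h
  · exact Trl_le_Hrm (hU j h)
  · exact IdSp_le_Hrm h

theorem isNetAff_succ {κ : Fin (m + 1) → Type} [∀ i, DecidableEq (κ i)] [∀ i, Fintype (κ i)]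
    {U : ∀ i, Submodule ℝ (Op (κ i))} (hU : ∀ i, U i ≤ Trl (κ i)) {l : Fin (m + 1) → ℝ}
    (hl : l (Fin.last m) ≠ 0) {R : Op (ρ × ∀ i, κ i)} (hR : R.IsHermitian) :
    IsNetAff U l R ↔ ∃ T : Op (ρ × ∀ i : Fin m, κ i.castSucc),
      IsNetAff (fun i : Fin m => U i.castSucc) (fun i => l i.castSucc) T ∧
      ∀ Y ∈ perp (U (Fin.last m)), rslice (reix (prodPiSnoc ρ κ) R) Y =
        (l (Fin.last m) * Y.trace) • T := by
  have hW : tens (Hrm ρ) (⨆ i, stair (fun j : Fin m => U j.castSucc) i) ≤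
      Hrm (ρ × ∀ i : Fin m, κ i.castSucc) :=
    tens_le_Hrm le_rfl (iSup_le fun i => stair_le_Hrm (fun j => hU _) i)
  have h := sub_smul_one_mem_iff_rslice hW (hU (Fin.last m)) hl (∏ i : Fin m, l i.castSucc)
    (Z := reix (prodPiSnoc ρ κ) R) (hR.submatrix _)
  refine Iff.trans ?_ h
  rw [← map_tens_Hrm_stair, Submodule.mem_map_equiv, map_sub, LinearEquiv.symm_apply_apply,
    ← Fin.prod_univ_castSucc, IsNetAff, map_smul, reix_symm_apply, Matrix.submatrix_one_equiv]

/-- The final system is one more step of the recursion, with `U = Trl` and weight `1/d_F`. Only `Y ∈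
ℝ1` is then tested, so `T` is the marginal over `F`. -/
theorem mem_DeltaNet_iff {κ : Fin m → Type} [∀ i, DecidableEq (κ i)] [∀ i, Fintype (κ i)]
    {U : ∀ i, Submodule ℝ (Op (κ i))} (hU : ∀ i, U i ≤ Trl (κ i)) (l : Fin m → ℝ)
    {P F : Word} {R : Op (P.Idx × (∀ i, κ i) × F.Idx)} (hR : R.IsHermitian) :
    (∃ X ∈ DeltaNet U P F, R = ((Fintype.card F.Idx : ℝ)⁻¹ * ∏ i, l i) • 1 + X) ↔
      IsNetAff U l (ptrR (R.submatrix (Equiv.prodAssoc P.Idx (∀ i, κ i) F.Idx)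
        (Equiv.prodAssoc P.Idx (∀ i, κ i) F.Idx))) := by
  have hF : (Fintype.card F.Idx : ℝ) ≠ 0 := Nat.cast_ne_zero.mpr Fintype.card_ne_zero
  have hF' : (Fintype.card F.Idx : ℂ) ≠ 0 := Nat.cast_ne_zero.mpr Fintype.card_ne_zero
  have h0 : (∃ X ∈ DeltaNet U P F, R = ((Fintype.card F.Idx : ℝ)⁻¹ * ∏ i, l i) • 1 + X) ↔
      R - ((Fintype.card F.Idx : ℝ)⁻¹ * ∏ i, l i) • 1 ∈ DeltaNet U P F := by
    constructor
    · rintro ⟨X, hX, rfl⟩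
      rwa [add_sub_cancel_left]
    · exact fun h => ⟨_, h, (add_sub_cancel _ _).symm⟩
  have hmap : (DeltaNet U P F).map
      (reix (Equiv.prodAssoc P.Idx (∀ i, κ i) F.Idx).symm).toLinearMap =
      tens (tens (Hrm P.Idx) (⨆ i, stair U i)) (IdSp F.Idx) ⊔
        tens (Hrm (P.Idx × ∀ i, κ i)) (Trl F.Idx) := by
    rw [DeltaNet, ← tens_iSup_left, tens_sup_right, Submodule.map_sup, map_tens_assoc,
      map_tens_assoc, piTens_Hrm, tens_Hrm_Hrm, sup_comm]
  have hW : tens (Hrm P.Idx) (⨆ i, stair U i) ≤ Hrm (P.Idx × ∀ i, κ i) :=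
    tens_le_Hrm le_rfl (iSup_le fun i => stair_le_Hrm hU i)
  have h := sub_smul_one_mem_iff_rslice hW (le_refl (Trl F.Idx)) (inv_ne_zero hF) (∏ i, l i)
    (Z := R.submatrix (Equiv.prodAssoc P.Idx (∀ i, κ i) F.Idx)
        (Equiv.prodAssoc P.Idx (∀ i, κ i) F.Idx)) (hR.submatrix _)
  rw [h0]
  refine Iff.trans ?_ (h.trans ?_)
  · rw [← hmap, Submodule.mem_map_equiv, map_sub, map_smul, mul_comm]
    rw [reix_symm_apply, reix_symm_apply, Matrix.submatrix_one_equiv, Matrix.submatrix_submatrix,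
      Equiv.self_comp_symm, Matrix.submatrix_id_id]
  · rw [perp_Trl]
    constructor
    · rintro ⟨T, hT, hY⟩
      have := hY 1 one_mem_IdSp
      rw [rslice_one, Matrix.trace_one] at this
      push_cast at this
      rw [inv_mul_cancel₀ hF', one_smul] at this
      rw [this]
      exact hT
    · intro hT
      refine ⟨_, hT, fun Y hY => ?_⟩
      obtain ⟨c, rfl⟩ := mem_IdSp.mp hY
      rw [← rslice_one]
      ext i j
      simp only [rslice_apply, Matrix.smul_apply, Complex.real_smul, smul_eq_mul,
        Matrix.trace_smul, Matrix.trace_one]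
      push_cast
      rw [mul_left_comm, inv_mul_cancel₀ hF', mul_one, Finset.mul_sum]
      refine Finset.sum_congr rfl fun b _ => ?_
      rw [Finset.mul_sum]
      exact Finset.sum_congr rfl fun b' _ => by ring

end Network

/-! ### Realization of staircase operators by sequences of nodes -/

section Realization

/-- Grouping of `ρ ⊗ (⨂ᵢ κᵢ) ⊗ φ` with the last of the `κᵢ` next to `φ`. -/
def lastGroup {m : ℕ} (ρ φ : Type) (κ : Fin (m + 1) → Type) :
    (ρ × ∀ i : Fin m, κ i.castSucc) × (κ (Fin.last m) × φ) ≃ ρ × (∀ i, κ i) × φ where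
  toFun p := (p.1.1, Fin.snoc (α := κ) p.1.2 p.2.1, p.2.2)
  invFun p := ((p.1, fun i => p.2.1 i.castSucc), (p.2.1 (Fin.last m), p.2.2))
  left_inv p := by simp
  right_inv p := by
    refine Prod.ext rfl (Prod.ext ?_ rfl)
    exact Fin.snoc_init_self p.2.1

theorem rslice_marginal {m : ℕ} {ρ φ : Type} {κ : Fin (m + 1) → Type} [Fintype ρ] [Fintype φ]
    [DecidableEq φ] [∀ i, Fintype (κ i)] (R : Op (ρ × (∀ i, κ i) × φ)) (Y : Op (κ (Fin.last m))) :
    rslice (reix (prodPiSnoc ρ κ) (ptrR (R.submatrix (Equiv.prodAssoc ρ (∀ i, κ i) φ)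
        (Equiv.prodAssoc ρ (∀ i, κ i) φ)))) Y =
      rslice (R.submatrix (lastGroup ρ φ κ) (lastGroup ρ φ κ)) (Y ⊗ₖ (1 : Op φ)) := by
  ext p q
  simp only [rslice_apply, Fintype.sum_prod_type, Matrix.kroneckerMap_apply, Matrix.one_apply,
    mul_ite, mul_one, mul_zero]
  refine Finset.sum_congr rfl fun k _ => ?_
  rw [Finset.sum_comm]
  refine Finset.sum_congr rfl fun k' _ => ?_
  rw [reix_apply, Matrix.submatrix_apply, ptrR, Matrix.of_apply, Finset.sum_mul]
  refine Finset.sum_congr rfl fun f _ => ?_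
  rw [Finset.sum_ite_eq' Finset.univ f, if_pos (Finset.mem_univ f)]
  rfl

/-- Induction on the number of nodes, for arbitrary `U` and `l`, so that it serves channels,
supermaps and general types at once. The shorter network ends in the memory `E`, and the induction
hypothesis concerns only its marginal after `E` is traced out. -/
theorem seqComp_iff : ∀ {n : ℕ} {κ : Fin (n + 1) → Type} [∀ i, Fintype (κ i)]
    [∀ i, DecidableEq (κ i)] [∀ i, Nonempty (κ i)]
    {node : ∀ (i : Fin (n + 1)) (E E' : Word), Op (E.Idx × κ i × E'.Idx) → Prop}
    {U : ∀ i, Submodule ℝ (Op (κ i))} {l : Fin (n + 1) → ℝ}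
    (_ : ∀ i, U i ≤ Trl (κ i)) (_ : ∀ i, 0 < l i)
    (_ : ∀ i E E' M, node i E E' M ↔ IsNodeOf (U i) (l i) M)
    {P F : Word} {R : Op (P.Idx × (∀ i, κ i) × F.Idx)},
    SeqComp node P F R ↔ R.PosSemidef ∧
      IsNetAff U l (ptrR (R.submatrix (Equiv.prodAssoc P.Idx (∀ i, κ i) F.Idx)
        (Equiv.prodAssoc P.Idx (∀ i, κ i) F.Idx)))
  | 0, κ, _, _, _, node, U, l, hU, hl, hnode, P, F, R => by
    let e : P.Idx × κ 0 × F.Idx ≃ P.Idx × (∀ i, κ i) × F.Idx :=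
      { toFun := fun p => (p.1, fun i => Fin.cases (motive := κ) p.2.1 (fun j => j.elim0) i, p.2.2)
        invFun := fun p => (p.1, p.2.1 0, p.2.2)
        left_inv := fun _ => rfl
        right_inv := fun p => by
          refine Prod.ext rfl (Prod.ext (funext fun i => ?_) rfl)
          rw [Fin.eq_zero i]
          rfl }
    have h1 : SeqComp node P F R ↔ IsNodeOf (U 0) (l 0) (R.submatrix e e) := by
      constructor
      · rintro ⟨M, hM, rfl⟩
        exact (hnode 0 P F M).mp hM
      · intro h
        refine ⟨R.submatrix e e, (hnode 0 P F _).mpr h, ?_⟩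
        have : R = (R.submatrix e e).submatrix e.symm e.symm := by
          rw [Matrix.submatrix_submatrix, Equiv.self_comp_symm, Matrix.submatrix_id_id]
        exact this
    rw [h1, IsNodeOf, Matrix.posSemidef_submatrix_equiv]
    refine and_congr_right fun hR => ?_
    -- For one node the shorter network is empty and `T = 1`, which is the node condition itself.
    rw [isNetAff_succ hU (hl _).ne' (isHermitian_ptrR (hR.isHermitian.submatrix _))]
    simp only [isNetAff_zero, exists_eq_left, rslice_marginal]
    have h2 : ∀ Y : Op (κ 0), rslice (R.submatrix e e) (Y ⊗ₖ (1 : Op F.Idx)) =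
        (rslice (R.submatrix (lastGroup P.Idx F.Idx κ) (lastGroup P.Idx F.Idx κ))
          (Y ⊗ₖ (1 : Op F.Idx))).submatrix (Equiv.prodUnique P.Idx _).symm
          (Equiv.prodUnique P.Idx (∀ i : Fin 0, κ i.castSucc)).symm := by
      intro Y
      have h3 : ∀ (p : P.Idx) (b : κ 0 × F.Idx), e (p, b) =
          lastGroup P.Idx F.Idx κ ((Equiv.prodUnique P.Idx _).symm p, b) := by
        intro p b
        refine Prod.ext rfl (Prod.ext (funext fun i => ?_) rfl)
        rw [Fin.eq_zero i]
        rfl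
      ext p q
      simp only [rslice_apply, Matrix.submatrix_apply, h3]
      rfl
    refine forall₂_congr fun Y hY => ?_
    rw [h2]
    constructor
    · intro h
      refine (reix (Equiv.prodUnique P.Idx (∀ i : Fin 0, κ i.castSucc))).injective (h.trans ?_)
      rw [reix_apply, Matrix.submatrix_smul, Pi.smul_apply, Pi.smul_apply,
        Matrix.submatrix_one_equiv]
      rfl
    · intro h
      have h' : rslice (R.submatrix (lastGroup P.Idx F.Idx κ) (lastGroup P.Idx F.Idx κ))
          (Y ⊗ₖ (1 : Op F.Idx)) = ((l 0 : ℂ) * Y.trace) • 1 := h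
      rw [h', Matrix.submatrix_smul, Pi.smul_apply, Pi.smul_apply, Matrix.submatrix_one_equiv]
  | n + 1, κ, _, _, _, node, U, l, hU, hl, hnode, P, F, R => by
    let g := lastGroup P.Idx F.Idx κ
    have hS : SeqComp node P F R ↔ ∃ (E : Word)
        (S : Op ((P.Idx × ∀ i : Fin (n + 1), κ i.castSucc) × E.Idx))
        (M : Op (E.Idx × κ (Fin.last (n + 1)) × F.Idx)),
        (S.PosSemidef ∧ IsNetAff (fun i : Fin (n + 1) => U i.castSucc) (fun i => l i.castSucc)
          (ptrR S)) ∧ IsNodeOf (U (Fin.last (n + 1))) (l (Fin.last (n + 1))) M ∧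
        R.submatrix g g = link S M := by
      have ih : ∀ (E : Word) (S : Op (P.Idx × (∀ i : Fin (n + 1), κ i.castSucc) × E.Idx)), _ :=
        fun E S => seqComp_iff (κ := fun i : Fin (n + 1) => κ i.castSucc)
          (node := fun i => node i.castSucc) (U := fun i => U i.castSucc)
          (l := fun i => l i.castSucc) (fun i => hU _) (fun i => hl _) (fun i => hnode _)
          (P := P) (F := E) (R := S)
      constructor
      · rintro ⟨E, S, M, hS, hM, rfl⟩
        refine ⟨E, _, M, ⟨?_, ((ih E S).mp hS).2⟩, (hnode _ _ _ _).mp hM, ?_⟩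
        · exact ((ih E S).mp hS).1.submatrix _
        · rw [Matrix.submatrix_submatrix]
          exact (congrArg₂ _ g.symm_comp_self g.symm_comp_self).trans (Matrix.submatrix_id_id _)
      · rintro ⟨E, S, M, ⟨hS, hS'⟩, hM, hR⟩
        refine ⟨E, S.submatrix (Equiv.prodAssoc _ _ _).symm (Equiv.prodAssoc _ _ _).symm, M,
          (ih E _).mpr ⟨hS.submatrix _, ?_⟩, (hnode _ _ _ _).mpr hM, ?_⟩
        · exact hS'
        · have : R = (link S M).submatrix g.symm g.symm := by
            rw [← hR, Matrix.submatrix_submatrix, Equiv.self_comp_symm, Matrix.submatrix_id_id]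
          exact this
    rw [hS]
    constructor
    · rintro ⟨E, S, M, ⟨hS, hS'⟩, hM, hR⟩
      have hRp : R.PosSemidef := by
        rw [← Matrix.posSemidef_submatrix_equiv g, hR]
        exact posSemidef_link hS hM.1
      refine ⟨hRp, ?_⟩
      rw [isNetAff_succ hU (hl _).ne' (isHermitian_ptrR (hRp.isHermitian.submatrix _))]
      refine ⟨ptrR S, hS', fun Y hY => ?_⟩
      -- The operator `T` of the recursion is the marginal of the partial composite over the memory.
      rw [rslice_marginal, ← rslice_link_of_isNodeOf hM hY, ← hR]
    · rintro ⟨hR, h⟩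
      rw [isNetAff_succ hU (hl _).ne' (isHermitian_ptrR (hR.isHermitian.submatrix _))] at h
      obtain ⟨T, hT, hY⟩ := h
      simp only [rslice_marginal] at hY
      -- Split off the last node; the remaining `S` is positive with marginal `T`, so the induction
      -- hypothesis realizes it as a network ending in `E`.
      obtain ⟨E, S, M, hS, hST, hM, hlink⟩ :=
        exists_link (hU _) (hl _) (hR.submatrix g) hY
      exact ⟨E, S, M, ⟨hS, by rw [hST]; exact hT⟩, hM, hlink.symm⟩

end Realization

/-! ### Transport of the network constraint along relabellings of the slots -/

section NetworkReindex

variable {m : ℕ} {κ κ' : Fin m → Type} (e : ∀ i, κ i ≃ κ' i)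

theorem map_piTens (U : ∀ i, Submodule ℝ (Op (κ i))) :
    (piTens U).map (reix (Equiv.piCongrRight e)).toLinearMap =
      piTens fun i => (U i).map (reix (e i)).toLinearMap := by
  apply le_antisymm
  · rw [Submodule.map_le_iff_le_comap, piTens, Submodule.span_le]
    rintro _ ⟨A, hA, rfl⟩
    exact Submodule.subset_span ⟨fun i => reix (e i) (A i),
      fun i => Submodule.mem_map_of_mem (hA i), rfl⟩
  · rw [piTens, Submodule.span_le]
    rintro _ ⟨A, hA, rfl⟩
    choose B hB hBA using hA
    refine ⟨piKron B, Submodule.subset_span ⟨B, hB, rfl⟩, ?_⟩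
    rw [← funext hBA]
    rfl

theorem map_stair [∀ i, DecidableEq (κ i)] [∀ i, DecidableEq (κ' i)]
    (U : ∀ i, Submodule ℝ (Op (κ i))) (i : Fin m) :
    (stair U i).map (reix (Equiv.piCongrRight e)).toLinearMap =
      stair (fun i => (U i).map (reix (e i)).toLinearMap) i := by
  rw [stair, map_piTens, stair]
  congr 1
  ext1 j
  split_ifs
  · exact map_Hrm (e j)
  · rfl
  · exact map_IdSp (e j)

theorem isNetAff_map_iff {ρ : Type} [Fintype ρ] [DecidableEq ρ] [∀ i, DecidableEq (κ i)]
    [∀ i, DecidableEq (κ' i)] (U : ∀ i, Submodule ℝ (Op (κ i))) (l : Fin m → ℝ)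
    (R : Op (ρ × ∀ i, κ' i)) :
    IsNetAff (fun i => (U i).map (reix (e i)).toLinearMap) l R ↔
      IsNetAff U l (R.submatrix ((Equiv.refl ρ).prodCongr (Equiv.piCongrRight e))
        ((Equiv.refl ρ).prodCongr (Equiv.piCongrRight e))) := by
  have h : tens (Hrm ρ) (⨆ i, stair (fun i => (U i).map (reix (e i)).toLinearMap) i) =
      (tens (Hrm ρ) (⨆ i, stair U i)).map
        (reix ((Equiv.refl ρ).prodCongr (Equiv.piCongrRight e))).toLinearMap := by
    rw [map_tens, map_Hrm, Submodule.map_iSup]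
    simp only [map_stair]
  rw [IsNetAff, h, Submodule.mem_map_equiv, IsNetAff, map_sub, map_smul, reix_symm_apply,
    reix_symm_apply, Matrix.submatrix_one_equiv]

end NetworkReindex

/-! ### Characterizations of networks, bi-tooth combs and bi-slot combs -/

theorem isNetwork_iff {n : ℕ} {x : Fin (n + 1) → Ty} {P F : Word}
    {R : Op (P.Idx × (∀ i, (x i).Idx) × F.Idx)} :
    IsNetwork x P F R ↔ R.PosSemidef ∧
      IsNetAff (fun i => (x i).Delta) (fun i => (x i).lam)
        (ptrR (R.submatrix (Equiv.prodAssoc P.Idx (∀ i, (x i).Idx) F.Idx)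
          (Equiv.prodAssoc P.Idx (∀ i, (x i).Idx) F.Idx))) :=
  seqComp_iff (fun i => (x i).Delta_le_Trl) (fun i => (x i).lam_pos) fun _ _ _ _ => isNode_iff

theorem isBiTooth_iff {n : ℕ} {d : Fin (n + 1) → ℕ+} {R : Op (∀ i, (bi (d i)).Idx)} :
    IsBiTooth d R ↔ R.PosSemidef ∧ ∃ X ∈ ⨆ i, stair (fun j => (bi (d j)).Delta) i,
      R = (1 / ∏ i, (d i : ℝ)) • 1 + X := by
  let e : Word.triv.Idx × (∀ i, (bi (d i)).Idx) × Word.triv.Idx ≃ ∀ i, (bi (d i)).Idx :=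
    (Equiv.uniqueProd _ Word.triv.Idx).trans (Equiv.prodUnique _ Word.triv.Idx)
  have hpos : (padTriv R).PosSemidef ↔ R.PosSemidef := Matrix.posSemidef_submatrix_equiv e
  have hR : ptrR ((padTriv R).submatrix (Equiv.prodAssoc _ _ _) (Equiv.prodAssoc _ _ _)) =
      reix (Equiv.uniqueProd (∀ i, (bi (d i)).Idx) Word.triv.Idx).symm R := by
    ext p q
    exact Fintype.sum_unique (ι := Word.triv.Idx) fun _ => R p.2 q.2
  have hl : ∏ i, (bi (d i)).lam = 1 / ∏ i, (d i : ℝ) := by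
    simp only [lam_bi, Finset.prod_div_distrib, Finset.prod_const_one]
  rw [IsBiTooth, isNetwork_iff, hpos, hR, IsNetAff, tens_unique_left, hl, Submodule.mem_map_equiv,
    map_sub, LinearEquiv.symm_apply_apply, map_smul, reix_symm_apply, Matrix.submatrix_one_equiv]
  refine and_congr_right fun _ => ⟨fun h => ⟨_, h, (add_sub_cancel _ _).symm⟩, ?_⟩
  rintro ⟨X, hX, h⟩
  rw [h, add_sub_cancel_left]
  exact hX

/-- The slot type `(Â → B̂) → I` has direction space `bar Δ` up to a trivial factor, and weight
`1/(d² · 1/d) = 1/d`. -/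
theorem isBiSlot_iff {n : ℕ} {d : Fin (n + 1) → ℕ+} {P F : Word}
    {R : Op (P.Idx × (∀ i, (bi (d i)).Idx) × F.Idx)} :
    IsBiSlot d P F R ↔ R.PosSemidef ∧
      IsNetAff (fun i => bar (bi (d i)).Delta) (fun i => 1 / (d i : ℝ))
        (ptrR (R.submatrix (Equiv.prodAssoc P.Idx (∀ i, (bi (d i)).Idx) F.Idx)
          (Equiv.prodAssoc P.Idx (∀ i, (bi (d i)).Idx) F.Idx))) := by
  let e : ∀ i, (bi (d i)).Idx ≃ (bi (d i)).func.Idx :=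
    fun i => (Equiv.prodUnique (bi (d i)).Idx Word.triv.Idx).symm
  let f : P.Idx × (∀ i, (bi (d i)).func.Idx) × F.Idx ≃ P.Idx × (∀ i, (bi (d i)).Idx) × F.Idx :=
    (Equiv.refl _).prodCongr ((Equiv.piCongrRight e).symm.prodCongr (Equiv.refl _))
  have h0 : IsBiSlot d P F R ↔ IsNetwork (fun i => (bi (d i)).func) P F (R.submatrix f f) := Iff.rfl
  have hU : (fun i => (bi (d i)).func.Delta) =
      fun i => (bar (bi (d i)).Delta).map (reix (e i)).toLinearMap :=
    funext fun i => Delta_func _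
  have hl : (fun i => (bi (d i)).func.lam) = fun i => 1 / (d i : ℝ) :=
    funext fun i => (lam_func _).trans (lam_func_bi _)
  rw [h0, isNetwork_iff, Matrix.posSemidef_submatrix_equiv, hU, hl, isNetAff_map_iff]
  rfl

/-- Bistochastic supermaps satisfy `IsNodeOf` with the same space and weight as the nodes of a
bi-slot comb, so `seqComp_iff` gives both compositions the same characterization. -/
theorem isBiSlot_iff_seqComp {n : ℕ} {d : Fin (n + 1) → ℕ+} {P F : Word}
    {R : Op (P.Idx × (∀ i, (bi (d i)).Idx) × F.Idx)} :
    IsBiSlot d P F R ↔ SeqComp (fun i E E' M => IsBiSupermap (d i) E E' M) P F R := by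
  rw [isBiSlot_iff]
  exact (seqComp_iff (κ := fun i => (bi (d i)).Idx)
    (node := fun i E E' M => IsBiSupermap (d i) E E' M) (U := fun i => bar (bi (d i)).Delta)
    (l := fun i => 1 / (d i : ℝ)) (fun i => bar_le_Trl _)
    (fun i => one_div_pos.mpr (Nat.cast_pos.mpr (d i).pos)) fun _ _ _ _ => isBiSupermap_iff).symm

theorem isNode_bi_iff {d : ℕ+} {E F : Word} {M : Op (E.Idx × (bi d).Idx × F.Idx)} :
    IsNode (bi d) E F M ↔ IsBiChannel d E F M := by
  rw [isNode_iff, isBiChannel_iff, lam_bi]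

end HOQ
end

open HOQ in
theorem mainTheorem3 (n : ℕ) (x : Fin (n + 1) → Ty) (d : Fin (n + 1) → ℕ+) (P F : Word) :
    -- networks of higher-order maps
    (∀ R : Op (P.Idx × (∀ i, (x i).Idx) × F.Idx),
      IsNetwork x P F R ↔
        R.PosSemidef ∧ ∃ X ∈ DeltaNet (fun i => (x i).Delta) P F,
          R = ((Fintype.card F.Idx : ℝ)⁻¹ * ∏ i, (x i).lam) • 1 + X) ∧
    -- bi-tooth combs
    (∀ R : Op (∀ i, (bi (d i)).Idx),
      IsBiTooth d R ↔
        R.PosSemidef ∧ ∃ X ∈ ⨆ i, stair (fun j => (bi (d j)).Delta) i,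
          R = (1 / ∏ i, (d i : ℝ)) • 1 + X) ∧
    -- bi-slot combs
    (∀ R : Op (P.Idx × (∀ i, (bi (d i)).Idx) × F.Idx),
      IsBiSlot d P F R ↔
        R.PosSemidef ∧ ∃ X ∈ DeltaNet (fun i => bar (bi (d i)).Delta) P F,
          R = (1 / ((Fintype.card F.Idx : ℝ) * ∏ i, (d i : ℝ))) • 1 + X) ∧
    -- a node on a bistochastic channel is a partially bistochastic channel
    (∀ (i : Fin (n + 1)) (M : Op (P.Idx × (bi (d i)).Idx × F.Idx)),
      IsNode (bi (d i)) P F M ↔ IsBiChannel (d i) P F M) ∧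
    -- bi-tooth combs are the sequential compositions of partially bistochastic channels
    (∀ R : Op (∀ i, (bi (d i)).Idx),
      IsBiTooth d R ↔
        SeqComp (fun i E E' M => IsBiChannel (d i) E E' M) Word.triv Word.triv (padTriv R)) ∧
    -- bi-slot combs are the sequential compositions of bistochastic supermaps
    (∀ R : Op (P.Idx × (∀ i, (bi (d i)).Idx) × F.Idx),
      IsBiSlot d P F R ↔
        SeqComp (fun i E E' M => IsBiSupermap (d i) E E' M) P F R) := by
  refine ⟨fun R => ?_, fun R => isBiTooth_iff, fun R => ?_, fun i M => isNode_bi_iff, fun R => ?_,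
    fun R => isBiSlot_iff_seqComp⟩
  · rw [isNetwork_iff]
    exact and_congr_right fun hR =>
      (mem_DeltaNet_iff (fun i => (x i).Delta_le_Trl) (fun i => (x i).lam) hR.isHermitian).symm
  · rw [isBiSlot_iff]
    refine and_congr_right fun hR => ?_
    rw [← mem_DeltaNet_iff (fun i => bar_le_Trl _) _ hR.isHermitian]
    have hc : (Fintype.card F.Idx : ℝ)⁻¹ * ∏ i, 1 / (d i : ℝ) =
        1 / ((Fintype.card F.Idx : ℝ) * ∏ i, (d i : ℝ)) := by
      rw [Finset.prod_div_distrib, Finset.prod_const_one, inv_eq_one_div, div_mul_div_comm, mul_one]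
    rw [hc]
  · have h : (fun (i : Fin (n + 1)) E E' M => IsBiChannel (d i) E E' M) =
        fun i E E' M => IsNode (bi (d i)) E E' M := by
      funext i E E' M
      exact propext isNode_bi_iff.symm
    rw [h]
    rfl
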